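/- **Walsh functions, tiles, bitiles.** For $l\ge 0$ the Walsh functions $w_l:\mathbb R\to\mathbb R$ are given by $w_0=\chi_{[0,1)}$, $w_{2l}(x)=w_l(2x)+w_l(2x-1)$, $w_{2l+1}(x)=w_l(2x)-w_l(2x-1)$. A tile is a rectangle $P=I_P\times\omega_P=[2^{-k}n,2^{-k}(n+1))\times[2^kl,2^k(l+1))$ with $k,n\in\mathbb Z$ and $l\in\mathbb Z_{\ge0}$; its wave packet is $\phi_P(x)=2^{k/2}w_l(2^kx-n)$. A bitile is a rectangle $P=[2^{-k}n,2^{-k}(n+1))\times[2^{k+1}l,2^{k+1}(l+1))$ with $k,n\in\mathbb Z$ and $l\in\mathbb Z_{\ge0}$; its sub-tiles are $P_1=[2^{-k}n,2^{-k}(n+1))\times[2^k\,2l,2^k(2l+1))$ and $P_2=[2^{-k}n,2^{-k}(n+1))\times[2^k(2l+1),2^k(2l+2))$. For a set $\mathbf P$ of bitiles and a (Lebesgue) measurable function $N:\mathbb R\to\mathbb R$, the linearized Walsh–Carleson operator is $$C_{walsh,\mathbf P}(f)(x)=\sum_{P\in\mathbf P}\langle f,\phi_{P_1}\rangle\,\phi_{P_1}(x)\,\chi_{\{x:\,N(x)\in\omega_{P_2}\}}(x),\qquad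 \langle f,\phi_{P_1}\rangle=\int_{\mathbb R}f\,\phi_{P_1}.$$ **Theorem 1.7.** Let $1<p<\infty$. There is a constant $C=C(p)<\infty$, depending only on $p$, such that for every (finite or infinite) set $\mathbf P$ of bitiles, every measurable $N:\mathbb R\to\mathbb R$ and every $f\in L^p(\mathbb R;\mathbb C)$, the series defining $C_{walsh,\mathbf P}(f)(x)$ converges absolutely for every $x\in\mathbb R$, its sum $C_{walsh,\mathbf P}(f)$ belongs to $L^p(\mathbb R;\mathbb C)$, and $$\|C_{walsh,\mathbf P}(f)\|_{L^p(\mathbb R)}\le C\,\|f\|_{L^p(\mathbb R)}.$$ -/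

import Mathlib

open MeasureTheory
open scoped ENNReal NNReal

noncomputable section

/-- The Walsh functions `w_l : ℝ → ℝ`, `l ≥ 0`: `w_0` is the indicator of `[0,1)`, and
`w_{2l}(x) = w_l(2x) + w_l(2x-1)`, `w_{2l+1}(x) = w_l(2x) - w_l(2x-1)`
(see `walsh_zero`, `walsh_even`, `walsh_odd`). -/
def walsh (m : ℕ) (x : ℝ) : ℝ :=
  if m = 0 then (Set.Ico (0 : ℝ) 1).indicator 1 x
  else if m % 2 = 0 then walsh (m / 2) (2 * x) + walsh (m / 2) (2 * x - 1)
  else walsh (m / 2) (2 * x) - walsh (m / 2) (2 * x - 1)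
termination_by m
decreasing_by all_goals omega

theorem walsh_zero : walsh 0 = (Set.Ico (0 : ℝ) 1).indicator 1 := by
  funext x
  rw [walsh, if_pos rfl]

theorem walsh_even (l : ℕ) (x : ℝ) :
    walsh (2 * l) x = walsh l (2 * x) + walsh l (2 * x - 1) := by
  rcases Nat.eq_zero_or_pos l with rfl | hl
  · rw [Nat.mul_zero, walsh_zero]
    simp only [Set.indicator_apply, Set.mem_Ico, Pi.one_apply]
    split_ifs <;> first | (exfalso; grind) | norm_num
  · have h1 : 2 * l ≠ 0 := by omega
    have h2 : 2 * l % 2 = 0 := by omega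
    have h3 : 2 * l / 2 = l := by omega
    rw [walsh, if_neg h1, if_pos h2, h3]

theorem walsh_odd (l : ℕ) (x : ℝ) :
    walsh (2 * l + 1) x = walsh l (2 * x) - walsh l (2 * x - 1) := by
  have h1 : 2 * l + 1 ≠ 0 := by omega
  have h2 : ¬ (2 * l + 1) % 2 = 0 := by omega
  have h3 : (2 * l + 1) / 2 = l := by omega
  rw [walsh, if_neg h1, if_neg h2, h3]

/-- The tile `[2^{-k} n, 2^{-k} (n+1)) × [2^k l, 2^k (l+1))`, a dyadic rectangle of area one,
encoded by its integer parameters `k, n ∈ ℤ` and `l ≥ 0`. -/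
@[ext] structure Tile where
  k : ℤ
  n : ℤ
  l : ℕ

/-- The time interval `I_P = [2^{-k} n, 2^{-k} (n+1))` of a tile. -/
def Tile.time (P : Tile) : Set ℝ :=
  Set.Ico ((2 : ℝ) ^ (-P.k) * P.n) ((2 : ℝ) ^ (-P.k) * (P.n + 1))

/-- The frequency interval `ω_P = [2^k l, 2^k (l+1))` of a tile. -/
def Tile.freq (P : Tile) : Set ℝ :=
  Set.Ico ((2 : ℝ) ^ P.k * P.l) ((2 : ℝ) ^ P.k * (P.l + 1))

/-- The Walsh wave packet `φ_P(x) = 2^{k/2} w_l(2^k x - n)`. -/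
def Tile.wavePacket (P : Tile) (x : ℝ) : ℝ :=
  (2 : ℝ) ^ ((P.k : ℝ) / 2) * walsh P.l ((2 : ℝ) ^ P.k * x - P.n)

/-- The bitile `[2^{-k} n, 2^{-k} (n+1)) × [2^{k+1} l, 2^{k+1} (l+1))`, a dyadic rectangle of
area two, encoded by its integer parameters `k, n ∈ ℤ` and `l ≥ 0`. -/
@[ext] structure Bitile where
  k : ℤ
  n : ℤ
  l : ℕ

/-- The time interval `I_P = [2^{-k} n, 2^{-k} (n+1))` of a bitile. -/
def Bitile.time (P : Bitile) : Set ℝ :=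
  Set.Ico ((2 : ℝ) ^ (-P.k) * P.n) ((2 : ℝ) ^ (-P.k) * (P.n + 1))

/-- The frequency interval `ω_P = [2^{k+1} l, 2^{k+1} (l+1))` of a bitile. -/
def Bitile.freq (P : Bitile) : Set ℝ :=
  Set.Ico ((2 : ℝ) ^ (P.k + 1) * P.l) ((2 : ℝ) ^ (P.k + 1) * (P.l + 1))

/-- The lower sub-tile `P_1 = [2^{-k} n, 2^{-k} (n+1)) × [2^k 2l, 2^k (2l+1))`. -/
def Bitile.sub₁ (P : Bitile) : Tile := ⟨P.k, P.n, 2 * P.l⟩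

/-- The upper sub-tile `P_2 = [2^{-k} n, 2^{-k} (n+1)) × [2^k (2l+1), 2^k (2l+2))`. -/
def Bitile.sub₂ (P : Bitile) : Tile := ⟨P.k, P.n, 2 * P.l + 1⟩

/-- A bitile is the union of its two sub-tiles. -/
theorem Bitile.prod_eq_union (P : Bitile) :
    P.time ×ˢ P.freq = P.sub₁.time ×ˢ P.sub₁.freq ∪ P.sub₂.time ×ˢ P.sub₂.freq := by
  have h : (0 : ℝ) < (2 : ℝ) ^ P.k := by positivity
  have h2 : P.freq = P.sub₁.freq ∪ P.sub₂.freq := by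
    simp only [Bitile.freq, Tile.freq, Bitile.sub₁, Bitile.sub₂]
    rw [zpow_add_one₀ (two_ne_zero)]
    push_cast
    rw [Set.Ico_union_Ico_eq_Ico (by nlinarith) (by nlinarith)]
    congr 1 <;> ring
  rw [h2, Set.prod_union]
  rfl

/-- The pairing `⟨f, φ_P⟩ = ∫ f φ_P` (the wave packet is real-valued). -/
def Tile.coeff (P : Tile) (f : ℝ → ℂ) : ℂ :=
  ∫ y, f y * (P.wavePacket y : ℂ)

/-- The summand `⟨f, φ_{P_1}⟩ φ_{P_1} χ_{{x : N(x) ∈ ω_{P_2}}}` of the Walsh–Carleson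
operator. -/
def walshCarlesonTerm (N : ℝ → ℝ) (f : ℝ → ℂ) (P : Bitile) : ℝ → ℂ :=
  {x | N x ∈ P.sub₂.freq}.indicator
    (fun x => P.sub₁.coeff f * (P.sub₁.wavePacket x : ℂ))

/-- The linearized Walsh–Carleson operator of an arbitrary, finite or infinite, set of bitiles:
`C_{walsh,𝓟} f(x) = ∑_{P ∈ 𝓟} ⟨f, φ_{P_1}⟩ φ_{P_1}(x) χ_{{x : N(x) ∈ ω_{P_2}}}(x)`, where the
sum is the unconditional sum at each point `x`. -/
def walshCarleson (𝓟 : Set Bitile) (N : ℝ → ℝ) (f : ℝ → ℂ) (x : ℝ) : ℂ :=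
  ∑' P : 𝓟, walshCarlesonTerm N f P x

/-- For a finite collection the operator is the usual finite sum. -/
theorem walshCarleson_finset (s : Finset Bitile) (N : ℝ → ℝ) (f : ℝ → ℂ) (x : ℝ) :
    walshCarleson (s : Set Bitile) N f x = ∑ P ∈ s, walshCarlesonTerm N f P x :=
  Finset.tsum_subtype' s fun P => walshCarlesonTerm N f P x

end

/-!
# The Walsh–Carleson theorem

The proof is the time-frequency argument of Lacey and Thiele in the Walsh model. A finite
collection `T` of bitiles is measured by two quantities. Its *size* (`HasSize`) bounds the energy
`∑ |⟨f, φ_{P_1}⟩|²`, relative to `|I|`, over the trees of upper type, whose top frequency lies in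
every `ω_{P_2}`. Its *density* (`HasDens`) bounds the proportion of a set `E` inside `I_Q` on which
`N` takes values in `ω_Q`, for the bitiles `Q` above members of `T`.

* On a single tree with top interval `I` the `L¹(E)` norm of the Walsh–Carleson sum is
  `O(density · size · |I|)` (`tree_estimate`). After division by the Walsh character of the top
  frequency the partial sums over the upper part of the tree form a dyadic martingale
  (`sum_upper_eq`); the operator takes differences of it, and its maximal function is handled by a
  Bellman function adapted to `E` (`lintegral_tree_le`). The lower part has at most one nonzero term
  at each point.
* The bitiles responsible for a large density, or for a large size, can be removed in trees with
  little total top length (`density_selection`, `size_selection`). The first rests on the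
  disjointness of maximal heavy bitiles, the second on Bessel's inequality for disjoint tiles
  (`sum_coeff_sq_le`).
* Lowering both thresholds step by step and summing a two-sided geometric series gives
  `∫_E |C_T f| ≤ C |E| σ^{1-θ} ρ^θ`, where `σ` bounds the size, `ρ² |E| = ‖f‖₂²` and `0 < θ < 1`
  (`exists_carlesonNorm_le`).

The size is controlled by averages of `|f|` over the ancestors of the time intervals
(`hasSize_of_average`). For `|f| ≤ χ_F` it is thus `O(1)`, which yields restricted weak type for the
exponents above two; and it is `O(|F| / |E|)` once the set where the dyadic maximal function of `f`
exceeds a multiple of `|F| / |E|` is removed from `E`, which yields the exponents between one and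
two. Decomposing `f` into its dyadic level sets, `exists_lintegral_rpow_le` interpolates between two
such exponents. All constants are uniform in the collection, so Fatou's lemma extends the bound to
infinite collections, for which the series converges absolutely because only one bitile per scale
contributes at a given point.
-/

noncomputable section

/-! ### Dyadic intervals -/

/-- The dyadic interval `[2^{-k} n, 2^{-k} (n+1))` of scale `k`. -/
def dyadic (k n : ℤ) : Set ℝ :=
  Set.Ico ((2 : ℝ) ^ (-k) * n) ((2 : ℝ) ^ (-k) * (n + 1))

/-- The index of the dyadic interval of scale `k` that contains `x`. -/
def cell (k : ℤ) (x : ℝ) : ℤ := ⌊(2 : ℝ) ^ k * x⌋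

theorem mem_dyadic {k n : ℤ} {x : ℝ} : x ∈ dyadic k n ↔ cell k x = n := by
  have h : (0 : ℝ) < (2 : ℝ) ^ k := by positivity
  rw [dyadic, cell, Int.floor_eq_iff, Set.mem_Ico, zpow_neg, inv_mul_le_iff₀ h,
    lt_inv_mul_iff₀ h]

theorem mem_dyadic_cell (k : ℤ) (x : ℝ) : x ∈ dyadic k (cell k x) := mem_dyadic.2 rfl

theorem cell_succ_ediv (k : ℤ) (x : ℝ) : cell (k + 1) x / 2 = cell k x := by
  have h1 := Int.floor_le ((2 : ℝ) ^ (k + 1) * x)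
  have h2 := Int.lt_floor_add_one ((2 : ℝ) ^ (k + 1) * x)
  have e : (2 : ℝ) ^ (k + 1) * x = 2 * ((2 : ℝ) ^ k * x) := by
    rw [zpow_add_one₀ two_ne_zero]; ring
  rw [eq_comm, cell, cell, Int.floor_eq_iff]
  rw [e] at h1 h2 ⊢
  set m := ⌊2 * ((2 : ℝ) ^ k * x)⌋
  have h3 : 2 * (m / 2) ≤ m := by omega
  have h4 : m + 1 ≤ 2 * (m / 2) + 2 := by omega
  have h3' : (2 : ℝ) * ((m / 2 : ℤ) : ℝ) ≤ m := by exact_mod_cast h3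
  have h4' : (m : ℝ) + 1 ≤ 2 * ((m / 2 : ℤ) : ℝ) + 2 := by exact_mod_cast h4
  constructor <;> linarith

theorem cell_eq_of_le {k k' : ℤ} (h : k ≤ k') {x y : ℝ} (hxy : cell k' x = cell k' y) :
    cell k x = cell k y := by
  induction k', h using Int.leInduction with
  | base => exact hxy
  | succ j _ ih => exact ih (by rw [← cell_succ_ediv j x, ← cell_succ_ediv j y, hxy])

/-- Dyadic intervals are nested. -/
theorem dyadic_subset {k k' n n' : ℤ} (h : k ≤ k') {x : ℝ} (hx : x ∈ dyadic k n)
    (hx' : x ∈ dyadic k' n') : dyadic k' n' ⊆ dyadic k n := by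
  intro y hy
  rw [mem_dyadic] at *
  rw [← hx]
  exact cell_eq_of_le h (by rw [hy, hx'])

theorem dyadic_left_mem (k n : ℤ) : (2 : ℝ) ^ (-k) * n ∈ dyadic k n := by
  have : (0 : ℝ) < (2 : ℝ) ^ (-k) := by positivity
  refine ⟨le_rfl, ?_⟩
  nlinarith

theorem dyadic_nonempty (k n : ℤ) : (dyadic k n).Nonempty := ⟨_, dyadic_left_mem k n⟩

theorem dyadic_subset_parent (k n : ℤ) : dyadic (k + 1) n ⊆ dyadic k (n / 2) := by
  intro x hx
  rw [mem_dyadic] at *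
  rw [← cell_succ_ediv, hx]

theorem dyadic_disjoint {k n n' : ℤ} (h : n ≠ n') : Disjoint (dyadic k n) (dyadic k n') := by
  rw [Set.disjoint_left]
  intro x hx hx'
  rw [mem_dyadic] at *
  exact h (hx ▸ hx')

theorem dyadic_eq_union (k n : ℤ) :
    dyadic k n = dyadic (k + 1) (2 * n) ∪ dyadic (k + 1) (2 * n + 1) := by
  ext x
  simp only [Set.mem_union, mem_dyadic, ← cell_succ_ediv k x]
  omega

theorem dyadic_child_disjoint (k n : ℤ) :
    Disjoint (dyadic (k + 1) (2 * n)) (dyadic (k + 1) (2 * n + 1)) :=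
  dyadic_disjoint (by omega)

theorem measurableSet_dyadic (k n : ℤ) : MeasurableSet (dyadic k n) := measurableSet_Ico

theorem volume_dyadic (k n : ℤ) : volume (dyadic k n) = ENNReal.ofReal ((2 : ℝ) ^ (-k)) := by
  rw [dyadic, Real.volume_Ico]
  congr 1
  ring

theorem measureReal_dyadic (k n : ℤ) : volume.real (dyadic k n) = (2 : ℝ) ^ (-k) := by
  rw [Measure.real, volume_dyadic, ENNReal.toReal_ofReal (by positivity)]

theorem volume_dyadic_ne_top (k n : ℤ) : volume (dyadic k n) ≠ ∞ := by
  rw [volume_dyadic]; exact ENNReal.ofReal_ne_top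

theorem dyadic_index_eq {k n n' : ℤ} {x : ℝ} (h : x ∈ dyadic k n) (h' : x ∈ dyadic k n') :
    n = n' := by
  rw [mem_dyadic] at *
  exact h ▸ h'

theorem dyadic_scale_le {k k' n n' : ℤ} (h : dyadic k' n' ⊆ dyadic k n) : k ≤ k' := by
  have := measure_mono (μ := volume) h
  rw [volume_dyadic, volume_dyadic, ENNReal.ofReal_le_ofReal_iff (by positivity),
    zpow_le_zpow_iff_right₀ (by norm_num)] at this
  omega

theorem Tile.time_eq (P : Tile) : P.time = dyadic P.k P.n := rfl

theorem Tile.freq_eq (P : Tile) : P.freq = dyadic (-P.k) P.l := by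
  simp [Tile.freq, dyadic]

theorem Bitile.time_eq (P : Bitile) : P.time = dyadic P.k P.n := rfl

theorem Bitile.freq_eq (P : Bitile) : P.freq = dyadic (-(P.k + 1)) P.l := by
  simp only [Bitile.freq, dyadic, neg_neg]; rfl

theorem Bitile.sub₁_freq_eq (P : Bitile) : P.sub₁.freq = dyadic (-P.k) (2 * P.l) := by
  rw [Tile.freq_eq]; simp [Bitile.sub₁]

theorem Bitile.sub₂_freq_eq (P : Bitile) : P.sub₂.freq = dyadic (-P.k) (2 * P.l + 1) := by
  rw [Tile.freq_eq]; simp [Bitile.sub₂]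

theorem Bitile.freq_eq_union (P : Bitile) : P.freq = P.sub₁.freq ∪ P.sub₂.freq := by
  rw [P.freq_eq, P.sub₁_freq_eq, P.sub₂_freq_eq, dyadic_eq_union]
  congr 2 <;> ring

theorem Bitile.sub₂_freq_subset (P : Bitile) : P.sub₂.freq ⊆ P.freq := by
  rw [P.freq_eq_union]; exact Set.subset_union_right

theorem Bitile.sub₁_freq_subset (P : Bitile) : P.sub₁.freq ⊆ P.freq := by
  rw [P.freq_eq_union]; exact Set.subset_union_left

theorem Bitile.sub_freq_disjoint (P : Bitile) : Disjoint P.sub₁.freq P.sub₂.freq := by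
  rw [P.sub₁_freq_eq, P.sub₂_freq_eq]
  exact dyadic_disjoint (by omega)

/-! ### Walsh wave packets -/

/-- The Walsh functions live on `[0, 1)`. -/
theorem walsh_eq_zero {l : ℕ} : ∀ {x : ℝ}, x ∉ Set.Ico (0 : ℝ) 1 → walsh l x = 0 := by
  induction l using Nat.strong_induction_on with
  | _ l ih =>
    intro x hx
    rcases Nat.eq_zero_or_pos l with rfl | hl
    · rw [walsh_zero, Set.indicator_of_notMem hx]
    have hx1 : 2 * x ∉ Set.Ico (0 : ℝ) 1 := by
      rw [Set.mem_Ico] at *; intro h; apply hx; constructor <;> linarith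
    have hx2 : 2 * x - 1 ∉ Set.Ico (0 : ℝ) 1 := by
      rw [Set.mem_Ico] at *; intro h; apply hx; constructor <;> linarith
    obtain ⟨m, rfl | rfl⟩ := Nat.even_or_odd' l
    · rw [walsh_even, ih m (by omega) hx1, ih m (by omega) hx2, add_zero]
    · rw [walsh_odd, ih m (by omega) hx1, ih m (by omega) hx2, sub_zero]

/-- The Walsh functions have modulus one on `[0, 1)`. -/
theorem abs_walsh {l : ℕ} : ∀ {x : ℝ}, x ∈ Set.Ico (0 : ℝ) 1 → |walsh l x| = 1 := by
  induction l using Nat.strong_induction_on with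
  | _ l ih =>
    intro x hx
    rcases Nat.eq_zero_or_pos l with rfl | hl
    · rw [walsh_zero, Set.indicator_of_mem hx]; simp
    rw [Set.mem_Ico] at hx
    rcases lt_or_ge x (1 / 2) with h | h
    · have hx1 : 2 * x ∈ Set.Ico (0 : ℝ) 1 := ⟨by linarith, by linarith⟩
      have hx2 : 2 * x - 1 ∉ Set.Ico (0 : ℝ) 1 := by
        rw [Set.mem_Ico]; intro h; linarith
      obtain ⟨m, rfl | rfl⟩ := Nat.even_or_odd' l
      · rw [walsh_even, walsh_eq_zero hx2, add_zero, ih m (by omega) hx1]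
      · rw [walsh_odd, walsh_eq_zero hx2, sub_zero, ih m (by omega) hx1]
    · have hx1 : 2 * x ∉ Set.Ico (0 : ℝ) 1 := by
        rw [Set.mem_Ico]; intro h; linarith
      have hx2 : 2 * x - 1 ∈ Set.Ico (0 : ℝ) 1 := ⟨by linarith, by linarith⟩
      obtain ⟨m, rfl | rfl⟩ := Nat.even_or_odd' l
      · rw [walsh_even, walsh_eq_zero hx1, zero_add, ih m (by omega) hx2]
      · rw [walsh_odd, walsh_eq_zero hx1, zero_sub, abs_neg, ih m (by omega) hx2]

theorem measurable_walsh (l : ℕ) : Measurable (walsh l) := by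
  induction l using Nat.strong_induction_on with
  | _ l ih =>
    rcases Nat.eq_zero_or_pos l with rfl | hl
    · rw [walsh_zero]; exact measurable_one.indicator measurableSet_Ico
    obtain ⟨m, rfl | rfl⟩ := Nat.even_or_odd' l
    · rw [funext (walsh_even m)]
      have := ih m (by omega)
      fun_prop
    · rw [funext (walsh_odd m)]
      have := ih m (by omega)
      fun_prop

theorem Tile.measurable_wavePacket (P : Tile) : Measurable P.wavePacket := by
  have := measurable_walsh P.l
  unfold Tile.wavePacket
  fun_prop

theorem Tile.mem_time_iff (P : Tile) (x : ℝ) :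
    x ∈ P.time ↔ (2 : ℝ) ^ P.k * x - P.n ∈ Set.Ico (0 : ℝ) 1 := by
  rw [P.time_eq, mem_dyadic, cell, Int.floor_eq_iff, Set.mem_Ico]
  constructor <;> rintro ⟨h1, h2⟩ <;> constructor <;> linarith

theorem Tile.wavePacket_eq_zero (P : Tile) {x : ℝ} (h : x ∉ P.time) : P.wavePacket x = 0 := by
  rw [P.mem_time_iff] at h
  rw [Tile.wavePacket, walsh_eq_zero h, mul_zero]

theorem Tile.abs_wavePacket (P : Tile) {x : ℝ} (h : x ∈ P.time) :
    |P.wavePacket x| = (2 : ℝ) ^ ((P.k : ℝ) / 2) := by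
  rw [P.mem_time_iff] at h
  rw [Tile.wavePacket, abs_mul, abs_walsh h, mul_one, abs_of_pos (by positivity)]

theorem Tile.abs_wavePacket_le (P : Tile) (x : ℝ) :
    |P.wavePacket x| ≤ (2 : ℝ) ^ ((P.k : ℝ) / 2) := by
  by_cases h : x ∈ P.time
  · exact (P.abs_wavePacket h).le
  · rw [P.wavePacket_eq_zero h, abs_zero]; positivity

theorem rpow_half_sq (k : ℤ) : ((2 : ℝ) ^ ((k : ℝ) / 2)) ^ 2 = (2 : ℝ) ^ k := by
  rw [← Real.rpow_natCast, ← Real.rpow_mul (by norm_num), ← Real.rpow_intCast]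
  congr 1
  push_cast; ring

theorem rpow_half_succ (k : ℤ) :
    (2 : ℝ) ^ ((k : ℝ) / 2) = (√2)⁻¹ * (2 : ℝ) ^ (((k + 1 : ℤ) : ℝ) / 2) := by
  rw [Real.sqrt_eq_rpow, ← Real.rpow_neg (by norm_num), ← Real.rpow_add (by norm_num)]
  congr 1
  push_cast; ring

/-- A wave packet of even frequency index is the normalized sum of the two packets of half the
frequency index over the halves of its time interval. -/
theorem wavePacket_even (k n : ℤ) (l : ℕ) (x : ℝ) :
    (Tile.mk k n (2 * l)).wavePacket x = (√2)⁻¹ *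
      ((Tile.mk (k + 1) (2 * n) l).wavePacket x +
        (Tile.mk (k + 1) (2 * n + 1) l).wavePacket x) := by
  simp only [Tile.wavePacket]
  rw [walsh_even, rpow_half_succ, zpow_add_one₀ two_ne_zero, ← mul_add, mul_assoc]
  congr 4 <;> (push_cast; ring)

/-- A wave packet of odd frequency index is the normalized difference of the two packets of half
the frequency index over the halves of its time interval. -/
theorem wavePacket_odd (k n : ℤ) (l : ℕ) (x : ℝ) :
    (Tile.mk k n (2 * l + 1)).wavePacket x = (√2)⁻¹ *
      ((Tile.mk (k + 1) (2 * n) l).wavePacket x -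
        (Tile.mk (k + 1) (2 * n + 1) l).wavePacket x) := by
  simp only [Tile.wavePacket]
  rw [walsh_odd, rpow_half_succ, zpow_add_one₀ two_ne_zero, ← mul_sub, mul_assoc]
  congr 4 <;> (push_cast; ring)

/-! ### The Walsh character of a frequency -/

/-- The recursion for Walsh functions in multiplicative form, on the circle `ℝ / ℤ`. -/
theorem walsh_fract (m : ℕ) (y : ℝ) :
    walsh m (Int.fract y) =
      (if m % 2 = 1 ∧ ⌊2 * y⌋ % 2 = 1 then -1 else 1) * walsh (m / 2) (Int.fract (2 * y)) := by
  have h0 := Int.fract_nonneg y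
  have h1 := Int.fract_lt_one y
  have hy : y = ⌊y⌋ + Int.fract y := (Int.floor_add_fract y).symm
  rcases lt_or_ge (Int.fract y) (1 / 2) with h | h
  · have hf : ⌊2 * y⌋ = 2 * ⌊y⌋ := by
      rw [Int.floor_eq_iff]; push_cast; constructor <;> linarith
    have hfr : Int.fract (2 * y) = 2 * Int.fract y := by
      rw [Int.fract, hf]; push_cast; linarith
    have hx2 : 2 * Int.fract y - 1 ∉ Set.Ico (0 : ℝ) 1 := by
      rw [Set.mem_Ico]; intro h; linarith
    have hne : ¬ (m % 2 = 1 ∧ ⌊2 * y⌋ % 2 = 1) := by omega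
    rw [if_neg hne, one_mul, hfr]
    obtain ⟨l, rfl | rfl⟩ := Nat.even_or_odd' m
    · rw [walsh_even, walsh_eq_zero hx2, add_zero]; congr; omega
    · rw [walsh_odd, walsh_eq_zero hx2, sub_zero]; congr; omega
  · have hf : ⌊2 * y⌋ = 2 * ⌊y⌋ + 1 := by
      rw [Int.floor_eq_iff]; push_cast; constructor <;> linarith
    have hfr : Int.fract (2 * y) = 2 * Int.fract y - 1 := by
      rw [Int.fract, hf]; push_cast; linarith
    have hx1 : 2 * Int.fract y ∉ Set.Ico (0 : ℝ) 1 := by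
      rw [Set.mem_Ico]; intro h; linarith
    rw [hfr]
    obtain ⟨l, rfl | rfl⟩ := Nat.even_or_odd' m
    · rw [walsh_even, walsh_eq_zero hx1, zero_add, if_neg (by omega), one_mul]; congr; omega
    · rw [walsh_odd, walsh_eq_zero hx1, zero_sub, if_pos (by omega), neg_one_mul]
      congr; omega

/-- The part of the Walsh character of frequency `ξ` that oscillates on dyadic intervals of scale
`k`: up to normalization, this is the wave packet whose tile has scale `k` and contains `ξ`. -/
def walshChar (k : ℤ) (ξ x : ℝ) : ℝ :=
  walsh (cell (-k) ξ).toNat (Int.fract ((2 : ℝ) ^ k * x))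

theorem abs_walshChar (k : ℤ) (ξ x : ℝ) : |walshChar k ξ x| = 1 :=
  abs_walsh ⟨Int.fract_nonneg _, Int.fract_lt_one _⟩

theorem walshChar_eq (k : ℤ) {ξ : ℝ} (hξ : 0 ≤ ξ) (x : ℝ) :
    walshChar k ξ x = (if cell (-k) ξ % 2 = 1 ∧ cell (k + 1) x % 2 = 1 then -1 else 1) *
      walshChar (k + 1) ξ x := by
  have h0 : 0 ≤ cell (-k) ξ := Int.floor_nonneg.2 (by positivity)
  have h1 := cell_succ_ediv (-(k + 1)) ξ
  rw [show -(k + 1) + 1 = -k by ring] at h1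
  have e : 2 * ((2 : ℝ) ^ k * x) = (2 : ℝ) ^ (k + 1) * x := by
    rw [zpow_add_one₀ two_ne_zero]; ring
  rw [walshChar, walsh_fract, walshChar, ← h1, e]
  congr 2
  · change (_ ∧ cell (k + 1) x % 2 = 1) = _
    rw [eq_iff_iff]; constructor <;> rintro ⟨a, b⟩ <;> refine ⟨?_, b⟩ <;> omega
  · omega

theorem Tile.wavePacket_eq (P : Tile) {x : ℝ} (hx : x ∈ P.time) :
    P.wavePacket x = (2 : ℝ) ^ ((P.k : ℝ) / 2) * walsh P.l (Int.fract ((2 : ℝ) ^ P.k * x)) := by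
  rw [P.time_eq, mem_dyadic, cell] at hx
  rw [Tile.wavePacket, Int.fract, hx]

theorem Bitile.wavePacket_sub₁ (P : Bitile) {x ξ : ℝ} (hx : x ∈ P.time) (hξ : ξ ∈ P.freq) :
    P.sub₁.wavePacket x = (2 : ℝ) ^ ((P.k : ℝ) / 2) * walshChar (P.k + 1) ξ x := by
  rw [P.freq_eq, mem_dyadic] at hξ
  rw [Tile.wavePacket_eq _ hx]
  simp only [Bitile.sub₁]
  rw [walsh_fract, if_neg (by omega), one_mul, walshChar, hξ]
  congr 2
  · simp
  · rw [zpow_add_one₀ two_ne_zero]; ring_nf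

/-! ### Orthogonality of wave packets -/

theorem Tile.integrable_mul_wavePacket (P Q : Tile) :
    Integrable (fun x => P.wavePacket x * Q.wavePacket x) := by
  have : IntegrableOn (fun x => P.wavePacket x * Q.wavePacket x) P.time := by
    refine Measure.integrableOn_of_bounded
      (M := (2 : ℝ) ^ ((P.k : ℝ) / 2) * (2 : ℝ) ^ ((Q.k : ℝ) / 2)) (volume_dyadic_ne_top _ _) ?_ ?_
    · exact (P.measurable_wavePacket.mul Q.measurable_wavePacket).aestronglyMeasurable
    · refine Filter.Eventually.of_forall fun x => ?_
      rw [Real.norm_eq_abs, abs_mul]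
      exact mul_le_mul (P.abs_wavePacket_le x) (Q.abs_wavePacket_le x) (abs_nonneg _)
        (by positivity)
  refine (integrableOn_iff_integrable_of_support_subset fun x hx => ?_).1 this
  by_contra h
  exact hx (by simp [P.wavePacket_eq_zero h])

theorem Tile.wavePacket_sq (P : Tile) (x : ℝ) :
    P.wavePacket x * P.wavePacket x = P.time.indicator (fun _ => (2 : ℝ) ^ P.k) x := by
  by_cases h : x ∈ P.time
  · rw [Set.indicator_of_mem h, ← abs_mul_abs_self, P.abs_wavePacket h, ← sq, rpow_half_sq]
  · rw [Set.indicator_of_notMem h, P.wavePacket_eq_zero h, mul_zero]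

theorem Tile.integral_wavePacket_self (P : Tile) :
    ∫ x, P.wavePacket x * P.wavePacket x = 1 := by
  simp_rw [P.wavePacket_sq]
  rw [P.time_eq, integral_indicator (measurableSet_dyadic _ _), setIntegral_const,
    measureReal_dyadic, smul_eq_mul, ← zpow_add₀ two_ne_zero, neg_add_cancel, zpow_zero]

theorem Tile.integral_wavePacket_of_disjoint_time {P Q : Tile} (h : Disjoint P.time Q.time) :
    ∫ x, P.wavePacket x * Q.wavePacket x = 0 := by
  refine integral_eq_zero_of_ae (Filter.Eventually.of_forall fun x => ?_)
  by_cases hx : x ∈ P.time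
  · simp [Q.wavePacket_eq_zero (Set.disjoint_left.1 h hx)]
  · simp [P.wavePacket_eq_zero hx]

/-- Any wave packet is, up to a sign, the normalized sum of the packets of half the frequency over
the two halves of its time interval. -/
theorem exists_wavePacket_split (k n : ℤ) (l : ℕ) :
    ∃ ε : ℝ, ε = (if l % 2 = 1 then -1 else 1) ∧ ∀ x, (Tile.mk k n l).wavePacket x = (√2)⁻¹ *
      ((Tile.mk (k + 1) (2 * n) (l / 2)).wavePacket x +
        ε * (Tile.mk (k + 1) (2 * n + 1) (l / 2)).wavePacket x) := by
  refine ⟨_, rfl, fun x => ?_⟩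
  obtain ⟨m, rfl | rfl⟩ := Nat.even_or_odd' l
  · rw [wavePacket_even, if_neg (by omega), one_mul, show 2 * m / 2 = m by omega]
  · rw [wavePacket_odd, if_pos (by omega), show (2 * m + 1) / 2 = m by omega]; ring

theorem integral_wavePacket_same_time (k n : ℤ) {l m : ℕ} (h : l ≠ m) :
    ∫ x, (Tile.mk k n l).wavePacket x * (Tile.mk k n m).wavePacket x = 0 := by
  obtain ⟨s, hs⟩ : ∃ s, s = l + m := ⟨_, rfl⟩
  induction s using Nat.strong_induction_on generalizing k n l m with
  | _ s ih =>
    obtain ⟨ε, hε, h1⟩ := exists_wavePacket_split k n l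
    obtain ⟨δ, hδ, h2⟩ := exists_wavePacket_split k n m
    set A := Tile.mk (k + 1) (2 * n) (l / 2)
    set B := Tile.mk (k + 1) (2 * n + 1) (l / 2)
    set A' := Tile.mk (k + 1) (2 * n) (m / 2)
    set B' := Tile.mk (k + 1) (2 * n + 1) (m / 2)
    have e : ∀ x, (Tile.mk k n l).wavePacket x * (Tile.mk k n m).wavePacket x = 1 / 2 *
        (A.wavePacket x * A'.wavePacket x + δ * (A.wavePacket x * B'.wavePacket x) +
          ε * (B.wavePacket x * A'.wavePacket x) + ε * δ * (B.wavePacket x * B'.wavePacket x)) := by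
      intro x
      rw [h1, h2]
      have : (√2)⁻¹ * (√2)⁻¹ = (1 / 2 : ℝ) := by
        rw [← mul_inv, Real.mul_self_sqrt (by norm_num)]; norm_num
      rw [← this]; ring
    simp_rw [e]
    have i1 := A.integrable_mul_wavePacket A'
    have i2 := (A.integrable_mul_wavePacket B').const_mul δ
    have i3 := (B.integrable_mul_wavePacket A').const_mul ε
    have i4 := (B.integrable_mul_wavePacket B').const_mul (ε * δ)
    have i12 : Integrable fun x => A.wavePacket x * A'.wavePacket x +
      δ * (A.wavePacket x * B'.wavePacket x) := i1.add i2
    have i123 : Integrable fun x => A.wavePacket x * A'.wavePacket x +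
      δ * (A.wavePacket x * B'.wavePacket x) + ε * (B.wavePacket x * A'.wavePacket x) := i12.add i3
    rw [integral_const_mul, integral_add i123 i4, integral_add i12 i3, integral_add i1 i2,
      integral_const_mul, integral_const_mul, integral_const_mul,
      Tile.integral_wavePacket_of_disjoint_time (P := A) (Q := B') (dyadic_child_disjoint k n),
      Tile.integral_wavePacket_of_disjoint_time (P := B) (Q := A')
        (dyadic_child_disjoint k n).symm]
    by_cases hlm : l / 2 = m / 2
    · have : A' = A := by simp [A, A', hlm]
      rw [this]
      have : B' = B := by simp [B, B', hlm]
      rw [this, A.integral_wavePacket_self, B.integral_wavePacket_self]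
      rcases Nat.mod_two_eq_zero_or_one l with hl | hl <;>
        rcases Nat.mod_two_eq_zero_or_one m with hm | hm <;>
        first | (exfalso; omega) | (rw [hε, hδ]; simp [hl, hm])
    · rw [ih (l / 2 + m / 2) (by omega) (k + 1) (2 * n) hlm rfl,
        ih (l / 2 + m / 2) (by omega) (k + 1) (2 * n + 1) hlm rfl]
      simp

theorem integral_wavePacket_of_disjoint_of_le {P Q : Tile} (hk : P.k ≤ Q.k)
    (h : Disjoint P.time Q.time ∨ Disjoint P.freq Q.freq) :
    ∫ x, P.wavePacket x * Q.wavePacket x = 0 := by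
  obtain ⟨k, n, l⟩ := P
  obtain ⟨d, hd⟩ : ∃ d : ℕ, Q.k = k + d := ⟨(Q.k - k).toNat, by simp at hk; omega⟩
  clear hk
  induction d generalizing k n l with
  | zero =>
    by_cases hn : n = Q.n
    · obtain ⟨k', n', l'⟩ := Q
      simp only at hd hn
      simp only [Nat.cast_zero, add_zero] at hd
      subst hd hn
      refine integral_wavePacket_same_time k' n fun hl => ?_
      subst hl
      rcases h with h | h
      · exact (dyadic_nonempty k' n).ne_empty (disjoint_self.1 h)
      · rw [Tile.freq_eq] at h
        exact (dyadic_nonempty _ _).ne_empty (disjoint_self.1 h)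
    · refine Tile.integral_wavePacket_of_disjoint_time ?_
      rw [Tile.time_eq, Tile.time_eq, hd]
      simpa using dyadic_disjoint hn
  | succ d ih =>
    by_cases ht : Disjoint (Tile.mk k n l).time Q.time
    · exact Tile.integral_wavePacket_of_disjoint_time ht
    have h := h.resolve_left ht
    obtain ⟨ε, -, h1⟩ := exists_wavePacket_split k n l
    -- halving `I_P` doubles `ω_P`; if the result met `ω_Q`, dyadic nesting would give
    -- `ω_P ⊆ ω_Q`
    have hfreq : Disjoint (dyadic (-(k + 1)) ((l / 2 : ℕ) : ℤ)) Q.freq := by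
      rw [Set.disjoint_left]
      intro ξ hξ hξQ
      have hsub := dyadic_subset_parent (-(k + 1)) l
      rw [show -(k + 1) + 1 = -k by ring] at hsub
      rw [Tile.freq_eq, Tile.freq_eq] at h
      rw [Tile.freq_eq] at hξQ
      have h2 := dyadic_subset (by omega) hξQ hξ
      have h3 := dyadic_left_mem (-k) l
      exact Set.disjoint_left.1 h h3 (h2 (by simpa using hsub h3))
    have hA := ih (k + 1) (2 * n) (l / 2) (Or.inr (by rwa [Tile.freq_eq]))
      (by push_cast at hd; omega)
    have hB := ih (k + 1) (2 * n + 1) (l / 2) (Or.inr (by rwa [Tile.freq_eq]))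
      (by push_cast at hd; omega)
    simp_rw [h1]
    have e : ∀ a b c : ℝ, (√2)⁻¹ * (a + ε * b) * c = (√2)⁻¹ * (a * c + ε * (b * c)) := by
      intros; ring
    simp_rw [e]
    rw [integral_const_mul, integral_add (Tile.integrable_mul_wavePacket _ _)
      ((Tile.integrable_mul_wavePacket _ _).const_mul _), integral_const_mul, hA, hB]
    simp

/-- Wave packets of disjoint tiles are orthogonal. -/
theorem integral_wavePacket_of_disjoint {P Q : Tile}
    (h : Disjoint P.time Q.time ∨ Disjoint P.freq Q.freq) :
    ∫ x, P.wavePacket x * Q.wavePacket x = 0 := by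
  rcases le_total P.k Q.k with hk | hk
  · exact integral_wavePacket_of_disjoint_of_le hk h
  · simp_rw [mul_comm (P.wavePacket _)]
    exact integral_wavePacket_of_disjoint_of_le hk (h.imp (fun h => h.symm) fun h => h.symm)

theorem Tile.memLp_wavePacket (P : Tile) :
    MemLp (fun x => (P.wavePacket x : ℂ)) 2 volume := by
  have hm : Measurable (fun x => (P.wavePacket x : ℂ)) :=
    Complex.measurable_ofReal.comp P.measurable_wavePacket
  rw [memLp_two_iff_integrable_sq_norm hm.aestronglyMeasurable]
  simpa [sq_abs, sq] using P.integrable_mul_wavePacket P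

/-- Bessel's inequality for the wave packets of pairwise disjoint tiles. -/
theorem sum_coeff_sq_le {ι : Type*} (D : Finset ι) (τ : ι → Tile)
    (hD : (D : Set ι).Pairwise fun P Q =>
      Disjoint (τ P).time (τ Q).time ∨ Disjoint (τ P).freq (τ Q).freq)
    {f : ℝ → ℂ} (hf : MemLp f 2 volume) :
    ∑ P ∈ D, ‖(τ P).coeff f‖ ^ 2 ≤ ∫ x, ‖f x‖ ^ 2 := by
  have hinner : ∀ (P : Tile) (g : ℝ → ℂ) (hg : MemLp g 2 volume),
      inner ℂ (P.memLp_wavePacket.toLp _) (hg.toLp g) = P.coeff g := by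
    intro P g hg
    rw [L2.inner_def, Tile.coeff]
    refine integral_congr_ae ?_
    filter_upwards [P.memLp_wavePacket.coeFn_toLp, hg.coeFn_toLp] with x h1 h2
    rw [h1, h2]
    simp
  have hon : Orthonormal ℂ (fun P : D => ((τ P).memLp_wavePacket.toLp _)) := by
    classical
    rw [orthonormal_iff_ite]
    intro P Q
    rw [hinner, Tile.coeff]
    have : ∀ x, ((τ Q).wavePacket x : ℂ) * ((τ P).wavePacket x : ℂ)
        = (((τ Q).wavePacket x * (τ P).wavePacket x : ℝ) : ℂ) := by intro x; push_cast; rfl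
    simp_rw [this]
    rw [integral_complex_ofReal]
    by_cases hPQ : P = Q
    · rw [if_pos hPQ, hPQ, Tile.integral_wavePacket_self]; simp
    · rw [if_neg hPQ, integral_wavePacket_of_disjoint
        (hD Q.2 P.2 fun h => hPQ (Subtype.ext h.symm))]
      simp
  have hb := hon.sum_inner_products_le (s := Finset.univ) (hf.toLp f)
  simp_rw [hinner] at hb
  rw [Finset.univ_eq_attach, Finset.sum_attach D (fun P => ‖(τ P).coeff f‖ ^ 2)] at hb
  refine hb.trans_eq ?_
  rw [← inner_self_eq_norm_sq (𝕜 := ℂ), L2.inner_def, ← integral_re]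
  · refine integral_congr_ae ?_
    filter_upwards [hf.coeFn_toLp] with x h
    rw [h, inner_self_eq_norm_sq]
  · exact L2.integrable_inner _ _

/-! ### Trees, size and density -/

theorem Bitile.ext_of_mem {P Q : Bitile} {x ξ : ℝ} (hk : P.k = Q.k) (hx : x ∈ P.time)
    (hx' : x ∈ Q.time) (hξ : ξ ∈ P.freq) (hξ' : ξ ∈ Q.freq) : P = Q := by
  rw [Bitile.time_eq] at hx hx'
  rw [Bitile.freq_eq] at hξ hξ'
  rw [hk] at hx hξ
  have h1 := dyadic_index_eq hx hx'
  have h2 := dyadic_index_eq hξ hξ'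
  exact Bitile.ext hk h1 (by exact_mod_cast h2)

theorem Bitile.freq_subset {P Q : Bitile} {ξ : ℝ} (hk : P.k ≤ Q.k) (hξ : ξ ∈ P.freq)
    (hξ' : ξ ∈ Q.freq) : P.freq ⊆ Q.freq := by
  simp only [Bitile.freq_eq] at *
  exact dyadic_subset (by omega) hξ' hξ

theorem Bitile.time_subset {P Q : Bitile} {x : ℝ} (hk : P.k ≤ Q.k) (hx : x ∈ P.time)
    (hx' : x ∈ Q.time) : Q.time ⊆ P.time :=
  dyadic_subset hk hx hx'

theorem Bitile.sub₂_freq_subset_sub₂ {P Q : Bitile} {ξ : ℝ} (hk : P.k ≤ Q.k)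
    (hξ : ξ ∈ P.sub₂.freq) (hξ' : ξ ∈ Q.sub₂.freq) : P.sub₂.freq ⊆ Q.sub₂.freq := by
  simp only [Bitile.sub₂_freq_eq] at *
  exact dyadic_subset (by omega) hξ' hξ

theorem Bitile.freq_subset_sub₁ {P Q : Bitile} {ξ : ℝ} (hk : P.k < Q.k)
    (hξ : ξ ∈ P.freq) (hξ' : ξ ∈ Q.sub₁.freq) : P.freq ⊆ Q.sub₁.freq := by
  simp only [Bitile.freq_eq, Bitile.sub₁_freq_eq] at *
  exact dyadic_subset (by omega) hξ' hξ

theorem Bitile.freq_nonneg {P : Bitile} {ξ : ℝ} (h : ξ ∈ P.freq) : 0 ≤ ξ :=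
  le_trans (by positivity) h.1

/-- The bitile with time interval of scale `k` and index `n` whose frequency interval contains
`ξ ≥ 0`. -/
def bitileAt (ξ : ℝ) (k n : ℤ) : Bitile := ⟨k, n, (cell (-(k + 1)) ξ).toNat⟩

theorem mem_freq_bitileAt {ξ : ℝ} (hξ : 0 ≤ ξ) (k n : ℤ) : ξ ∈ (bitileAt ξ k n).freq := by
  rw [Bitile.freq_eq, mem_dyadic, bitileAt]
  have h0 : 0 ≤ cell (-(k + 1)) ξ := Int.floor_nonneg.2 (by positivity)
  exact (Int.toNat_of_nonneg h0).symm

theorem eq_bitileAt {P : Bitile} {ξ : ℝ} (h : ξ ∈ P.freq) : P = bitileAt ξ P.k P.n := by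
  obtain ⟨x, hx⟩ := dyadic_nonempty P.k P.n
  exact Bitile.ext_of_mem rfl hx hx h (mem_freq_bitileAt (Bitile.freq_nonneg h) _ _)

theorem time_subset_split (P : Bitile) (k n : ℤ) :
    P.time ⊆ dyadic k n ↔ (P.k = k ∧ P.n = n) ∨ P.time ⊆ dyadic (k + 1) (2 * n) ∨
      P.time ⊆ dyadic (k + 1) (2 * n + 1) := by
  obtain ⟨x, hx⟩ := dyadic_nonempty P.k P.n
  constructor
  · intro h
    have hk := dyadic_scale_le h
    rcases hk.eq_or_lt with hk | hk
    · left
      refine ⟨hk.symm, ?_⟩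
      have := h hx
      rw [hk] at this
      exact dyadic_index_eq hx this
    · right
      have := h hx
      rw [dyadic_eq_union] at this
      exact this.imp (fun h => dyadic_subset (by omega) h hx)
        fun h => dyadic_subset (by omega) h hx
  · rintro (⟨rfl, rfl⟩ | h | h)
    · exact le_rfl
    · rw [dyadic_eq_union]; exact h.trans Set.subset_union_left
    · rw [dyadic_eq_union]; exact h.trans Set.subset_union_right

open scoped Classical in
/-- The energy `∑ |c_P|^2` over the bitiles `P ∈ T` with `I_P` inside a given dyadic interval and
`ξ ∈ ω_{P_2}`. -/
def energy (c : Bitile → ℂ) (T : Finset Bitile) (ξ : ℝ) (k n : ℤ) : ℝ :=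
  ∑ P ∈ T with P.time ⊆ dyadic k n ∧ ξ ∈ P.sub₂.freq, ‖c P‖ ^ 2

open scoped Classical in
/-- The coefficient of the bitile of `T` over a given dyadic interval whose upper half contains the
frequency `ξ`; zero if `T` has no such bitile. -/
def jump (c : Bitile → ℂ) (T : Finset Bitile) (ξ : ℝ) (k n : ℤ) : ℂ :=
  if bitileAt ξ k n ∈ T ∧ ξ ∈ (bitileAt ξ k n).sub₂.freq then c (bitileAt ξ k n) else 0

theorem energy_nonneg (c : Bitile → ℂ) (T : Finset Bitile) (ξ : ℝ) (k n : ℤ) :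
    0 ≤ energy c T ξ k n := Finset.sum_nonneg fun _ _ => by positivity

/-- The energy over an interval is the energy of the bitile over that interval plus the energies over
its two halves. -/
theorem energy_split (c : Bitile → ℂ) (T : Finset Bitile) (ξ : ℝ) (k n : ℤ) :
    energy c T ξ k n = ‖jump c T ξ k n‖ ^ 2 + energy c T ξ (k + 1) (2 * n) +
      energy c T ξ (k + 1) (2 * n + 1) := by
  classical
  simp only [energy, Finset.sum_filter]
  have hj : ‖jump c T ξ k n‖ ^ 2 =
      ∑ P ∈ T, if (P.k = k ∧ P.n = n) ∧ ξ ∈ P.sub₂.freq then ‖c P‖ ^ 2 else 0 := by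
    -- only `bitileAt ξ k n` can contribute to the sum
    rw [jump]
    split_ifs with h
    · rw [Finset.sum_eq_single_of_mem _ h.1]
      · rw [if_pos ⟨⟨rfl, rfl⟩, h.2⟩]
      · rintro P - hP
        rw [if_neg]
        rintro ⟨⟨rfl, rfl⟩, h'⟩
        exact hP (eq_bitileAt (P.sub₂_freq_subset h'))
    · rw [norm_zero, Finset.sum_eq_zero]
      · norm_num
      intro P hP
      rw [if_neg]
      rintro ⟨⟨rfl, rfl⟩, h'⟩
      have := eq_bitileAt (P.sub₂_freq_subset h')
      rw [← this] at h
      exact h ⟨hP, h'⟩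
  rw [hj, ← Finset.sum_add_distrib, ← Finset.sum_add_distrib]
  refine Finset.sum_congr rfl fun P _ => ?_
  have key := time_subset_split P k n
  obtain ⟨x, hx⟩ := dyadic_nonempty P.k P.n
  have hLR : ¬ (P.time ⊆ dyadic (k + 1) (2 * n) ∧ P.time ⊆ dyadic (k + 1) (2 * n + 1)) :=
    fun h => Set.disjoint_left.1 (dyadic_child_disjoint k n) (h.1 hx) (h.2 hx)
  have h1 : P.k = k ∧ P.n = n → ¬ P.time ⊆ dyadic (k + 1) (2 * n) := fun h h' => by
    have := dyadic_scale_le h'; omega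
  have h2 : P.k = k ∧ P.n = n → ¬ P.time ⊆ dyadic (k + 1) (2 * n + 1) := fun h h' => by
    have := dyadic_scale_le h'; omega
  by_cases hξ : ξ ∈ P.sub₂.freq
  · simp only [hξ, and_true]
    rw [if_congr key rfl rfl]
    by_cases a : P.k = k ∧ P.n = n
    · rw [if_pos (Or.inl a), if_pos a, if_neg (h1 a), if_neg (h2 a)]; ring
    · by_cases b : P.time ⊆ dyadic (k + 1) (2 * n)
      · rw [if_pos (Or.inr (Or.inl b)), if_neg a, if_pos b, if_neg fun h => hLR ⟨b, h⟩]; ring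
      · by_cases d : P.time ⊆ dyadic (k + 1) (2 * n + 1)
        · rw [if_pos (Or.inr (Or.inr d)), if_neg a, if_neg b, if_pos d]; ring
        · rw [if_neg (by tauto), if_neg a, if_neg b, if_neg d]; ring
  · simp [hξ]

/-- The collection `T` has size at most `s` for the coefficients `c`: the energy of every tree of
upper type, that is one whose top frequency lies in all `ω_{P_2}`, is at most `s^2 |I|`. -/
def HasSize (c : Bitile → ℂ) (T : Finset Bitile) (s : ℝ) : Prop :=
  ∀ k n ξ, energy c T ξ k n ≤ s ^ 2 * (2 : ℝ) ^ (-k)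

/-- The collection `T` has density at most `d` for the linearizing function `N` on the set `E`: for
every bitile `Q` above some `P ∈ T`, the part of `E ∩ I_Q` on which `N` lies in `ω_Q` has measure at
most `d |I_Q|`. -/
def HasDens (N : ℝ → ℝ) (E : Set ℝ) (T : Finset Bitile) (d : ℝ) : Prop :=
  ∀ P ∈ T, ∀ Q : Bitile, P.time ⊆ Q.time → Q.freq ⊆ P.freq →
    volume (E ∩ (Q.time ∩ N ⁻¹' Q.freq)) ≤ ENNReal.ofReal (d * (2 : ℝ) ^ (-Q.k))

theorem energy_mono {c : Bitile → ℂ} {T T' : Finset Bitile} (h : T ⊆ T') (ξ : ℝ) (k n : ℤ) :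
    energy c T ξ k n ≤ energy c T' ξ k n := by
  classical
  exact Finset.sum_le_sum_of_subset_of_nonneg (Finset.filter_subset_filter _ h)
    fun _ _ _ => by positivity

theorem HasSize.subset {c : Bitile → ℂ} {T T' : Finset Bitile} {s : ℝ} (h : HasSize c T' s)
    (hT : T ⊆ T') : HasSize c T s :=
  fun k n ξ => (energy_mono hT ξ k n).trans (h k n ξ)

theorem HasDens.subset {N : ℝ → ℝ} {E : Set ℝ} {T T' : Finset Bitile} {d : ℝ}
    (h : HasDens N E T' d) (hT : T ⊆ T') : HasDens N E T d :=
  fun P hP => h P (hT hP)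

theorem HasSize.norm_le {c : Bitile → ℂ} {T : Finset Bitile} {s : ℝ} (h : HasSize c T s)
    (hs : 0 ≤ s) {P : Bitile} (hP : P ∈ T) : ‖c P‖ ≤ s * (2 : ℝ) ^ (-(P.k : ℝ) / 2) := by
  classical
  obtain ⟨ξ, hξ⟩ : P.sub₂.freq.Nonempty := by
    rw [P.sub₂_freq_eq]; exact dyadic_nonempty _ _
  have h1 : ‖c P‖ ^ 2 ≤ energy c T ξ P.k P.n :=
    Finset.single_le_sum (f := fun P => ‖c P‖ ^ 2) (fun _ _ => by positivity)
      (Finset.mem_filter.2 ⟨hP, le_rfl, hξ⟩)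
  have h2 := h1.trans (h P.k P.n ξ)
  refine le_of_sq_le_sq (h2.trans_eq ?_) (by positivity)
  rw [mul_pow]
  have := rpow_half_sq (-P.k)
  push_cast at this
  rw [this]

theorem HasSize.norm_mul_le {c : Bitile → ℂ} {T : Finset Bitile} {s : ℝ} (h : HasSize c T s)
    (hs : 0 ≤ s) {P : Bitile} (hP : P ∈ T) (x : ℝ) : ‖c P * (P.sub₁.wavePacket x : ℂ)‖ ≤ s := by
  rw [norm_mul, Complex.norm_real, Real.norm_eq_abs]
  have h1 := h.norm_le hs hP
  have h2 : |P.sub₁.wavePacket x| ≤ _ := P.sub₁.abs_wavePacket_le x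
  refine (mul_le_mul h1 h2 (abs_nonneg _) (by positivity)).trans_eq ?_
  rw [mul_assoc, ← Real.rpow_add (by norm_num)]
  simp only [Bitile.sub₁]
  rw [show -(P.k : ℝ) / 2 + (P.k : ℝ) / 2 = 0 by ring, Real.rpow_zero, mul_one]

/-- The Walsh–Carleson sum of a finite collection of bitiles with arbitrary coefficients `c`. -/
def carlesonSum (c : Bitile → ℂ) (N : ℝ → ℝ) (T : Finset Bitile) (x : ℝ) : ℂ :=
  ∑ P ∈ T, {x | N x ∈ P.sub₂.freq}.indicator (fun x => c P * (P.sub₁.wavePacket x : ℂ)) x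

/-! ### Size is controlled by averages -/

theorem Tile.integrable_mul {f : ℝ → ℂ} (P : Tile) (hf : IntegrableOn f P.time) :
    Integrable fun y => f y * (P.wavePacket y : ℂ) := by
  have h : Integrable fun y => P.time.indicator f y * (P.wavePacket y : ℂ) := by
    refine ((integrable_indicator_iff (measurableSet_dyadic P.k P.n)).2 hf).mul_bdd
      (c := (2 : ℝ) ^ ((P.k : ℝ) / 2))
      (Complex.measurable_ofReal.comp P.measurable_wavePacket).aestronglyMeasurable
      (Filter.Eventually.of_forall fun x => ?_)
    simpa using P.abs_wavePacket_le x
  refine h.congr (Filter.Eventually.of_forall fun x => ?_)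
  by_cases hx : x ∈ P.time
  · simp [hx]
  · simp [P.wavePacket_eq_zero hx]

theorem coeff_even {f : ℝ → ℂ} (hf : Integrable f) (k n : ℤ) (l : ℕ) :
    (Tile.mk k n (2 * l)).coeff f = ((√2)⁻¹ : ℝ) *
      ((Tile.mk (k + 1) (2 * n) l).coeff f + (Tile.mk (k + 1) (2 * n + 1) l).coeff f) := by
  simp only [Tile.coeff]
  rw [← integral_add (Tile.integrable_mul _ hf.integrableOn)
    (Tile.integrable_mul _ hf.integrableOn), ← integral_const_mul]
  refine integral_congr_ae (Filter.Eventually.of_forall fun x => ?_)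
  simp only [wavePacket_even]
  push_cast; ring

theorem coeff_odd {f : ℝ → ℂ} (hf : Integrable f) (k n : ℤ) (l : ℕ) :
    (Tile.mk k n (2 * l + 1)).coeff f = ((√2)⁻¹ : ℝ) *
      ((Tile.mk (k + 1) (2 * n) l).coeff f - (Tile.mk (k + 1) (2 * n + 1) l).coeff f) := by
  simp only [Tile.coeff]
  rw [← integral_sub (Tile.integrable_mul _ hf.integrableOn)
    (Tile.integrable_mul _ hf.integrableOn), ← integral_const_mul]
  refine integral_congr_ae (Filter.Eventually.of_forall fun x => ?_)
  simp only [wavePacket_odd]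
  push_cast; ring

/-- The two sub-tiles of a bitile carry the same energy as the two tiles obtained by cutting the
bitile in time. -/
theorem coeff_sq_add_coeff_sq {f : ℝ → ℂ} (hf : Integrable f) (k n : ℤ) (l : ℕ) :
    ‖(Tile.mk k n (2 * l)).coeff f‖ ^ 2 + ‖(Tile.mk k n (2 * l + 1)).coeff f‖ ^ 2 =
      ‖(Tile.mk (k + 1) (2 * n) l).coeff f‖ ^ 2 +
        ‖(Tile.mk (k + 1) (2 * n + 1) l).coeff f‖ ^ 2 := by
  rw [coeff_even hf, coeff_odd hf, norm_mul, norm_mul, mul_pow, mul_pow, ← mul_add,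
    Complex.norm_real, Real.norm_eq_abs, sq_abs, inv_pow, Real.sq_sqrt (by norm_num)]
  have := parallelogram_law_with_norm ℂ ((Tile.mk (k + 1) (2 * n) l).coeff f)
    ((Tile.mk (k + 1) (2 * n + 1) l).coeff f)
  linarith

theorem Tile.norm_coeff_le {f : ℝ → ℂ} (P : Tile) (hf : IntegrableOn f P.time) :
    ‖P.coeff f‖ ≤ (2 : ℝ) ^ ((P.k : ℝ) / 2) * ∫ x in P.time, ‖f x‖ := by
  refine (norm_integral_le_integral_norm _).trans ?_
  have hm : MeasurableSet P.time := measurableSet_dyadic _ _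
  rw [← integral_indicator hm, ← integral_const_mul]
  refine integral_mono (P.integrable_mul hf).norm
    (((integrable_indicator_iff hm).2 hf.norm).const_mul _) fun x => ?_
  simp only [norm_mul, Complex.norm_real, Real.norm_eq_abs]
  by_cases hx : x ∈ P.time
  · rw [Set.indicator_of_mem hx, P.abs_wavePacket hx, mul_comm]
  · rw [Set.indicator_of_notMem hx, P.wavePacket_eq_zero hx]; simp

theorem Tile.norm_coeff_sq_le {f : ℝ → ℂ} (P : Tile) (hf : IntegrableOn f P.time) :
    ‖P.coeff f‖ ^ 2 ≤ (2 : ℝ) ^ P.k * (∫ x in P.time, ‖f x‖) ^ 2 := by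
  refine (pow_le_pow_left₀ (norm_nonneg _) (P.norm_coeff_le hf) 2).trans_eq ?_
  rw [mul_pow, rpow_half_sq]

theorem energy_eq_zero {c : Bitile → ℂ} {T : Finset Bitile} {ξ : ℝ} {k n : ℤ}
    (h : ∀ P ∈ T, P.time ⊆ dyadic k n → ξ ∉ P.sub₂.freq) : energy c T ξ k n = 0 := by
  classical
  rw [energy, Finset.sum_eq_zero]
  intro P hP
  rw [Finset.mem_filter] at hP
  exact absurd hP.2.2 (h P hP.1 hP.2.1)

/-- Induction over the dyadic intervals that contain the time interval of a bitile of `T`. The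
recursion ends at the intervals that contain none, while their parents still do. -/
theorem dyadic_induction {T : Finset Bitile} {motive : ℤ → ℤ → Prop}
    (terminal : ∀ k n, ∀ P ∈ T, P.time ⊆ dyadic (k - 1) (n / 2) →
      (∀ P ∈ T, ¬ P.time ⊆ dyadic k n) → motive k n)
    (step : ∀ k n, ∀ P ∈ T, P.time ⊆ dyadic k n → motive (k + 1) (2 * n) →
      motive (k + 1) (2 * n + 1) → motive k n)
    {k n : ℤ} {P : Bitile} (hP : P ∈ T) (hPs : P.time ⊆ dyadic k n) : motive k n := by
  obtain ⟨K, hK⟩ : ∃ K : ℤ, ∀ P ∈ T, P.k < K := by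
    obtain ⟨K, hK⟩ := (T.image Bitile.k).bddAbove
    refine ⟨K + 1, fun P hP => ?_⟩
    have := hK (Finset.mem_coe.2 (Finset.mem_image_of_mem Bitile.k hP))
    omega
  obtain ⟨t, ht⟩ : ∃ t : ℕ, K ≤ k + t := ⟨(K - k).toNat, by omega⟩
  induction t generalizing k n P with
  | zero =>
    have := dyadic_scale_le hPs
    have := hK P hP
    simp at ht
    omega
  | succ t ih =>
    have child : ∀ b : ℤ, b = 0 ∨ b = 1 → motive (k + 1) (2 * n + b) := by
      intro b hb
      by_cases hc : ∃ Q ∈ T, Q.time ⊆ dyadic (k + 1) (2 * n + b)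
      · obtain ⟨Q, hQ, hQs⟩ := hc
        exact ih hQ hQs (by push_cast at ht; omega)
      · push Not at hc
        refine terminal _ _ P hP ?_ hc
        rwa [show k + 1 - 1 = k by ring, show (2 * n + b) / 2 = n by omega]
    refine step k n P hP hPs ?_ (child 1 (Or.inr rfl))
    simpa using child 0 (Or.inl rfl)

/-- The energy of a tree of upper type telescopes: added to the squared coefficient of the tile over
the top interval that contains `ξ`, it is at most the sum of such squares over the intervals where
the recursion stops, and there the averages of `|f|` are at most `2 A`. -/
theorem energy_add_sq_le {f : ℝ → ℂ} (hf : Integrable f) {T : Finset Bitile} {A : ℝ} {ξ : ℝ}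
    (hξ : 0 ≤ ξ) (h : ∀ P ∈ T, ∀ k n, P.time ⊆ dyadic k n →
      ∫ x in dyadic k n, ‖f x‖ ≤ A * (2 : ℝ) ^ (-k)) {k n : ℤ} {P : Bitile} (hP : P ∈ T)
    (hPs : P.time ⊆ dyadic k n) :
    energy (fun P => P.sub₁.coeff f) T ξ k n +
        ‖(Tile.mk k n (cell (-k) ξ).toNat).coeff f‖ ^ 2 ≤ (2 * A) ^ 2 * (2 : ℝ) ^ (-k) := by
  refine dyadic_induction (T := T) (motive := fun k n => energy (fun P => P.sub₁.coeff f) T ξ k n +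
    ‖(Tile.mk k n (cell (-k) ξ).toNat).coeff f‖ ^ 2 ≤ (2 * A) ^ 2 * (2 : ℝ) ^ (-k)) ?_ ?_ hP hPs
  · intro k n P hP hPs hno
    -- the average over the parent is at most `A`, hence that over `I` is at most `2 A`
    rw [energy_eq_zero fun P hP hs => absurd hs (hno P hP), zero_add]
    refine (Tile.norm_coeff_sq_le _ hf.integrableOn).trans ?_
    have h1 : ∫ x in dyadic k n, ‖f x‖ ≤ ∫ x in dyadic (k - 1) (n / 2), ‖f x‖ := by
      have hsub := dyadic_subset_parent (k - 1) n
      rw [sub_add_cancel] at hsub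
      refine setIntegral_mono_set hf.norm.integrableOn
        (Filter.Eventually.of_forall fun _ => norm_nonneg _)
        (Filter.Eventually.of_forall fun x hx => hsub hx)
    have h2 := pow_le_pow_left₀ (integral_nonneg fun _ => norm_nonneg _)
      (h1.trans (h P hP _ _ hPs)) 2
    refine (mul_le_mul_of_nonneg_left h2 (by positivity)).trans_eq ?_
    change (2 : ℝ) ^ k * _ = _
    have e : (2 : ℝ) ^ (-(k - 1)) = 2 * (2 : ℝ) ^ (-k) := by
      rw [show -(k - 1) = -k + 1 by ring, zpow_add_one₀ two_ne_zero, mul_comm]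
    have e2 : (2 : ℝ) ^ k * (2 : ℝ) ^ (-k) = 1 := by
      rw [← zpow_add₀ two_ne_zero, add_neg_cancel, zpow_zero]
    rw [e]
    linear_combination (4 * A ^ 2 * (2 : ℝ) ^ (-k)) * e2
  · intro k n P _ _ hL hR
    rw [energy_split]
    set u := (cell (-(k + 1)) ξ).toNat with hu
    have hsum := coeff_sq_add_coeff_sq hf k n u
    have h0 : 0 ≤ cell (-(k + 1)) ξ := Int.floor_nonneg.2 (by positivity)
    have h1 := cell_succ_ediv (-(k + 1)) ξ
    rw [show -(k + 1) + 1 = -k by ring] at h1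
    have e : (2 * A) ^ 2 * (2 : ℝ) ^ (-k) =
        (2 * A) ^ 2 * (2 : ℝ) ^ (-(k + 1)) + (2 * A) ^ 2 * (2 : ℝ) ^ (-(k + 1)) := by
      rw [show -k = -(k + 1) + 1 by ring, zpow_add_one₀ two_ne_zero]; ring
    rw [e]
    have key : ‖jump (fun P => P.sub₁.coeff f) T ξ k n‖ ^ 2 +
        ‖(Tile.mk k n (cell (-k) ξ).toNat).coeff f‖ ^ 2 ≤
        ‖(Tile.mk k n (2 * u)).coeff f‖ ^ 2 + ‖(Tile.mk k n (2 * u + 1)).coeff f‖ ^ 2 := by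
      rw [jump]
      split_ifs with hj
      · have h2 := hj.2
        rw [Bitile.sub₂_freq_eq, mem_dyadic] at h2
        simp only [bitileAt] at h2
        rw [show (cell (-k) ξ).toNat = 2 * u + 1 by omega]
        rfl
      · rw [norm_zero]
        have : (cell (-k) ξ).toNat = 2 * u ∨ (cell (-k) ξ).toNat = 2 * u + 1 := by omega
        rcases this with h | h <;> rw [h] <;> nlinarith [sq_nonneg ‖(Tile.mk k n (2 * u)).coeff f‖,
          sq_nonneg ‖(Tile.mk k n (2 * u + 1)).coeff f‖]
    linarith

/-- A collection of bitiles all of whose dyadic ancestors have averages of `|f|` at most `A` has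
size at most `2 A` for the wave packet coefficients of `f`. -/
theorem hasSize_of_average {f : ℝ → ℂ} (hf : Integrable f) {T : Finset Bitile} {A : ℝ}
    (h : ∀ P ∈ T, ∀ k n, P.time ⊆ dyadic k n →
      ∫ x in dyadic k n, ‖f x‖ ≤ A * (2 : ℝ) ^ (-k)) :
    HasSize (fun P => P.sub₁.coeff f) T (2 * A) := by
  intro k n ξ
  by_cases hc : ∃ P ∈ T, P.time ⊆ dyadic k n ∧ ξ ∈ P.sub₂.freq
  · obtain ⟨P, hP, hPs, hξ⟩ := hc
    have h0 := Bitile.freq_nonneg (P.sub₂_freq_subset hξ)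
    have := energy_add_sq_le hf h0 h hP hPs
    nlinarith [sq_nonneg ‖(Tile.mk k n (cell (-k) ξ).toNat).coeff f‖]
  · push Not at hc
    rw [energy_eq_zero hc]
    positivity

/-! ### The tree estimate -/

/-- The martingale attached to a tree with top scale `k₀` and top frequency `ξ`. On the dyadic
interval of scale `k₀ + j` and index `n` it is the partial sum of the wave packet expansion over
the bitiles of upper type with scale below `k₀ + j`, divided by the Walsh character. -/
def treeMart (c : Bitile → ℂ) (T : Finset Bitile) (ξ : ℝ) (k₀ : ℤ) : ℕ → ℤ → ℂ
  | 0, _ => 0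
  | j + 1, n =>
    (if cell (-(k₀ + j)) ξ % 2 = 1 ∧ n % 2 = 1 then -1 else 1) * treeMart c T ξ k₀ j (n / 2) +
      ((2 : ℝ) ^ (((k₀ + j : ℤ) : ℝ) / 2) : ℝ) * jump c T ξ (k₀ + j) (n / 2)

/-- The increments of the martingale are opposite on the two halves of an interval, up to signs that
do not affect absolute values. -/
theorem treeMart_children (c : Bitile → ℂ) (T : Finset Bitile) (ξ : ℝ) (k₀ : ℤ) (j : ℕ) (n : ℤ) :
    ∃ a : ℂ, ‖a‖ ^ 2 = (2 : ℝ) ^ (k₀ + j) * ‖jump c T ξ (k₀ + j) n‖ ^ 2 ∧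
      ‖treeMart c T ξ k₀ (j + 1) (2 * n)‖ = ‖treeMart c T ξ k₀ j n + a‖ ∧
      ‖treeMart c T ξ k₀ (j + 1) (2 * n + 1)‖ = ‖treeMart c T ξ k₀ j n - a‖ := by
  refine ⟨((2 : ℝ) ^ (((k₀ + j : ℤ) : ℝ) / 2) : ℝ) * jump c T ξ (k₀ + j) n, ?_, ?_, ?_⟩
  · rw [norm_mul, mul_pow, Complex.norm_real, Real.norm_eq_abs, sq_abs, rpow_half_sq]
  · rw [treeMart, if_neg (by omega), one_mul, show 2 * n / 2 = n by omega]
  · rw [treeMart, show (2 * n + 1) / 2 = n by omega]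
    split_ifs with h
    · rw [← norm_neg]; congr 1; ring
    · have : jump c T ξ (k₀ + j) n = 0 := by
        rw [jump, if_neg]
        rintro ⟨-, hξ⟩
        rw [Bitile.sub₂_freq_eq, mem_dyadic] at hξ
        simp only [bitileAt] at hξ
        omega
      rw [this]; simp

theorem treeMart_sq (c : Bitile → ℂ) (T : Finset Bitile) (ξ : ℝ) (k₀ : ℤ) (j : ℕ) (n : ℤ) :
    ‖treeMart c T ξ k₀ (j + 1) (2 * n)‖ ^ 2 + ‖treeMart c T ξ k₀ (j + 1) (2 * n + 1)‖ ^ 2 =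
      2 * ‖treeMart c T ξ k₀ j n‖ ^ 2 +
        2 * ((2 : ℝ) ^ (k₀ + j) * ‖jump c T ξ (k₀ + j) n‖ ^ 2) := by
  obtain ⟨a, ha, h1, h2⟩ := treeMart_children c T ξ k₀ j n
  rw [← ha, h1, h2]
  have := parallelogram_law_with_norm ℂ (treeMart c T ξ k₀ j n) a
  linarith

theorem treeMart_le (c : Bitile → ℂ) (T : Finset Bitile) (ξ : ℝ) (k₀ : ℤ) (j : ℕ) (n : ℤ) :
    2 * ‖treeMart c T ξ k₀ j n‖ ≤
      ‖treeMart c T ξ k₀ (j + 1) (2 * n)‖ + ‖treeMart c T ξ k₀ (j + 1) (2 * n + 1)‖ := by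
  obtain ⟨a, -, h1, h2⟩ := treeMart_children c T ξ k₀ j n
  rw [h1, h2]
  set m := treeMart c T ξ k₀ j n
  calc 2 * ‖m‖ = ‖(m + a) + (m - a)‖ := by
        rw [show (m + a) + (m - a) = (2 : ℂ) * m by ring, norm_mul]; simp
    _ ≤ _ := norm_add_le _ _

open scoped Classical in
/-- The partial sums of the wave packet expansion over the upper part of a tree form the martingale
`treeMart`, modulated by the Walsh character of the top frequency. -/
theorem sum_upper_eq (c : Bitile → ℂ) (T : Finset Bitile) {ξ : ℝ} (hξ : 0 ≤ ξ) (k₀ : ℤ)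
    (hT : ∀ P ∈ T, k₀ ≤ P.k) (x : ℝ) (j : ℕ) :
    ∑ P ∈ T with (x ∈ P.time ∧ ξ ∈ P.sub₂.freq) ∧ P.k < k₀ + j,
      c P * (P.sub₁.wavePacket x : ℂ) =
    (walshChar (k₀ + j) ξ x : ℂ) * treeMart c T ξ k₀ j (cell (k₀ + j) x) := by
  induction j with
  | zero =>
    rw [treeMart, mul_zero]
    refine Finset.sum_eq_zero fun P hP => ?_
    rw [Finset.mem_filter] at hP
    have := hT P hP.1
    have := hP.2.2
    simp at this
    omega
  | succ j ih =>
    have hcell : cell (k₀ + (j + 1 : ℕ)) x / 2 = cell (k₀ + j) x := by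
      rw [← cell_succ_ediv (k₀ + j) x]; push_cast; rw [add_assoc]
    rw [treeMart, hcell, mul_add]
    have e1 : (walshChar (k₀ + (j + 1 : ℕ)) ξ x : ℂ) *
        ((if cell (-(k₀ + j)) ξ % 2 = 1 ∧ cell (k₀ + (j + 1 : ℕ)) x % 2 = 1 then -1 else 1) *
          treeMart c T ξ k₀ j (cell (k₀ + j) x)) =
        (walshChar (k₀ + j) ξ x : ℂ) * treeMart c T ξ k₀ j (cell (k₀ + j) x) := by
      rw [walshChar_eq (k₀ + j) hξ, show k₀ + (j + 1 : ℕ) = k₀ + j + 1 by push_cast; ring]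
      split_ifs <;> push_cast <;> ring
    rw [e1, ← ih]
    simp only [Finset.sum_filter]
    have e2 : (walshChar (k₀ + (j + 1 : ℕ)) ξ x : ℂ) * (((2 : ℝ) ^ (((k₀ + j : ℤ) : ℝ) / 2) : ℝ) *
        jump c T ξ (k₀ + j) (cell (k₀ + j) x)) =
        ∑ P ∈ T, if (x ∈ P.time ∧ ξ ∈ P.sub₂.freq) ∧ P.k = k₀ + j then
          c P * (P.sub₁.wavePacket x : ℂ) else 0 := by
      set Q := bitileAt ξ (k₀ + j) (cell (k₀ + j) x) with hQ
      have hx : x ∈ Q.time := mem_dyadic_cell _ _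
      have huniq : ∀ P : Bitile, x ∈ P.time → ξ ∈ P.sub₂.freq → P.k = k₀ + j → P = Q :=
        fun P h1 h2 h3 => Bitile.ext_of_mem h3 h1 hx (P.sub₂_freq_subset h2)
          (mem_freq_bitileAt hξ _ _)
      rw [jump]
      split_ifs with h
      · rw [Finset.sum_eq_single_of_mem Q h.1]
        · rw [if_pos ⟨⟨hx, h.2⟩, rfl⟩, Q.wavePacket_sub₁ hx (Q.sub₂_freq_subset h.2)]
          rw [show k₀ + (j + 1 : ℕ) = Q.k + 1 by simp only [hQ, bitileAt]; push_cast; ring]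
          rw [← hQ]
          change (_ : ℂ) * (((2 : ℝ) ^ ((Q.k : ℝ) / 2) : ℝ) * c Q) = _
          push_cast; ring
        · rintro P - hP
          rw [if_neg]
          rintro ⟨⟨h1, h2⟩, h3⟩
          exact hP (huniq P h1 h2 h3)
      · rw [mul_zero, mul_zero, Finset.sum_eq_zero]
        intro P hP
        rw [if_neg]
        rintro ⟨⟨h1, h2⟩, h3⟩
        have := huniq P h1 h2 h3
        subst this
        exact h ⟨hP, h2⟩
    rw [e2, ← Finset.sum_add_distrib]
    refine Finset.sum_congr rfl fun P _ => ?_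
    by_cases h : x ∈ P.time ∧ ξ ∈ P.sub₂.freq
    · simp only [h, true_and]
      rcases lt_trichotomy P.k (k₀ + j) with h1 | h1 | h1
      · rw [if_pos (by push_cast; omega), if_pos h1, if_neg (by omega), add_zero]
      · rw [if_pos (by push_cast; omega), if_neg (by omega), if_pos h1, zero_add]
      · rw [if_neg (by push_cast; omega), if_neg (by omega), if_neg (by omega), add_zero]
    · simp [h]

theorem carlesonSum_eq (c : Bitile → ℂ) (N : ℝ → ℝ) (T : Finset Bitile) (x : ℝ)
    [DecidablePred fun P : Bitile => x ∈ P.time ∧ N x ∈ P.sub₂.freq] :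
    carlesonSum c N T x =
      ∑ P ∈ T with x ∈ P.time ∧ N x ∈ P.sub₂.freq, c P * (P.sub₁.wavePacket x : ℂ) := by
  classical
  rw [carlesonSum, Finset.sum_filter]
  refine Finset.sum_congr rfl fun P _ => ?_
  by_cases hx : x ∈ P.time
  · simp [Set.indicator_apply, hx]
  · have : P.sub₁.wavePacket x = 0 := P.sub₁.wavePacket_eq_zero hx
    simp [Set.indicator_apply, this]

/-- In a tree of lower type at most one bitile contributes at each point, because the sets
`ω_{P_2}` are disjoint for different scales. -/
theorem norm_sum_lower_le {c : Bitile → ℂ} {T : Finset Bitile} {s : ℝ} (hs : 0 ≤ s)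
    (hsize : HasSize c T s) (ξ x y : ℝ) (A : Finset Bitile) (hA : A ⊆ T)
    (hmem : ∀ P ∈ A, x ∈ P.time ∧ ξ ∈ P.sub₁.freq ∧ y ∈ P.sub₂.freq) :
    ‖∑ P ∈ A, c P * (P.sub₁.wavePacket x : ℂ)‖ ≤ s := by
  have huniq : ∀ P ∈ A, ∀ Q ∈ A, P = Q := by
    have key : ∀ P ∈ A, ∀ Q ∈ A, ¬ P.k < Q.k := by
      intro P hP Q hQ hlt
      obtain ⟨_, h2, h3⟩ := hmem P hP
      obtain ⟨_, h5, h6⟩ := hmem Q hQ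
      have := Bitile.freq_subset_sub₁ hlt (P.sub₁_freq_subset h2) h5 (P.sub₂_freq_subset h3)
      exact Set.disjoint_left.1 Q.sub_freq_disjoint this h6
    intro P hP Q hQ
    have hk : P.k = Q.k := le_antisymm (not_lt.1 (key Q hQ P hP)) (not_lt.1 (key P hP Q hQ))
    exact Bitile.ext_of_mem hk (hmem P hP).1 (hmem Q hQ).1
      (P.sub₁_freq_subset (hmem P hP).2.1) (Q.sub₁_freq_subset (hmem Q hQ).2.1)
  rcases A.eq_empty_or_nonempty with h | ⟨P, hP⟩
  · rw [h]; simpa using hs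
  · rw [Finset.sum_eq_single_of_mem P hP fun Q hQ hne => absurd (huniq Q hQ P hP) hne]
    exact hsize.norm_mul_le hs (hA hP) x

/-- In a tree of upper type the bitiles contributing at `x` form an interval of scales, hence the
sum is the difference of two values of the tree martingale. -/
theorem exists_norm_carlesonSum_le {c : Bitile → ℂ} {T : Finset Bitile} {s : ℝ} (hs : 0 ≤ s)
    (hsize : HasSize c T s) {ξ : ℝ} (hξ : ∀ P ∈ T, ξ ∈ P.freq) {k₀ : ℤ} (hT : ∀ P ∈ T, k₀ ≤ P.k)
    (hξ0 : 0 ≤ ξ) (N : ℝ → ℝ) (x : ℝ) (j : ℕ) (hj : ∀ P ∈ T, x ∈ P.time → P.k < k₀ + j) :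
    ∃ i ≤ j, ‖carlesonSum c N T x‖ ≤ s + ‖treeMart c T ξ k₀ j (cell (k₀ + j) x)‖ +
      ‖treeMart c T ξ k₀ i (cell (k₀ + i) x)‖ := by
  classical
  have hval : ∀ i : ℕ, ‖∑ P ∈ T with (x ∈ P.time ∧ ξ ∈ P.sub₂.freq) ∧ P.k < k₀ + i,
      c P * (P.sub₁.wavePacket x : ℂ)‖ = ‖treeMart c T ξ k₀ i (cell (k₀ + i) x)‖ := by
    intro i
    rw [sum_upper_eq c T hξ0 k₀ hT x i, norm_mul, Complex.norm_real, Real.norm_eq_abs,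
      abs_walshChar, one_mul]
  have hsplit : carlesonSum c N T x =
      ∑ P ∈ T with (x ∈ P.time ∧ N x ∈ P.sub₂.freq) ∧ ξ ∉ P.sub₂.freq,
        c P * (P.sub₁.wavePacket x : ℂ) +
      ∑ P ∈ T with (x ∈ P.time ∧ N x ∈ P.sub₂.freq) ∧ ξ ∈ P.sub₂.freq,
        c P * (P.sub₁.wavePacket x : ℂ) := by
    rw [carlesonSum_eq, add_comm, ← Finset.sum_filter_add_sum_filter_not _
      (fun P : Bitile => ξ ∈ P.sub₂.freq), Finset.filter_filter, Finset.filter_filter]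
  have hlow : ‖∑ P ∈ T with (x ∈ P.time ∧ N x ∈ P.sub₂.freq) ∧ ξ ∉ P.sub₂.freq,
      c P * (P.sub₁.wavePacket x : ℂ)‖ ≤ s := by
    refine norm_sum_lower_le hs hsize ξ x (N x) _ (Finset.filter_subset _ _) fun P hP => ?_
    rw [Finset.mem_filter] at hP
    have h := hξ P hP.1
    rw [P.freq_eq_union] at h
    exact ⟨hP.2.1.1, h.resolve_right hP.2.2, hP.2.1.2⟩
  set A := T.filter fun P => (x ∈ P.time ∧ N x ∈ P.sub₂.freq) ∧ ξ ∈ P.sub₂.freq with hA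
  rcases A.eq_empty_or_nonempty with hAe | hAn
  · refine ⟨0, Nat.zero_le _, ?_⟩
    rw [hsplit, hAe, Finset.sum_empty, add_zero]
    have := norm_nonneg (treeMart c T ξ k₀ j (cell (k₀ + j) x))
    have := norm_nonneg (treeMart c T ξ k₀ 0 (cell (k₀ + (0 : ℕ)) x))
    linarith
  · obtain ⟨Q, hQ, hQmin⟩ := A.exists_min_image Bitile.k hAn
    have hQ' := (Finset.mem_filter.1 hQ)
    have h1 := hT Q hQ'.1
    have h2 := hj Q hQ'.1 hQ'.2.1.1
    obtain ⟨i, hi⟩ : ∃ i : ℕ, Q.k = k₀ + i := ⟨(Q.k - k₀).toNat, by omega⟩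
    refine ⟨i, by omega, ?_⟩
    have hAeq : ∑ P ∈ A, c P * (P.sub₁.wavePacket x : ℂ) =
        ∑ P ∈ T with (x ∈ P.time ∧ ξ ∈ P.sub₂.freq) ∧ P.k < k₀ + j,
          c P * (P.sub₁.wavePacket x : ℂ) -
        ∑ P ∈ T with (x ∈ P.time ∧ ξ ∈ P.sub₂.freq) ∧ P.k < k₀ + i,
          c P * (P.sub₁.wavePacket x : ℂ) := by
      rw [eq_sub_iff_add_eq, ← Finset.sum_union]
      · refine Finset.sum_congr ?_ fun _ _ => rfl
        ext P
        simp only [hA, Finset.mem_union, Finset.mem_filter]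
        constructor
        · rintro (⟨h, ⟨hx, -⟩, hP⟩ | ⟨h, ⟨hx, hP⟩, -⟩)
          · exact ⟨h, ⟨hx, hP⟩, hj P h hx⟩
          · exact ⟨h, ⟨hx, hP⟩, hj P h hx⟩
        · rintro ⟨h, ⟨hx, hP⟩, -⟩
          by_cases hlt : P.k < k₀ + i
          · exact Or.inr ⟨h, ⟨hx, hP⟩, hlt⟩
          · exact Or.inl ⟨h, ⟨hx, Bitile.sub₂_freq_subset_sub₂ (by omega) hQ'.2.2 hP hQ'.2.1.2⟩, hP⟩
      · rw [Finset.disjoint_left]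
        intro P hP hP'
        have := hQmin P hP
        have := (Finset.mem_filter.1 hP').2.2
        omega
    rw [hsplit, hAeq]
    refine (norm_add_le _ _).trans ?_
    rw [add_assoc]
    refine add_le_add hlow ((norm_sub_le _ _).trans ?_)
    rw [hval, hval]

theorem carlesonSum_ne_zero {c : Bitile → ℂ} {N : ℝ → ℝ} {T : Finset Bitile} {x : ℝ}
    (h : carlesonSum c N T x ≠ 0) : ∃ P ∈ T, x ∈ P.time ∧ N x ∈ P.sub₂.freq := by
  classical
  rw [carlesonSum_eq] at h
  obtain ⟨P, hP, -⟩ := Finset.exists_ne_zero_of_sum_ne_zero h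
  exact ⟨P, (Finset.mem_filter.1 hP).1, (Finset.mem_filter.1 hP).2⟩

/-- Bellman function form of the tree estimate. The quantity `4 v - 4 L m + 2 L^2`, with `v` the
average energy, `m` the modulus of the martingale and `L ≥ m` its running maximum, dominates the
averages of the square of the final maximum; the density enters only at the intervals where the
induction stops. -/
theorem lintegral_tree_le {c : Bitile → ℂ} {T : Finset Bitile} {s d : ℝ} (hs : 0 < s) (hd : 0 ≤ d)
    (hsize : HasSize c T s) {N : ℝ → ℝ} (hN : Measurable N) {E : Set ℝ}
    (hdens : HasDens N E T d) {ξ : ℝ} (hξ : ∀ P ∈ T, ξ ∈ P.freq) {k₀ : ℤ}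
    (hT : ∀ P ∈ T, k₀ ≤ P.k) (hξ0 : 0 ≤ ξ) {k n : ℤ} {P : Bitile} (hP : P ∈ T)
    (hPs : P.time ⊆ dyadic k n) :
    ∀ j : ℕ, k = k₀ + j → ∀ L : ℝ, s ≤ L → ‖treeMart c T ξ k₀ j n‖ ≤ L →
      (∀ x ∈ dyadic k n, ∀ i < j, ‖treeMart c T ξ k₀ i (cell (k₀ + i) x)‖ ≤ L) →
      ∫⁻ x in dyadic k n, ‖carlesonSum c N T x‖ₑ ∂(volume.restrict E) ≤
        ENNReal.ofReal (6 * d / s * ((2 : ℝ) ^ (-k) * (4 * ‖treeMart c T ξ k₀ j n‖ ^ 2 -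
          4 * L * ‖treeMart c T ξ k₀ j n‖ + 2 * L ^ 2) + 4 * energy c T ξ k n)) := by
  refine dyadic_induction (T := T) (motive := fun k n => ∀ j : ℕ, k = k₀ + j → ∀ L : ℝ, s ≤ L →
    ‖treeMart c T ξ k₀ j n‖ ≤ L →
      (∀ x ∈ dyadic k n, ∀ i < j, ‖treeMart c T ξ k₀ i (cell (k₀ + i) x)‖ ≤ L) →
      ∫⁻ x in dyadic k n, ‖carlesonSum c N T x‖ₑ ∂(volume.restrict E) ≤
        ENNReal.ofReal (6 * d / s * ((2 : ℝ) ^ (-k) * (4 * ‖treeMart c T ξ k₀ j n‖ ^ 2 -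
          4 * L * ‖treeMart c T ξ k₀ j n‖ + 2 * L ^ 2) + 4 * energy c T ξ k n))) ?_ ?_ hP hPs
  · rintro k n P hP hPs hno j rfl L hsL hm hi
    -- all bitiles of `T` contributing on `I` have longer time intervals, so there `N` takes values in
    -- the frequency interval of the bitile `Q` over the parent of `I`, where the density bound applies
    set Q := bitileAt ξ (k₀ + j - 1) (n / 2) with hQ
    have hsub : dyadic (k₀ + j) n ⊆ Q.time := by
      have := dyadic_subset_parent (k₀ + j - 1) n
      rwa [sub_add_cancel] at this
    have hlt : ∀ x ∈ dyadic (k₀ + j) n, ∀ P ∈ T, x ∈ P.time → P.k < k₀ + j := by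
      intro x hx P hP hxP
      by_contra h
      exact hno P hP (dyadic_subset (not_lt.1 h) hx hxP)
    have hbound : ∀ x ∈ dyadic (k₀ + j) n, ‖carlesonSum c N T x‖ₑ ≤
        (N ⁻¹' Q.freq).indicator (fun _ => ENNReal.ofReal (3 * L ^ 2 / s)) x := by
      intro x hx
      by_cases h0 : carlesonSum c N T x = 0
      · rw [h0]; simp
      obtain ⟨P', hP', hx', hN'⟩ := carlesonSum_ne_zero h0
      have hlt' := hlt x hx P' hP' hx'
      have hmem : x ∈ N ⁻¹' Q.freq :=
        Bitile.freq_subset (by simp only [bitileAt]; omega) (hξ P' hP')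
          (mem_freq_bitileAt hξ0 _ _) (P'.sub₂_freq_subset hN')
      rw [Set.indicator_of_mem hmem, ← ofReal_norm]
      refine ENNReal.ofReal_le_ofReal ?_
      obtain ⟨i, hij, hle⟩ := exists_norm_carlesonSum_le hs.le hsize hξ hT hξ0 N x j (hlt x hx)
      rw [mem_dyadic.1 hx] at hle
      have hi' : ‖treeMart c T ξ k₀ i (cell (k₀ + i) x)‖ ≤ L := by
        rcases hij.eq_or_lt with rfl | h
        · rwa [mem_dyadic.1 hx]
        · exact hi x hx i h
      have h3 : 3 * L ≤ 3 * L ^ 2 / s := by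
        rw [le_div_iff₀ hs]; nlinarith
      linarith
    have hfm : MeasurableSet (N ⁻¹' Q.freq) :=
      hN (by rw [Q.freq_eq]; exact measurableSet_dyadic _ _)
    have hdQ := hdens P hP Q hPs
      (Bitile.freq_subset (by have := dyadic_scale_le hPs; simpa [hQ, bitileAt] using this)
        (mem_freq_bitileAt hξ0 _ _) (hξ P hP))
    calc _ ≤ ∫⁻ x in dyadic (k₀ + j) n,
          (N ⁻¹' Q.freq).indicator (fun _ => ENNReal.ofReal (3 * L ^ 2 / s)) x
            ∂(volume.restrict E) := setLIntegral_mono' (measurableSet_dyadic _ _) hbound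
      _ = ENNReal.ofReal (3 * L ^ 2 / s) *
          volume ((N ⁻¹' Q.freq ∩ dyadic (k₀ + j) n) ∩ E) := by
        rw [lintegral_indicator_const hfm, Measure.restrict_apply hfm,
          Measure.restrict_apply (hfm.inter (measurableSet_dyadic _ _))]
      _ ≤ ENNReal.ofReal (3 * L ^ 2 / s) * ENNReal.ofReal (d * (2 : ℝ) ^ (-Q.k)) := by
        gcongr
        refine (measure_mono ?_).trans hdQ
        rintro x ⟨⟨h1, h2⟩, h3⟩
        exact ⟨h3, hsub h2, h1⟩
      _ ≤ _ := by
        rw [← ENNReal.ofReal_mul (by positivity)]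
        refine ENNReal.ofReal_le_ofReal ?_
        have e : (2 : ℝ) ^ (-Q.k) = 2 * (2 : ℝ) ^ (-(k₀ + j)) := by
          simp only [hQ, bitileAt]
          rw [show -(k₀ + (j : ℤ) - 1) = -(k₀ + j) + 1 by ring, zpow_add_one₀ two_ne_zero, mul_comm]
        have hen := energy_nonneg c T ξ (k₀ + j) n
        rw [e]
        set m := ‖treeMart c T ξ k₀ j n‖
        set w := (2 : ℝ) ^ (-(k₀ + (j : ℤ)))
        have hw : 0 < w := by positivity
        have h5 : L ^ 2 * w ≤
            w * (4 * m ^ 2 - 4 * L * m + 2 * L ^ 2) + 4 * energy c T ξ (k₀ + j) n := by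
          nlinarith [mul_nonneg hw.le (sq_nonneg (2 * m - L))]
        calc _ = 6 * d / s * (L ^ 2 * w) := by ring
          _ ≤ _ := mul_le_mul_of_nonneg_left h5 (by positivity)
  · rintro k n P hP hPs hL hR j rfl L hsL hm hi
    set m := ‖treeMart c T ξ k₀ j n‖ with hmdef
    set m₁ := ‖treeMart c T ξ k₀ (j + 1) (2 * n)‖ with hm₁
    set m₂ := ‖treeMart c T ξ k₀ (j + 1) (2 * n + 1)‖ with hm₂
    have hchild : ∀ b : ℤ, b = 0 ∨ b = 1 → ∀ L', L ≤ L' →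
        ∀ x ∈ dyadic (k₀ + j + 1) (2 * n + b), ∀ i < j + 1,
          ‖treeMart c T ξ k₀ i (cell (k₀ + i) x)‖ ≤ L' := by
      intro b hb L' hL' x hx i hij
      have hx' := dyadic_subset_parent _ _ hx
      rw [show (2 * n + b) / 2 = n by omega] at hx'
      rcases (Nat.lt_succ_iff.1 hij).eq_or_lt with rfl | h
      · rw [mem_dyadic.1 hx']; exact hm.trans hL'
      · exact (hi x hx' i h).trans hL'
    have h1 := hL (j + 1) (by push_cast; ring) (max L m₁) (hsL.trans (le_max_left _ _))
      (le_max_right _ _) (by simpa using hchild 0 (Or.inl rfl) _ (le_max_left L m₁))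
    have h2 := hR (j + 1) (by push_cast; ring) (max L m₂) (hsL.trans (le_max_left _ _))
      (le_max_right _ _) (hchild 1 (Or.inr rfl) _ (le_max_left L m₂))
    rw [dyadic_eq_union, lintegral_union (measurableSet_dyadic _ _) (dyadic_child_disjoint _ _)]
    refine (add_le_add h1 h2).trans ?_
    -- enlarging `L` to `max L a` does not increase the Bellman function at martingale value `a`
    have hmx : ∀ a : ℝ, 4 * a ^ 2 - 4 * max L a * a + 2 * max L a ^ 2 ≤
        4 * a ^ 2 - 4 * L * a + 2 * L ^ 2 := by
      intro a
      rcases le_total L a with h | h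
      · rw [max_eq_right h]; nlinarith [sq_nonneg (a - L)]
      · rw [max_eq_left h]
    have hpos : ∀ a b : ℝ, 0 ≤ 4 * a ^ 2 - 4 * b * a + 2 * b ^ 2 := by
      intro a b; nlinarith [sq_nonneg (2 * a - b), sq_nonneg b]
    have hen := energy_split c T ξ (k₀ + j) n
    have hen1 := energy_nonneg c T ξ (k₀ + j + 1) (2 * n)
    have hen2 := energy_nonneg c T ξ (k₀ + j + 1) (2 * n + 1)
    have hsq := treeMart_sq c T ξ k₀ j n
    have hsub := treeMart_le c T ξ k₀ j n
    rw [← hm₁, ← hm₂, ← hmdef] at hsq hsub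
    have hw0 : (0 : ℝ) < (2 : ℝ) ^ (-(k₀ + (j : ℤ) + 1)) := by positivity
    rw [← ENNReal.ofReal_add
      (mul_nonneg (by positivity) (add_nonneg (mul_nonneg hw0.le (hpos _ _)) (by positivity)))
      (mul_nonneg (by positivity) (add_nonneg (mul_nonneg hw0.le (hpos _ _)) (by positivity))),
      ← mul_add]
    refine ENNReal.ofReal_le_ofReal (mul_le_mul_of_nonneg_left ?_ (by positivity))
    have e : (2 : ℝ) ^ (-(k₀ + (j : ℤ))) = 2 * (2 : ℝ) ^ (-(k₀ + (j : ℤ) + 1)) := by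
      rw [show -(k₀ + (j : ℤ)) = -(k₀ + j + 1) + 1 by ring, zpow_add_one₀ two_ne_zero, mul_comm]
    have e2 : (2 : ℝ) ^ (k₀ + (j : ℤ)) * (2 : ℝ) ^ (-(k₀ + (j : ℤ) + 1)) = 1 / 2 := by
      rw [← zpow_add₀ two_ne_zero, show k₀ + (j : ℤ) + -(k₀ + j + 1) = -1 by ring]
      norm_num
    rw [e, hen]
    set w := (2 : ℝ) ^ (-(k₀ + (j : ℤ) + 1))
    set J := ‖jump c T ξ (k₀ + j) n‖ ^ 2
    have h3 := mul_le_mul_of_nonneg_left (hmx m₁) hw0.le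
    have h4 := mul_le_mul_of_nonneg_left (hmx m₂) hw0.le
    have hL0 : 0 ≤ L := hs.le.trans hsL
    have h5 : w * (m₁ ^ 2 + m₂ ^ 2) = 2 * w * m ^ 2 + J := by
      rw [hsq]; linear_combination (2 * J) * e2
    have h6 := mul_le_mul_of_nonneg_left hsub (mul_nonneg hw0.le hL0)
    nlinarith

/-- The tree estimate: on a tree with top interval `I` and top frequency `ξ`, the Walsh–Carleson sum
has `L^1` norm on `E` at most a constant times density times size times `|I|`. -/
theorem tree_estimate {c : Bitile → ℂ} {T : Finset Bitile} {s d : ℝ} (hs : 0 < s) (hd : 0 ≤ d)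
    (hsize : HasSize c T s) {N : ℝ → ℝ} (hN : Measurable N) {E : Set ℝ}
    (hdens : HasDens N E T d) {ξ : ℝ} {k n : ℤ} (hξ : ∀ P ∈ T, ξ ∈ P.freq)
    (hT : ∀ P ∈ T, P.time ⊆ dyadic k n) :
    ∫⁻ x in E, ‖carlesonSum c N T x‖ₑ ≤ ENNReal.ofReal (36 * d * s * (2 : ℝ) ^ (-k)) := by
  rcases T.eq_empty_or_nonempty with rfl | ⟨P, hP⟩
  · simp [carlesonSum]
  have h := lintegral_tree_le hs hd hsize hN hdens hξ (k₀ := k)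
    (fun P hP => dyadic_scale_le (hT P hP)) (Bitile.freq_nonneg (hξ P hP)) hP (hT P hP) 0 (by simp)
    s le_rfl (by simp [treeMart, hs.le]) (by simp)
  have hsupp : ∫⁻ x in E, ‖carlesonSum c N T x‖ₑ =
      ∫⁻ x in dyadic k n, ‖carlesonSum c N T x‖ₑ ∂(volume.restrict E) := by
    rw [← lintegral_indicator (measurableSet_dyadic k n)]
    congr 1
    funext x
    by_cases hx : x ∈ dyadic k n
    · rw [Set.indicator_of_mem hx]
    · rw [Set.indicator_of_notMem hx]
      by_contra h0
      obtain ⟨P, hP, hxP, -⟩ := carlesonSum_ne_zero (fun h => h0 (by rw [h]; simp))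
      exact hx (hT P hP hxP)
  rw [hsupp]
  refine h.trans (ENNReal.ofReal_le_ofReal ?_)
  have hen := hsize k n ξ
  have h6 : 0 ≤ 6 * d / s := by positivity
  have : (2 : ℝ) ^ (-k) * (4 * ‖treeMart c T ξ k 0 n‖ ^ 2 - 4 * s * ‖treeMart c T ξ k 0 n‖ +
      2 * s ^ 2) + 4 * energy c T ξ k n ≤ 6 * s ^ 2 * (2 : ℝ) ^ (-k) := by
    simp [treeMart] at *
    linarith
  refine (mul_le_mul_of_nonneg_left this h6).trans_eq ?_
  field_simp
  ring

/-! ### Selection of trees -/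

/-- The `L^1` norm on `E` of a Walsh–Carleson sum. -/
def carlesonNorm (c : Bitile → ℂ) (N : ℝ → ℝ) (E : Set ℝ) (T : Finset Bitile) : ℝ≥0∞ :=
  ∫⁻ x in E, ‖carlesonSum c N T x‖ₑ

theorem measurable_carlesonSum (c : Bitile → ℂ) {N : ℝ → ℝ} (hN : Measurable N)
    (T : Finset Bitile) : Measurable (carlesonSum c N T) := by
  refine Finset.measurable_fun_sum _ fun P _ => Measurable.indicator ?_ ?_
  · exact (Complex.measurable_ofReal.comp P.sub₁.measurable_wavePacket).const_mul _
  · exact hN (by rw [P.sub₂_freq_eq]; exact measurableSet_dyadic _ _)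

theorem carlesonNorm_sum_le (c : Bitile → ℂ) {N : ℝ → ℝ} (hN : Measurable N) (E : Set ℝ)
    {ι : Type*} (A : Finset ι) (T : Finset Bitile) (T' : ι → Finset Bitile)
    (h : ∀ x, carlesonSum c N T x = ∑ i ∈ A, carlesonSum c N (T' i) x) :
    carlesonNorm c N E T ≤ ∑ i ∈ A, carlesonNorm c N E (T' i) := by
  simp only [carlesonNorm]
  rw [← lintegral_finsetSum _ fun i _ => (measurable_carlesonSum c hN _).enorm]
  refine lintegral_mono fun x => ?_
  rw [h]
  exact enorm_sum_le _ _

theorem carlesonNorm_le_add (c : Bitile → ℂ) {N : ℝ → ℝ} (hN : Measurable N) (E : Set ℝ)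
    [DecidableEq Bitile] {T T' : Finset Bitile} (h : T' ⊆ T) :
    carlesonNorm c N E T ≤ carlesonNorm c N E (T \ T') + carlesonNorm c N E T' := by
  have := carlesonNorm_sum_le c hN E Finset.univ T (fun b : Bool => if b then T \ T' else T') (by
    intro x
    simp only [Fintype.sum_bool, if_true, Bool.false_eq_true, if_false]
    rw [carlesonSum, carlesonSum, carlesonSum, Finset.sum_sdiff h])
  simpa using this

/-- `B` bounds the norm of the Walsh–Carleson sum of every tree contained in `T`, relative to the
length of the top interval. -/
def TreeBound (c : Bitile → ℂ) (N : ℝ → ℝ) (E : Set ℝ) (T : Finset Bitile) (B : ℝ) : Prop :=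
  ∀ T' ⊆ T, ∀ (ξ : ℝ) (k n : ℤ), (∀ P ∈ T', ξ ∈ P.freq) → (∀ P ∈ T', P.time ⊆ dyadic k n) →
    carlesonNorm c N E T' ≤ ENNReal.ofReal (B * (2 : ℝ) ^ (-k))

theorem TreeBound.subset {c : Bitile → ℂ} {N : ℝ → ℝ} {E : Set ℝ} {T T' : Finset Bitile} {B : ℝ}
    (h : TreeBound c N E T B) (hT : T' ⊆ T) : TreeBound c N E T' B :=
  fun T'' hT'' => h T'' (hT''.trans hT)

/-- The bitiles violating a density bound `d` are organized into trees whose tops, being the maximal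
heavy bitiles, are pairwise disjoint; so the lengths of the tops add up to at most `|E| / d`. -/
theorem density_selection (c : Bitile → ℂ) {N : ℝ → ℝ} (hN : Measurable N) {E : Set ℝ}
    (hE : MeasurableSet E) (hEfin : volume E ≠ ∞) (T : Finset Bitile) {d : ℝ} (hd : 0 < d) :
    ∃ T' ⊆ T, HasDens N E T' d ∧ ∀ B : ℝ, 0 ≤ B → TreeBound c N E T B →
      carlesonNorm c N E T ≤ carlesonNorm c N E T' +
        ENNReal.ofReal (B * (volume.real E / d)) := by
  classical
  let heavy : Bitile → Prop := fun Q =>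
    ENNReal.ofReal (d * (2 : ℝ) ^ (-Q.k)) < volume (E ∩ (Q.time ∩ N ⁻¹' Q.freq))
  let H : Finset Bitile := T.filter fun P => ∃ Q, (P.time ⊆ Q.time ∧ Q.freq ⊆ P.freq) ∧ heavy Q
  have hbdd : ∃ b : ℤ, ∀ Q : Bitile, heavy Q → b ≤ Q.k := by
    obtain ⟨m, hm⟩ := pow_unbounded_of_one_lt (volume.real E / d) (one_lt_two (α := ℝ))
    refine ⟨-m, fun Q hQ => ?_⟩
    by_contra hlt
    have h1 : ENNReal.ofReal (d * (2 : ℝ) ^ (-Q.k)) < volume E :=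
      lt_of_lt_of_le hQ (measure_mono Set.inter_subset_left)
    rw [← ENNReal.ofReal_toReal hEfin, ENNReal.ofReal_lt_ofReal_iff_of_nonneg (by positivity)] at h1
    have h2 : (2 : ℝ) ^ m ≤ (2 : ℝ) ^ (-Q.k) := by
      rw [← zpow_natCast]
      exact zpow_le_zpow_right₀ (by norm_num) (by omega)
    rw [div_lt_iff₀ hd] at hm
    have h3 : (volume E).toReal = volume.real E := rfl
    nlinarith
  have htop : ∀ P ∈ H, ∃ Q, (P.time ⊆ Q.time ∧ Q.freq ⊆ P.freq ∧ heavy Q) ∧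
      ∀ Q', P.time ⊆ Q'.time → Q'.freq ⊆ P.freq → heavy Q' → Q.k ≤ Q'.k := by
    intro P hP
    obtain ⟨Q, ⟨h1, h2⟩, h3⟩ := (Finset.mem_filter.1 hP).2
    obtain ⟨b, hb⟩ := hbdd
    obtain ⟨k, ⟨Q, hQ, rfl⟩, hk⟩ := Int.exists_least_of_bdd
      (P := fun k => ∃ Q, (P.time ⊆ Q.time ∧ Q.freq ⊆ P.freq ∧ heavy Q) ∧ Q.k = k)
      ⟨b, by rintro _ ⟨Q, hQ, rfl⟩; exact hb Q hQ.2.2⟩ ⟨_, Q, ⟨h1, h2, h3⟩, rfl⟩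
    exact ⟨Q, hQ, fun Q' h1 h2 h3 => hk _ ⟨Q', ⟨h1, h2, h3⟩, rfl⟩⟩
  have : Nonempty Bitile := ⟨⟨0, 0, 0⟩⟩
  choose! top htop hmin using htop
  refine ⟨T \ H, Finset.sdiff_subset, ?_, ?_⟩
  · intro P hP Q h1 h2
    rw [Finset.mem_sdiff] at hP
    by_contra h
    exact hP.2 (Finset.mem_filter.2 ⟨hP.1, Q, ⟨h1, h2⟩, not_le.1 h⟩)
  intro B hB htree
  refine (carlesonNorm_le_add c hN E (Finset.filter_subset _ T : H ⊆ T)).trans ?_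
  gcongr
  have hfib := carlesonNorm_sum_le c hN E (H.image top) H (fun Q => H.filter fun P => top P = Q) (by
    intro x
    simp only [carlesonSum]
    exact (Finset.sum_fiberwise_of_maps_to (fun P hP => Finset.mem_image_of_mem top hP) _).symm)
  refine hfib.trans ?_
  have hle : ∀ Q ∈ H.image top, carlesonNorm c N E (H.filter fun P => top P = Q) ≤
      ENNReal.ofReal (B * (2 : ℝ) ^ (-Q.k)) := by
    intro Q _
    have hξ : ∃ ξ, ξ ∈ Q.freq := by rw [Q.freq_eq]; exact dyadic_nonempty _ _
    obtain ⟨ξ, hξ⟩ := hξ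
    refine htree _ ((Finset.filter_subset _ _).trans (Finset.filter_subset _ _)) ξ Q.k Q.n ?_ ?_
    · intro P hP
      obtain ⟨hPH, rfl⟩ := Finset.mem_filter.1 hP
      exact (htop P hPH).2.1 hξ
    · intro P hP
      obtain ⟨hPH, rfl⟩ := Finset.mem_filter.1 hP
      exact (htop P hPH).1
  refine (Finset.sum_le_sum hle).trans ?_
  rw [← ENNReal.ofReal_sum_of_nonneg fun _ _ => by positivity, ← Finset.mul_sum]
  refine ENNReal.ofReal_le_ofReal (mul_le_mul_of_nonneg_left ?_ hB)
  rw [le_div_iff₀ hd, Finset.sum_mul]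
  have hmeas : ∀ Q : Bitile, MeasurableSet (E ∩ (Q.time ∩ N ⁻¹' Q.freq)) := fun Q =>
    hE.inter ((measurableSet_dyadic _ _).inter
      (hN (by rw [Q.freq_eq]; exact measurableSet_dyadic _ _)))
  have hdisj : ((H.image top : Finset Bitile) : Set Bitile).PairwiseDisjoint
      fun Q => E ∩ (Q.time ∩ N ⁻¹' Q.freq) := by
    have key : ∀ P ∈ H, ∀ P' ∈ H, (top P).k ≤ (top P').k → ∀ x ∈ (top P).time, x ∈ (top P').time →
        N x ∈ (top P).freq → N x ∈ (top P').freq → top P = top P' := by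
      intro P hP P' hP' hk x h1 h2 h3 h4
      have hle := hmin P' hP' (top P) ((htop P' hP').1.trans (Bitile.time_subset hk h1 h2))
        ((Bitile.freq_subset hk h3 h4).trans (htop P' hP').2.1) (htop P hP).2.2
      exact Bitile.ext_of_mem (le_antisymm hk hle) h1 h2 h3 h4
    rintro Q hQ Q' hQ' hne
    obtain ⟨P, hP, rfl⟩ := Finset.mem_image.1 (Finset.mem_coe.1 hQ)
    obtain ⟨P', hP', rfl⟩ := Finset.mem_image.1 (Finset.mem_coe.1 hQ')
    rw [Function.onFun, Set.disjoint_left]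
    rintro x ⟨-, h1, h2⟩ ⟨-, h3, h4⟩
    rcases le_total (top P).k (top P').k with hk | hk
    · exact hne (key P hP P' hP' hk x h1 h3 h2 h4)
    · exact hne (key P' hP' P hP hk x h3 h1 h4 h2).symm
  have hsum : ∑ Q ∈ H.image top, ENNReal.ofReal (d * (2 : ℝ) ^ (-Q.k)) ≤ volume E := by
    calc _ ≤ ∑ Q ∈ H.image top, volume (E ∩ (Q.time ∩ N ⁻¹' Q.freq)) := by
          refine Finset.sum_le_sum fun Q hQ => ?_
          obtain ⟨P, hP, rfl⟩ := Finset.mem_image.1 hQ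
          exact (htop P hP).2.2.le
      _ = volume (⋃ Q ∈ H.image top, E ∩ (Q.time ∩ N ⁻¹' Q.freq)) :=
          (measure_biUnion_finset hdisj fun Q _ => hmeas Q).symm
      _ ≤ volume E := measure_mono (Set.iUnion₂_subset fun _ _ => Set.inter_subset_left)
  rw [← ENNReal.ofReal_sum_of_nonneg fun _ _ => by positivity, ← ENNReal.ofReal_toReal hEfin,
    ENNReal.ofReal_le_ofReal_iff ENNReal.toReal_nonneg] at hsum
  change _ ≤ volume.real E at hsum
  simpa only [mul_comm] using hsum

theorem Bitile.freq_subset_sub₂ {P Q : Bitile} {ξ : ℝ} (hk : P.k < Q.k)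
    (hξ : ξ ∈ P.freq) (hξ' : ξ ∈ Q.sub₂.freq) : P.freq ⊆ Q.sub₂.freq := by
  simp only [Bitile.freq_eq, Bitile.sub₂_freq_eq] at *
  exact dyadic_subset (by omega) hξ' hξ

theorem Bitile.lt_of_mem_sub {P : Bitile} {ξ η : ℝ} (hξ : ξ ∈ P.sub₁.freq)
    (hη : η ∈ P.sub₂.freq) : ξ < η := by
  have h1 := hξ.2
  have h2 := hη.1
  simp only [Bitile.sub₁, Bitile.sub₂] at h1 h2
  push_cast at h1 h2
  linarith

/-- A frequency at which the energy of `T` exceeds `s^2 |I|` over some dyadic interval `I`. -/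
def ExcessFreq (c : Bitile → ℂ) (s : ℝ) (T : Finset Bitile) (ξ : ℝ) : Prop :=
  ∃ k n, s ^ 2 * (2 : ℝ) ^ (-k) < energy c T ξ k n

theorem exists_excessFreq_le {c : Bitile → ℂ} {s : ℝ} {T : Finset Bitile} {ξ : ℝ}
    (h : ExcessFreq c s T ξ) :
    ∃ Q ∈ T, (2 : ℝ) ^ Q.k * (2 * Q.l + 1) ≤ ξ ∧
      ExcessFreq c s T ((2 : ℝ) ^ Q.k * (2 * Q.l + 1)) := by
  classical
  obtain ⟨k, n, h⟩ := h
  set A := T.filter fun P => P.time ⊆ dyadic k n ∧ ξ ∈ P.sub₂.freq with hA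
  have hfreq : ∀ (P : Bitile) (η : ℝ), η ∈ P.sub₂.freq ↔
      (2 : ℝ) ^ P.k * (2 * P.l + 1) ≤ η ∧ η < (2 : ℝ) ^ P.k * (2 * P.l + 1 + 1) := by
    intro P η
    simp [Tile.freq, Bitile.sub₂, Set.mem_Ico]
  have hne : A.Nonempty := by
    by_contra hne
    rw [Finset.not_nonempty_iff_eq_empty] at hne
    rw [energy] at h
    have : energy c T ξ k n = 0 := by rw [energy, ← hA, hne, Finset.sum_empty]
    rw [energy] at this
    rw [this] at h
    exact absurd h (not_lt.2 (by positivity))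
  obtain ⟨Q, hQ, hmax⟩ := A.exists_max_image (fun P => (2 : ℝ) ^ P.k * (2 * P.l + 1)) hne
  have hQ' := Finset.mem_filter.1 hQ
  have hQξ := ((hfreq Q ξ).1 hQ'.2.2).1
  refine ⟨Q, hQ'.1, hQξ, k, n, h.trans_le ?_⟩
  refine Finset.sum_le_sum_of_subset_of_nonneg ?_ fun _ _ _ => by positivity
  intro P hP
  have hP' := Finset.mem_filter.1 hP
  refine Finset.mem_filter.2 ⟨hP'.1, hP'.2.1, ?_⟩
  have h1 := (hfreq P ξ).1 hP'.2.2
  exact (hfreq P _).2 ⟨hmax P hP, hQξ.trans_lt h1.2⟩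

/-- The bitiles violating a size bound `s` are organized into trees, each containing a tree of upper
type with large energy. Choosing the lowest top frequency at each step makes the lower tiles of all
these upper trees (collected in `D`) pairwise disjoint. -/
theorem size_selection (c : Bitile → ℂ) {N : ℝ → ℝ} (hN : Measurable N) (E : Set ℝ) {s : ℝ}
    (T : Finset Bitile) :
    ∃ T' ⊆ T, ∃ D ⊆ T, ∃ τ : ℝ, 0 ≤ τ ∧ HasSize c T' s ∧
      ((D : Set Bitile).Pairwise fun P Q =>
        Disjoint P.sub₁.time Q.sub₁.time ∨ Disjoint P.sub₁.freq Q.sub₁.freq) ∧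
      s ^ 2 * τ ≤ ∑ P ∈ D, ‖c P‖ ^ 2 ∧
      (∀ P ∈ D, ∃ ξ ∈ P.sub₂.freq, ExcessFreq c s T ξ) ∧
      ∀ B : ℝ, 0 ≤ B → TreeBound c N E T B →
        carlesonNorm c N E T ≤ carlesonNorm c N E T' + ENNReal.ofReal (B * τ) := by
  classical
  induction T using Finset.strongInduction with
  | _ T ih =>
  by_cases hsz : HasSize c T s
  · exact ⟨T, le_rfl, ∅, Finset.empty_subset _, 0, le_rfl, hsz, by simp, by simp, by simp, by simp⟩
  have hex : ∃ ξ, ExcessFreq c s T ξ := by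
    simp only [HasSize, not_forall, not_le] at hsz
    obtain ⟨k, n, ξ, h⟩ := hsz
    exact ⟨ξ, k, n, h⟩
  obtain ⟨ξ, hξ, hξmin⟩ : ∃ ξ, ExcessFreq c s T ξ ∧ ∀ η, ExcessFreq c s T η → ξ ≤ η := by
    obtain ⟨η, hη⟩ := hex
    obtain ⟨Q, hQ, -, hQe⟩ := exists_excessFreq_le hη
    obtain ⟨R, hR, hRmin⟩ := (T.filter fun Q => ExcessFreq c s T ((2 : ℝ) ^ Q.k * (2 * Q.l + 1))
      ).exists_min_image (fun P => (2 : ℝ) ^ P.k * (2 * P.l + 1))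
      ⟨Q, Finset.mem_filter.2 ⟨hQ, hQe⟩⟩
    refine ⟨_, (Finset.mem_filter.1 hR).2, fun η' hη' => ?_⟩
    obtain ⟨Q', hQ', hle, hQe'⟩ := exists_excessFreq_le hη'
    exact (hRmin Q' (Finset.mem_filter.2 ⟨hQ', hQe'⟩)).trans hle
  obtain ⟨k, n, hkn⟩ := hξ
  set U := T.filter fun P => P.time ⊆ dyadic k n ∧ ξ ∈ P.freq with hU
  set U₂ := T.filter fun P => P.time ⊆ dyadic k n ∧ ξ ∈ P.sub₂.freq with hU₂
  have hUT : U ⊆ T := Finset.filter_subset _ _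
  have hU₂U : U₂ ⊆ U := fun P hP => by
    have := Finset.mem_filter.1 hP
    exact Finset.mem_filter.2 ⟨this.1, this.2.1, P.sub₂_freq_subset this.2.2⟩
  have hen : energy c T ξ k n = ∑ P ∈ U₂, ‖c P‖ ^ 2 := rfl
  have hU₂n : U₂.Nonempty := by
    by_contra hne
    rw [Finset.not_nonempty_iff_eq_empty] at hne
    rw [hen, hne, Finset.sum_empty] at hkn
    exact absurd hkn (not_lt.2 (by positivity))
  have hss : T \ U ⊂ T := Finset.sdiff_ssubset hUT (hU₂n.mono hU₂U)
  obtain ⟨T', hT', D, hD, τ, hτ, hsize, hpair, hDτ, hDex, hB⟩ := ih (T \ U) hss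
  have hmono : ∀ η, ExcessFreq c s (T \ U) η → ExcessFreq c s T η := by
    rintro η ⟨k, n, h⟩
    exact ⟨k, n, h.trans_le (energy_mono Finset.sdiff_subset _ _ _)⟩
  have hdisj : Disjoint U₂ D := by
    rw [Finset.disjoint_left]
    exact fun P hP hP' => (Finset.mem_sdiff.1 (hD hP')).2 (hU₂U hP)
  have hcross : ∀ P ∈ U₂, ∀ Q ∈ D,
      Disjoint P.sub₁.time Q.sub₁.time ∨ Disjoint P.sub₁.freq Q.sub₁.freq := by
    intro P hP Q hQ
    by_contra hcon
    rw [not_or, Set.not_disjoint_iff, Set.not_disjoint_iff] at hcon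
    obtain ⟨⟨x, hxP, hxQ⟩, ⟨η, hηP, hηQ⟩⟩ := hcon
    have hP' := Finset.mem_filter.1 hP
    have hQ' := Finset.mem_sdiff.1 (hD hQ)
    rcases lt_trichotomy P.k Q.k with hk | hk | hk
    · refine hQ'.2 (Finset.mem_filter.2 ⟨hQ'.1, ?_, ?_⟩)
      · exact (Bitile.time_subset hk.le hxP hxQ).trans hP'.2.1
      · exact Q.sub₁_freq_subset (Bitile.freq_subset_sub₁ hk (P.sub₁_freq_subset hηP) hηQ
          (P.sub₂_freq_subset hP'.2.2))
    · have := Bitile.ext_of_mem hk hxP hxQ (P.sub₁_freq_subset hηP) (Q.sub₁_freq_subset hηQ)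
      exact hQ'.2 (this ▸ hU₂U hP)
    · obtain ⟨ξ', hξ', hex'⟩ := hDex Q hQ
      have h1 := Bitile.freq_subset_sub₁ hk (Q.sub₁_freq_subset hηQ) hηP (Q.sub₂_freq_subset hξ')
      have h2 := Bitile.lt_of_mem_sub h1 hP'.2.2
      exact absurd (hξmin ξ' (hmono _ hex')) (not_le.2 h2)
  have hU₂pair : ∀ P ∈ U₂, ∀ Q ∈ U₂, P ≠ Q →
      Disjoint P.sub₁.time Q.sub₁.time ∨ Disjoint P.sub₁.freq Q.sub₁.freq := by
    have key : ∀ P ∈ U₂, ∀ Q ∈ U₂, P.k < Q.k → Disjoint P.sub₁.freq Q.sub₁.freq := by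
      intro P hP Q hQ hk
      have h := Bitile.freq_subset_sub₂ hk (P.sub₂_freq_subset (Finset.mem_filter.1 hP).2.2)
        (Finset.mem_filter.1 hQ).2.2
      exact (Q.sub_freq_disjoint.symm).mono_left (P.sub₁_freq_subset.trans h)
    intro P hP Q hQ hne
    rcases lt_trichotomy P.k Q.k with hk | hk | hk
    · exact Or.inr (key P hP Q hQ hk)
    · left
      rw [Set.disjoint_left]
      intro x h1 h2
      exact hne (Bitile.ext_of_mem hk h1 h2 (P.sub₂_freq_subset (Finset.mem_filter.1 hP).2.2)
        (Q.sub₂_freq_subset (Finset.mem_filter.1 hQ).2.2))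
    · exact Or.inr (key Q hQ P hP hk).symm
  refine ⟨T', hT'.trans hss.subset, U₂ ∪ D,
    Finset.union_subset (hU₂U.trans hUT) (hD.trans hss.subset), (2 : ℝ) ^ (-k) + τ, by positivity,
    hsize, ?_, ?_, ?_, ?_⟩
  · intro P hP Q hQ hne
    rw [Finset.mem_coe, Finset.mem_union] at hP hQ
    rcases hP with hP | hP <;> rcases hQ with hQ | hQ
    · exact hU₂pair P hP Q hQ hne
    · exact hcross P hP Q hQ
    · exact (hcross Q hQ P hP).imp (fun h => h.symm) fun h => h.symm
    · exact hpair hP hQ hne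
  · rw [Finset.sum_union hdisj, mul_add, ← hen]
    exact add_le_add hkn.le hDτ
  · intro P hP
    rcases Finset.mem_union.1 hP with hP | hP
    · exact ⟨ξ, (Finset.mem_filter.1 hP).2.2, k, n, hkn⟩
    · obtain ⟨η, h1, h2⟩ := hDex P hP
      exact ⟨η, h1, hmono _ h2⟩
  · intro B hB0 htree
    have h1 := hB B hB0 (htree.subset hss.subset)
    have h2 := htree U hUT ξ k n (fun P hP => (Finset.mem_filter.1 hP).2.2)
      fun P hP => (Finset.mem_filter.1 hP).2.1
    refine (carlesonNorm_le_add c hN E hUT).trans ((add_le_add h1 h2).trans_eq ?_)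
    rw [add_assoc, ← ENNReal.ofReal_add (by positivity) (by positivity)]
    congr 2; ring

/-! ### The main estimate for finite collections -/

/-- The contribution of the `m`-th step of the decomposition decays geometrically in `|m|`. -/
theorem min_mul_min_le {σ ρ θ : ℝ} (hσ : 0 < σ) (hρ : 0 < ρ) (hθ0 : 0 < θ) (hθ1 : θ < 1) (m : ℤ) :
    min 1 ((4 : ℝ) ^ m) * min σ ((2 : ℝ) ^ m * ρ) * (4 : ℝ) ^ (-m) ≤
      σ ^ (1 - θ) * ρ ^ θ * ((2 : ℝ) ^ (-θ)) ^ m.natAbs := by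
  set t := (2 : ℝ) ^ m with ht
  have ht0 : 0 < t := by positivity
  have h4 : (4 : ℝ) ^ m = t ^ 2 := by
    rw [ht, ← zpow_natCast, ← zpow_mul, mul_comm, zpow_mul]; norm_num
  have h1 : min σ (t * ρ) ≤ σ ^ (1 - θ) * (t ^ θ * ρ ^ θ) := by
    rw [← Real.mul_rpow ht0.le hρ.le]
    have hm : 0 < min σ (t * ρ) := lt_min hσ (by positivity)
    calc min σ (t * ρ) = min σ (t * ρ) ^ (1 - θ) * min σ (t * ρ) ^ θ := by
          rw [← Real.rpow_add hm]; simp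
      _ ≤ _ := by
          gcongr
          · exact min_le_left _ _
          · exact min_le_right _ _
  have h2 : min 1 ((4 : ℝ) ^ m) * (4 : ℝ) ^ (-m) * t ^ θ ≤ ((2 : ℝ) ^ (-θ)) ^ m.natAbs := by
    obtain ⟨j, rfl | rfl⟩ := m.eq_nat_or_neg
    · have : min 1 ((4 : ℝ) ^ (j : ℤ)) ≤ 1 := min_le_left _ _
      calc _ ≤ 1 * (4 : ℝ) ^ (-(j : ℤ)) * t ^ θ := by gcongr
        _ = ((2 : ℝ) ^ (θ - 2)) ^ j := by
            rw [ht, one_mul, zpow_natCast, ← Real.rpow_natCast, ← Real.rpow_mul (by norm_num),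
              ← Real.rpow_natCast, ← Real.rpow_mul (by norm_num), ← Real.rpow_intCast,
              show (4 : ℝ) = 2 ^ (2 : ℝ) by norm_num, ← Real.rpow_mul (by norm_num),
              ← Real.rpow_add (by norm_num)]
            congr 1
            push_cast; ring
        _ ≤ _ := by
            rw [Int.natAbs_natCast]
            gcongr
            · norm_num
            · linarith
    · have : min 1 ((4 : ℝ) ^ (-(j : ℤ))) ≤ (4 : ℝ) ^ (-(j : ℤ)) := min_le_right _ _
      calc _ ≤ (4 : ℝ) ^ (-(j : ℤ)) * (4 : ℝ) ^ (- -(j : ℤ)) * t ^ θ := by gcongr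
        _ = ((2 : ℝ) ^ (-θ)) ^ j := by
            rw [← zpow_add₀ (by norm_num), add_neg_cancel, zpow_zero, one_mul, ht,
              ← Real.rpow_natCast, ← Real.rpow_mul (by norm_num), ← Real.rpow_intCast,
              ← Real.rpow_mul (by norm_num)]
            congr 1
            push_cast; ring
        _ ≤ _ := by simp
  calc _ ≤ min 1 ((4 : ℝ) ^ m) * (σ ^ (1 - θ) * (t ^ θ * ρ ^ θ)) * (4 : ℝ) ^ (-m) := by gcongr
    _ = σ ^ (1 - θ) * ρ ^ θ * (min 1 ((4 : ℝ) ^ m) * (4 : ℝ) ^ (-m) * t ^ θ) := by ring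
    _ ≤ _ := by gcongr

theorem hasDens_one {N : ℝ → ℝ} {E : Set ℝ} (T : Finset Bitile) : HasDens N E T 1 := by
  intro P _ Q _ _
  rw [one_mul, ← volume_dyadic Q.k Q.n]
  exact measure_mono fun x hx => hx.2.1

/-- Bessel's inequality for the lower tiles of a collection of bitiles, with constant `a`. -/
def HasBessel (c : Bitile → ℂ) (T : Finset Bitile) (a : ℝ) : Prop :=
  ∀ D ⊆ T, ((D : Set Bitile).Pairwise fun P Q =>
    Disjoint P.sub₁.time Q.sub₁.time ∨ Disjoint P.sub₁.freq Q.sub₁.freq) →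
    ∑ P ∈ D, ‖c P‖ ^ 2 ≤ a

/-- One step of the decomposition: density is lowered by the factor four and size by the factor
two, at the cost of trees whose total contribution is controlled. -/
theorem carlesonNorm_step {c : Bitile → ℂ} {N : ℝ → ℝ} (hN : Measurable N) {E : Set ℝ}
    (hE : MeasurableSet E) (hEfin : volume E ≠ ∞) {T : Finset Bitile} {σ ρ θ : ℝ} (hσ : 0 < σ)
    (hρ : 0 < ρ) (hθ0 : 0 < θ) (hθ1 : θ < 1) (hbes : HasBessel c T (ρ ^ 2 * volume.real E))
    (hsize : HasSize c T σ) (m : ℤ) (hdm : HasDens N E T ((4 : ℝ) ^ m))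
    (hsm : HasSize c T ((2 : ℝ) ^ m * ρ)) :
    ∃ T' ⊆ T, HasDens N E T' ((4 : ℝ) ^ (m - 1)) ∧ HasSize c T' ((2 : ℝ) ^ (m - 1) * ρ) ∧
      carlesonNorm c N E T ≤ carlesonNorm c N E T' +
        ENNReal.ofReal (288 * volume.real E * (σ ^ (1 - θ) * ρ ^ θ) *
          ((2 : ℝ) ^ (-θ)) ^ m.natAbs) := by
  set d := min 1 ((4 : ℝ) ^ m) with hd
  set s := min σ ((2 : ℝ) ^ m * ρ) with hs
  have hd0 : 0 < d := lt_min one_pos (by positivity)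
  have hs0 : 0 < s := lt_min hσ (by positivity)
  have hdT : HasDens N E T d := by
    rcases min_choice 1 ((4 : ℝ) ^ m) with h | h
    · rw [hd, h]; exact hasDens_one T
    · rw [hd, h]; exact hdm
  have hsT : HasSize c T s := by
    rcases min_choice σ ((2 : ℝ) ^ m * ρ) with h | h
    · rw [hs, h]; exact hsize
    · rw [hs, h]; exact hsm
  set B := 36 * d * s with hB
  have hB0 : 0 ≤ B := by positivity
  have htree : TreeBound c N E T B := by
    intro T' hT' ξ k n h1 h2
    exact tree_estimate hs0 hd0.le (hsT.subset hT') hN (hdT.subset hT') h1 h2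
  obtain ⟨T₁, hT₁, hd₁, h₁⟩ := density_selection c hN hE hEfin T
    (d := (4 : ℝ) ^ (m - 1)) (by positivity)
  obtain ⟨T₂, hT₂, D, hD, τ, hτ, hs₂, hpair, hDτ, -, h₂⟩ := size_selection c hN E
    (s := (2 : ℝ) ^ (m - 1) * ρ) T₁
  refine ⟨T₂, hT₂.trans hT₁, hd₁.subset hT₂, hs₂, ?_⟩
  have h4 : ((2 : ℝ) ^ (m - 1)) ^ 2 = (4 : ℝ) ^ (m - 1) := by
    rw [← zpow_natCast, ← zpow_mul, mul_comm, zpow_mul]; norm_num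
  have hτ' : τ ≤ volume.real E / (4 : ℝ) ^ (m - 1) := by
    have h := hDτ.trans (hbes D (hD.trans hT₁) hpair)
    rw [mul_pow, h4] at h
    rw [le_div_iff₀ (by positivity)]
    have h5 : ρ ^ 2 * (τ * (4 : ℝ) ^ (m - 1)) ≤ ρ ^ 2 * volume.real E := by linarith
    exact le_of_mul_le_mul_left h5 (by positivity)
  have e1 := h₁ B hB0 htree
  have e2 := h₂ B hB0 (htree.subset hT₁)
  refine (e1.trans (add_le_add_left e2 _)).trans ?_
  rw [add_assoc, ← ENNReal.ofReal_add (by positivity) (by positivity)]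
  gcongr
  have e4 : volume.real E / (4 : ℝ) ^ (m - 1) = 4 * volume.real E * (4 : ℝ) ^ (-m) := by
    rw [zpow_sub_one₀ (by norm_num), zpow_neg]; field_simp
  have key := min_mul_min_le hσ hρ hθ0 hθ1 m
  calc B * τ + B * (volume.real E / (4 : ℝ) ^ (m - 1))
      ≤ B * (volume.real E / (4 : ℝ) ^ (m - 1)) + B * (volume.real E / (4 : ℝ) ^ (m - 1)) := by
        gcongr
    _ = 288 * volume.real E * (d * s * (4 : ℝ) ^ (-m)) := by rw [e4, hB]; ring
    _ ≤ 288 * volume.real E * (σ ^ (1 - θ) * ρ ^ θ * ((2 : ℝ) ^ (-θ)) ^ m.natAbs) := by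
        gcongr
    _ = _ := by ring

/-- The trivial bound, used for what is left after many steps of the decomposition. -/
theorem carlesonNorm_le_of_hasSize {c : Bitile → ℂ} {N : ℝ → ℝ} (hN : Measurable N) (E : Set ℝ)
    {T : Finset Bitile} {s : ℝ} (hs : 0 ≤ s) (hsize : HasSize c T s) :
    carlesonNorm c N E T ≤ ENNReal.ofReal (s * ∑ P ∈ T, (2 : ℝ) ^ (-P.k)) := by
  refine (carlesonNorm_sum_le c hN E T T (fun P => {P}) fun x => by simp [carlesonSum]).trans ?_
  rw [Finset.mul_sum, ENNReal.ofReal_sum_of_nonneg fun _ _ => by positivity]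
  refine Finset.sum_le_sum fun P hP => ?_
  rw [carlesonNorm]
  calc _ ≤ ∫⁻ x in E, (dyadic P.k P.n).indicator (fun _ => ENNReal.ofReal s) x := by
        refine lintegral_mono fun x => ?_
        by_cases h0 : carlesonSum c N {P} x = 0
        · rw [h0]; simp
        obtain ⟨Q, hQ, hx, -⟩ := carlesonSum_ne_zero h0
        rw [Finset.mem_singleton] at hQ
        subst hQ
        rw [Set.indicator_of_mem (by exact hx), ← ofReal_norm]
        refine ENNReal.ofReal_le_ofReal ?_
        rw [carlesonSum, Finset.sum_singleton]
        exact (norm_indicator_le_norm_self _ _).trans (hsize.norm_mul_le hs hP x)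
    _ ≤ ∫⁻ x, (dyadic P.k P.n).indicator (fun _ => ENNReal.ofReal s) x :=
        lintegral_mono' Measure.restrict_le_self le_rfl
    _ = _ := by
        rw [lintegral_indicator_const (measurableSet_dyadic _ _), volume_dyadic,
          ENNReal.ofReal_mul hs]

/-- The result of `j` steps of the decomposition, starting at density `4^m` and size `2^m ρ`. -/
theorem carlesonNorm_iterate {c : Bitile → ℂ} {N : ℝ → ℝ} (hN : Measurable N) {E : Set ℝ}
    (hE : MeasurableSet E) (hEfin : volume E ≠ ∞) {σ ρ θ : ℝ} (hσ : 0 < σ)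
    (hρ : 0 < ρ) (hθ0 : 0 < θ) (hθ1 : θ < 1) (j : ℕ) : ∀ (T : Finset Bitile) (m : ℤ),
    HasBessel c T (ρ ^ 2 * volume.real E) → HasSize c T σ → HasDens N E T ((4 : ℝ) ^ m) →
    HasSize c T ((2 : ℝ) ^ m * ρ) →
    carlesonNorm c N E T ≤ ENNReal.ofReal (288 * volume.real E * (σ ^ (1 - θ) * ρ ^ θ) *
      ∑ i ∈ Finset.range j, ((2 : ℝ) ^ (-θ)) ^ (m - i).natAbs) +
      ENNReal.ofReal ((2 : ℝ) ^ (m - j) * ρ * ∑ P ∈ T, (2 : ℝ) ^ (-P.k)) := by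
  induction j with
  | zero =>
    intro T m _ _ _ hsm
    simpa using carlesonNorm_le_of_hasSize hN E (by positivity) hsm
  | succ j ih =>
    intro T m hbes hsize hdm hsm
    obtain ⟨T', hT', hd', hs', h⟩ :=
      carlesonNorm_step hN hE hEfin hσ hρ hθ0 hθ1 hbes hsize m hdm hsm
    have h' := ih T' (m - 1) (fun D hD => hbes D (hD.trans hT')) (hsize.subset hT') hd' hs'
    refine h.trans ((add_le_add_left h' _).trans ?_)
    rw [Finset.sum_range_succ', mul_add, ENNReal.ofReal_add (by positivity) (by positivity)]
    simp only [Nat.cast_zero, sub_zero]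
    rw [add_right_comm]
    have e : ∀ i : ℕ, m - 1 - (i : ℤ) = m - ((i + 1 : ℕ) : ℤ) := fun i => by push_cast; ring
    simp only [e]
    gcongr

theorem summable_pow_natAbs {r : ℝ} (h0 : 0 ≤ r) (h1 : r < 1) :
    Summable fun z : ℤ => r ^ z.natAbs := by
  refine Summable.of_nat_of_neg ?_ ?_
  · simpa using summable_geometric_of_lt_one h0 h1
  · simpa using summable_geometric_of_lt_one h0 h1

/-- The main estimate: `∫_E |C_T f|` for a finite collection of size at most `σ`, where `ρ^2 |E|`
stands for `‖f‖_2^2`. -/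
theorem exists_carlesonNorm_le {θ : ℝ} (hθ0 : 0 < θ) (hθ1 : θ < 1) :
    ∃ C : ℝ, 0 < C ∧ ∀ (c : Bitile → ℂ) (N : ℝ → ℝ), Measurable N → ∀ E : Set ℝ, MeasurableSet E →
      volume E ≠ ∞ → ∀ (σ ρ : ℝ), 0 < σ → 0 < ρ → ∀ T : Finset Bitile,
      HasBessel c T (ρ ^ 2 * volume.real E) → HasSize c T σ →
      carlesonNorm c N E T ≤ ENNReal.ofReal (C * volume.real E * (σ ^ (1 - θ) * ρ ^ θ)) := by
  set r := (2 : ℝ) ^ (-θ) with hr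
  have hr0 : 0 < r := by positivity
  have hr1 : r < 1 := Real.rpow_lt_one_of_one_lt_of_neg (by norm_num) (by linarith)
  have hsum := summable_pow_natAbs hr0.le hr1
  have hS0 : 0 < ∑' z : ℤ, r ^ z.natAbs := hsum.tsum_pos (fun _ => by positivity) 0 (by simp)
  refine ⟨288 * ∑' z : ℤ, r ^ z.natAbs, by positivity, ?_⟩
  intro c N hN E hE hEfin σ ρ hσ hρ T hbes hsize
  obtain ⟨m, hm⟩ := pow_unbounded_of_one_lt (σ / ρ) (one_lt_two (α := ℝ))
  rw [div_lt_iff₀ hρ] at hm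
  have hdm : HasDens N E T ((4 : ℝ) ^ (m : ℤ)) := by
    intro P hP Q h1 h2
    refine (hasDens_one T P hP Q h1 h2).trans (ENNReal.ofReal_le_ofReal ?_)
    have : (1 : ℝ) ≤ (4 : ℝ) ^ (m : ℤ) := by
      rw [zpow_natCast]; exact one_le_pow₀ (by norm_num)
    gcongr
  have hsm : HasSize c T ((2 : ℝ) ^ (m : ℤ) * ρ) := by
    intro k n ξ
    refine (hsize k n ξ).trans ?_
    rw [zpow_natCast]
    gcongr
  have hj : ∀ j : ℕ, carlesonNorm c N E T ≤
      ENNReal.ofReal (288 * (∑' z : ℤ, r ^ z.natAbs) * volume.real E * (σ ^ (1 - θ) * ρ ^ θ)) +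
      ENNReal.ofReal ((2 : ℝ) ^ ((m : ℤ) - j) * ρ * ∑ P ∈ T, (2 : ℝ) ^ (-P.k)) := by
    intro j
    refine (carlesonNorm_iterate hN hE hEfin hσ hρ hθ0 hθ1 j T m hbes hsize hdm hsm).trans ?_
    gcongr ENNReal.ofReal ?_ + _
    have h1 : ∑ i ∈ Finset.range j, r ^ ((m : ℤ) - i).natAbs ≤ ∑' z : ℤ, r ^ z.natAbs := by
      rw [← Finset.sum_image (g := fun i : ℕ => (m : ℤ) - i) (f := fun z : ℤ => r ^ z.natAbs)
        fun a _ b _ h => by simpa using h]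
      exact hsum.sum_le_tsum _ fun _ _ => by positivity
    calc _ ≤ 288 * volume.real E * (σ ^ (1 - θ) * ρ ^ θ) * ∑' z : ℤ, r ^ z.natAbs := by gcongr
      _ = _ := by ring
  have hlim : Filter.Tendsto (fun j : ℕ =>
      ENNReal.ofReal (288 * (∑' z : ℤ, r ^ z.natAbs) * volume.real E * (σ ^ (1 - θ) * ρ ^ θ)) +
      ENNReal.ofReal ((2 : ℝ) ^ ((m : ℤ) - j) * ρ * ∑ P ∈ T, (2 : ℝ) ^ (-P.k))) Filter.atTop
      (nhds (ENNReal.ofReal (288 * (∑' z : ℤ, r ^ z.natAbs) * volume.real E *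
        (σ ^ (1 - θ) * ρ ^ θ)) + ENNReal.ofReal 0)) := by
    refine Filter.Tendsto.add tendsto_const_nhds (ENNReal.tendsto_ofReal ?_)
    have h2 : Filter.Tendsto (fun j : ℕ => (2 : ℝ) ^ ((m : ℤ) - j)) Filter.atTop (nhds 0) := by
      have e : ∀ j : ℕ, (2 : ℝ) ^ ((m : ℤ) - j) = (2 : ℝ) ^ m * (1 / 2) ^ j := by
        intro j
        rw [zpow_sub₀ two_ne_zero, zpow_natCast, zpow_natCast, one_div, inv_pow, div_eq_mul_inv]
      simp_rw [e]
      simpa using (tendsto_pow_atTop_nhds_zero_of_lt_one (by norm_num : (0 : ℝ) ≤ 1 / 2)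
        (by norm_num)).const_mul ((2 : ℝ) ^ m)
    simpa [mul_assoc] using h2.mul_const (ρ * ∑ P ∈ T, (2 : ℝ) ^ (-P.k))
  have := ge_of_tendsto' hlim hj
  simpa using this

/-! ### Restricted weak type estimates -/

/-- The set where the dyadic maximal function of `f` exceeds `A`: the union of the dyadic intervals
over which the average of `|f|` is larger than `A`. -/
def maximalSet (f : ℝ → ℂ) (A : ℝ) : Set ℝ :=
  ⋃ (k : ℤ) (n : ℤ) (_ : A * (2 : ℝ) ^ (-k) < ∫ x in dyadic k n, ‖f x‖), dyadic k n

theorem measurableSet_maximalSet (f : ℝ → ℂ) (A : ℝ) : MeasurableSet (maximalSet f A) :=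
  MeasurableSet.iUnion fun k => MeasurableSet.iUnion fun n => MeasurableSet.iUnion fun _ =>
    measurableSet_dyadic k n

/-- The weak type `(1,1)` bound for the dyadic maximal function. -/
theorem volume_maximalSet_le {f : ℝ → ℂ} (hf : Integrable f) {A : ℝ} (hA : 0 < A) :
    volume (maximalSet f A) ≤ ENNReal.ofReal ((∫ x, ‖f x‖) / A) := by
  let bad : ℤ → ℤ → Prop := fun k n => A * (2 : ℝ) ^ (-k) < ∫ x in dyadic k n, ‖f x‖
  let M : Set (ℤ × ℤ) := {I | bad I.1 I.2 ∧ ∀ k n, bad k n → dyadic I.1 I.2 ⊆ dyadic k n → I.1 ≤ k}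
  have hbdd : ∃ b : ℤ, ∀ k n, bad k n → b ≤ k := by
    obtain ⟨m, hm⟩ := pow_unbounded_of_one_lt ((∫ x, ‖f x‖) / A) (one_lt_two (α := ℝ))
    refine ⟨-m, fun k n hb => ?_⟩
    by_contra hlt
    have h1 : ∫ x in dyadic k n, ‖f x‖ ≤ ∫ x, ‖f x‖ :=
      setIntegral_le_integral hf.norm (Filter.Eventually.of_forall fun _ => norm_nonneg _)
    have h2 : (2 : ℝ) ^ m ≤ (2 : ℝ) ^ (-k) := by
      rw [← zpow_natCast]
      exact zpow_le_zpow_right₀ (by norm_num) (by omega)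
    rw [div_lt_iff₀ hA] at hm
    have h3 : A * (2 : ℝ) ^ (-k) < ∫ x in dyadic k n, ‖f x‖ := hb
    nlinarith
  have hcover : maximalSet f A ⊆ ⋃ I ∈ M, dyadic I.1 I.2 := by
    intro x hx
    simp only [maximalSet, Set.mem_iUnion] at hx
    obtain ⟨k, n, hb, hx⟩ := hx
    obtain ⟨b, hbd⟩ := hbdd
    obtain ⟨l, hl, hmin⟩ := Int.exists_least_of_bdd (P := fun k => bad k (cell k x))
      ⟨b, fun z hz => hbd _ _ hz⟩ ⟨k, by rw [mem_dyadic.1 hx]; exact hb⟩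
    refine Set.mem_iUnion₂.2 ⟨(l, cell l x), ⟨hl, fun k n hb' hsub => hmin k ?_⟩,
      mem_dyadic_cell l x⟩
    rw [mem_dyadic.1 (hsub (mem_dyadic_cell l x))]
    exact hb'
  have hdisj : M.PairwiseDisjoint fun I => dyadic I.1 I.2 := by
    have key : ∀ I ∈ M, ∀ J ∈ M, I.1 ≤ J.1 → ∀ x ∈ dyadic I.1 I.2, x ∈ dyadic J.1 J.2 → I = J := by
      intro I hI J hJ hk x h1 h2
      have := hJ.2 I.1 I.2 hI.1 (dyadic_subset hk h1 h2)
      have hk' := le_antisymm hk this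
      rw [hk'] at h1
      exact Prod.ext hk' (dyadic_index_eq h1 h2)
    intro I hI J hJ hne
    rw [Function.onFun, Set.disjoint_left]
    intro x h1 h2
    rcases le_total I.1 J.1 with h | h
    · exact hne (key I hI J hJ h x h1 h2)
    · exact hne (key J hJ I hI h x h2 h1).symm
  have hcount : M.Countable := Set.to_countable M
  calc volume (maximalSet f A) ≤ volume (⋃ I ∈ M, dyadic I.1 I.2) := measure_mono hcover
    _ ≤ ∑' I : M, volume (dyadic I.1.1 I.1.2) := measure_biUnion_le _ hcount _
    _ ≤ ∑' I : M, (ENNReal.ofReal A)⁻¹ * ∫⁻ x in dyadic I.1.1 I.1.2, ‖f x‖ₑ := by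
        refine ENNReal.tsum_le_tsum fun I => ?_
        have h : A * (2 : ℝ) ^ (-I.1.1) < ∫ x in dyadic I.1.1 I.1.2, ‖f x‖ := I.2.1
        rw [← ENNReal.div_eq_inv_mul, ENNReal.le_div_iff_mul_le
          (Or.inl (by simpa using hA)) (Or.inl ENNReal.ofReal_ne_top), volume_dyadic, mul_comm,
          ← ENNReal.ofReal_mul hA.le, ← ofReal_integral_norm_eq_lintegral_enorm hf.integrableOn]
        exact ENNReal.ofReal_le_ofReal h.le
    _ = (ENNReal.ofReal A)⁻¹ * ∫⁻ x in ⋃ I ∈ M, dyadic I.1 I.2, ‖f x‖ₑ := by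
        rw [ENNReal.tsum_mul_left, lintegral_biUnion hcount
          (fun I _ => measurableSet_dyadic _ _) hdisj]
    _ ≤ (ENNReal.ofReal A)⁻¹ * ∫⁻ x, ‖f x‖ₑ := by
        gcongr
        exact Measure.restrict_le_self
    _ = _ := by
        rw [← ofReal_integral_norm_eq_lintegral_enorm hf, ENNReal.ofReal_div_of_pos hA,
          ENNReal.div_eq_inv_mul]

theorem carlesonSum_filter_not_subset (c : Bitile → ℂ) (N : ℝ → ℝ) (T : Finset Bitile) (Ω : Set ℝ)
    [DecidablePred fun P : Bitile => ¬ P.time ⊆ Ω] {x : ℝ} (hx : x ∉ Ω) :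
    carlesonSum c N (T.filter fun P => ¬ P.time ⊆ Ω) x = carlesonSum c N T x := by
  classical
  rw [carlesonSum_eq, carlesonSum_eq, Finset.filter_filter]
  refine Finset.sum_congr (Finset.filter_congr fun P _ => ?_) fun _ _ => rfl
  constructor
  · exact fun h => h.2
  · exact fun h => ⟨fun hs => hx (hs h.1), h⟩

theorem finite_volume_carlesonSum_ne_zero (c : Bitile → ℂ) (N : ℝ → ℝ) (T : Finset Bitile) :
    volume {x | carlesonSum c N T x ≠ 0} ≠ ∞ := by
  refine ((measure_mono (t := ⋃ P ∈ T, P.time) ?_).trans_lt ?_).ne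
  · intro x hx
    obtain ⟨P, hP, hxP, -⟩ := carlesonSum_ne_zero hx
    exact Set.mem_iUnion₂.2 ⟨P, hP, hxP⟩
  · refine (measure_biUnion_finset_le _ _).trans_lt (ENNReal.sum_lt_top.2 fun P _ => ?_)
    exact (volume_dyadic_ne_top _ _).lt_top

/-- If `|C_T f| ≥ α` on `E` then the main estimate bounds `α`. -/
theorem exists_le_of_le_carlesonSum {θ : ℝ} (hθ0 : 0 < θ) (hθ1 : θ < 1) :
    ∃ C : ℝ, 0 < C ∧ ∀ (N : ℝ → ℝ), Measurable N → ∀ E : Set ℝ, MeasurableSet E →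
      volume E ≠ ∞ → 0 < volume.real E → ∀ (f : ℝ → ℂ), MemLp f 2 volume → ∀ φ : ℝ, 0 < φ →
      ∫ x, ‖f x‖ ^ 2 ≤ φ → ∀ (σ α : ℝ), 0 < σ → 0 ≤ α → ∀ T : Finset Bitile,
      HasSize (fun P => P.sub₁.coeff f) T σ →
      (∀ x ∈ E, α ≤ ‖carlesonSum (fun P => P.sub₁.coeff f) N T x‖) →
      α ≤ C * σ ^ (1 - θ) * (φ / volume.real E) ^ (θ / 2) := by
  obtain ⟨C, hC, hmain⟩ := exists_carlesonNorm_le hθ0 hθ1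
  refine ⟨C, hC, ?_⟩
  intro N hN E hE hEfin he f hf φ hφ hfφ σ α hσ hα T hsize hαle
  set e := volume.real E with he'
  have hρ : 0 < √(φ / e) := Real.sqrt_pos.2 (by positivity)
  have hbes : HasBessel (fun P => P.sub₁.coeff f) T (√(φ / e) ^ 2 * e) := by
    intro D _ hD
    rw [Real.sq_sqrt (by positivity), div_mul_cancel₀ _ he.ne']
    exact (sum_coeff_sq_le D Bitile.sub₁ hD hf).trans hfφ
  have h1 := hmain _ N hN E hE hEfin σ _ hσ hρ T hbes hsize
  have h2 : ENNReal.ofReal (α * e) ≤ carlesonNorm (fun P => P.sub₁.coeff f) N E T := by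
    rw [ENNReal.ofReal_mul hα, he', Measure.real, ENNReal.ofReal_toReal hEfin, carlesonNorm,
      ← setLIntegral_const]
    refine setLIntegral_mono' hE fun x hx => ?_
    rw [← ofReal_norm]
    exact ENNReal.ofReal_le_ofReal (hαle x hx)
  have h3 := h2.trans h1
  rw [ENNReal.ofReal_le_ofReal_iff (by positivity)] at h3
  have h4 : √(φ / e) ^ θ = (φ / e) ^ (θ / 2) := by
    rw [Real.sqrt_eq_rpow, ← Real.rpow_mul (by positivity)]
    congr 1; ring
  rw [h4] at h3
  refine le_of_mul_le_mul_right (h3.trans_eq ?_) he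
  ring

/-- The statement that the Walsh–Carleson sums are of restricted weak type `(q,q)`, with a constant
`C` that is uniform in all parameters. -/
def RestrictedWeakType (q C : ℝ) : Prop :=
  ∀ (N : ℝ → ℝ), Measurable N → ∀ F : Set ℝ, MeasurableSet F → volume F ≠ ∞ →
    ∀ f : ℝ → ℂ, Measurable f → (∀ x, ‖f x‖ ≤ F.indicator 1 x) → ∀ T : Finset Bitile, ∀ α : ℝ,
      0 < α → volume {x | α < ‖carlesonSum (fun P => P.sub₁.coeff f) N T x‖} ≤
        ENNReal.ofReal ((C / α) ^ q) * volume F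

/-- Reduction of the restricted weak type bound to the essential inequality
`α ≤ C (|F| / |G|)^{1/q}` for the level set `G`. -/
theorem restrictedWeakType_of_le {q C : ℝ} (hq : 1 < q) (hC : 0 < C)
    (h : ∀ (N : ℝ → ℝ), Measurable N → ∀ F : Set ℝ, MeasurableSet F → volume F ≠ ∞ →
      0 < volume.real F → ∀ f : ℝ → ℂ, Integrable f → MemLp f 2 volume →
      (∀ x, ‖f x‖ ≤ F.indicator 1 x) → ∫ x, ‖f x‖ ≤ volume.real F →
      ∫ x, ‖f x‖ ^ 2 ≤ volume.real F → ∀ T : Finset Bitile, ∀ α : ℝ, 0 < α →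
      ∀ G : Set ℝ, MeasurableSet G → volume G ≠ ∞ → 0 < volume.real G →
      (∀ x ∈ G, α ≤ ‖carlesonSum (fun P => P.sub₁.coeff f) N T x‖) →
      α ≤ C * (volume.real F / volume.real G) ^ (1 / q)) :
    RestrictedWeakType q C := by
  intro N hN F hF hFfin f hfm hfF T α hα
  set G := {x | α < ‖carlesonSum (fun P => P.sub₁.coeff f) N T x‖} with hG
  have hGm : MeasurableSet G :=
    measurableSet_lt measurable_const (measurable_carlesonSum _ hN T).norm
  have hGfin : volume G ≠ ∞ := by
    refine ((measure_mono fun x hx => ?_).trans_lt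
      (finite_volume_carlesonSum_ne_zero (fun P => P.sub₁.coeff f) N T).lt_top).ne
    intro h0
    have : α < ‖carlesonSum (fun P => P.sub₁.coeff f) N T x‖ := hx
    rw [h0, norm_zero] at this
    exact absurd this hα.not_gt
  have hind : Integrable (F.indicator (1 : ℝ → ℝ)) :=
    (integrable_indicator_iff hF).2 (integrableOn_const hFfin)
  have hindint : ∫ x, F.indicator (1 : ℝ → ℝ) x = volume.real F := integral_indicator_one hF
  have hfi : Integrable f := hind.mono' hfm.aestronglyMeasurable
    (Filter.Eventually.of_forall hfF)
  have hsq : ∀ x, ‖f x‖ ^ 2 ≤ F.indicator (1 : ℝ → ℝ) x := by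
    intro x
    have := hfF x
    by_cases hx : x ∈ F
    · rw [Set.indicator_of_mem hx] at this ⊢
      exact pow_le_one₀ (norm_nonneg _) this
    · rw [Set.indicator_of_notMem hx] at this ⊢
      rw [le_antisymm this (norm_nonneg _)]; norm_num
  have hf2i : Integrable fun x => ‖f x‖ ^ 2 := hind.mono'
    (hfm.norm.pow_const 2).aestronglyMeasurable (Filter.Eventually.of_forall fun x => by
      rw [Real.norm_of_nonneg (by positivity)]; exact hsq x)
  have hf2 : MemLp f 2 volume := (memLp_two_iff_integrable_sq_norm hfm.aestronglyMeasurable).2 hf2i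
  have h1 : ∫ x, ‖f x‖ ≤ volume.real F := by
    rw [← hindint]; exact integral_mono hfi.norm hind hfF
  have h2 : ∫ x, ‖f x‖ ^ 2 ≤ volume.real F := by
    rw [← hindint]; exact integral_mono hf2i hind hsq
  rcases (measureReal_nonneg (μ := volume) (s := G)).eq_or_lt with hg | hg
  · have : volume G = 0 := (measureReal_eq_zero_iff hGfin).1 hg.symm
    rw [this]; exact bot_le
  rcases (measureReal_nonneg (μ := volume) (s := F)).eq_or_lt with hφ | hφ
  · exfalso
    have h0 : ∫ x, ‖f x‖ = 0 := le_antisymm (hφ ▸ h1) (integral_nonneg fun _ => norm_nonneg _)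
    rw [integral_eq_zero_iff_of_nonneg (fun _ => norm_nonneg _) hfi.norm] at h0
    have hc : ∀ P : Bitile, P.sub₁.coeff f = 0 := by
      intro P
      refine integral_eq_zero_of_ae ?_
      filter_upwards [h0] with x hx
      have : f x = 0 := by simpa using hx
      simp [this]
    have : G = ∅ := by
      ext x
      simp [hG, carlesonSum, hc, hα.le]
    rw [this] at hg
    simp at hg
  have h3 := h N hN F hF hFfin hφ f hfi hf2 hfF h1 h2 T α hα G hGm hGfin hg fun x hx => le_of_lt hx
  have h4 : (α / C) ^ q ≤ volume.real F / volume.real G := by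
    have : α / C ≤ (volume.real F / volume.real G) ^ (1 / q) := by
      rw [div_le_iff₀ hC, mul_comm]; exact h3
    calc (α / C) ^ q ≤ ((volume.real F / volume.real G) ^ (1 / q)) ^ q :=
          Real.rpow_le_rpow (by positivity) this (by linarith)
      _ = _ := by
          rw [← Real.rpow_mul (by positivity), one_div, inv_mul_cancel₀ (by linarith),
            Real.rpow_one]
  have h5 : volume.real G ≤ (C / α) ^ q * volume.real F := by
    rw [le_div_iff₀ hg] at h4
    rw [← inv_div α C, Real.inv_rpow (by positivity), ← div_eq_inv_mul, le_div_iff₀ (by positivity)]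
    linarith
  rw [← ENNReal.ofReal_toReal hGfin, ← ENNReal.ofReal_toReal hFfin,
    ← ENNReal.ofReal_mul (by positivity)]
  exact ENNReal.ofReal_le_ofReal h5

theorem exists_restrictedWeakType_of_two_lt {q : ℝ} (hq : 2 < q) :
    ∃ C, 0 < C ∧ RestrictedWeakType q C := by
  have hθ1 : 2 / q < 1 := by rw [div_lt_one (by linarith)]; exact hq
  obtain ⟨C, hC, hmain⟩ := exists_le_of_le_carlesonSum (θ := 2 / q) (by positivity) hθ1
  refine ⟨C * 2 ^ (1 - 2 / q), by positivity,
    restrictedWeakType_of_le (by linarith) (by positivity) ?_⟩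
  intro N hN F hF hFfin hφ f hfi hf2 hfF h1 h2 T α hα G hG hGfin hg hαle
  have hsize : HasSize (fun P => P.sub₁.coeff f) T (2 * 1) := by
    refine hasSize_of_average hfi fun P _ k n _ => ?_
    rw [one_mul, ← measureReal_dyadic k n, ← mul_one (volume.real _), ← smul_eq_mul,
      ← setIntegral_const]
    refine setIntegral_mono_on hfi.norm.integrableOn
      (integrableOn_const (volume_dyadic_ne_top k n)) (measurableSet_dyadic k n) fun x _ => ?_
    exact (hfF x).trans (Set.indicator_le_self' (fun _ _ => zero_le_one) x)
  have := hmain N hN G hG hGfin hg f hf2 _ hφ h2 _ α (by norm_num) hα.le T hsize hαle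
  rw [mul_one, show 2 / q / 2 = 1 / q by ring] at this
  exact this

theorem exists_restrictedWeakType_of_lt_two {q : ℝ} (hq1 : 1 < q) (hq2 : q < 2) :
    ∃ C, 0 < C ∧ RestrictedWeakType q C := by
  have hq0 : 0 < q := by linarith
  set θ := 2 - 2 / q with hθ
  have hθ0 : 0 < θ := by
    have : 2 / q < 2 := by rw [div_lt_iff₀ hq0]; linarith
    linarith
  have hθ1 : θ < 1 := by
    have : 1 < 2 / q := by rw [lt_div_iff₀ hq0]; linarith
    linarith
  obtain ⟨C, hC, hmain⟩ := exists_le_of_le_carlesonSum hθ0 hθ1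
  refine ⟨C * 4 ^ (1 - θ) * 2 ^ (θ / 2), by positivity,
    restrictedWeakType_of_le hq1 (by positivity) ?_⟩
  intro N hN F hF hFfin hφ f hfi hf2 hfF h1 h2 T α hα G hG hGfin hg hαle
  classical
  set φ := volume.real F
  set g := volume.real G
  -- removing the set where the maximal function exceeds `A` costs at most half of `G`
  set A := 2 * φ / g with hA
  have hA0 : 0 < A := by positivity
  set Ω := maximalSet f A with hΩ
  have hΩm := measurableSet_maximalSet f A
  have hΩle : volume Ω ≤ ENNReal.ofReal (g / 2) := by
    refine (volume_maximalSet_le hfi hA0).trans (ENNReal.ofReal_le_ofReal ?_)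
    rw [div_le_iff₀ hA0, hA]
    have : g / 2 * (2 * φ / g) = φ := by field_simp
    rwa [this]
  have hΩfin : volume Ω ≠ ∞ := (hΩle.trans_lt ENNReal.ofReal_lt_top).ne
  have hΩr : volume.real Ω ≤ g / 2 := ENNReal.toReal_le_of_le_ofReal (by positivity) hΩle
  set E := G \ Ω with hE
  have hEm : MeasurableSet E := hG.diff hΩm
  have hEfin : volume E ≠ ∞ :=
    ((measure_mono Set.sdiff_subset).trans_lt hGfin.lt_top).ne
  have he : g / 2 ≤ volume.real E := by
    have := le_measureReal_sdiff (μ := volume) (s₁ := G) (s₂ := Ω) hΩfin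
    linarith
  have he0 : 0 < volume.real E := by linarith [half_pos hg]
  have hsize : HasSize (fun P => P.sub₁.coeff f) (T.filter fun P => ¬ P.time ⊆ Ω) (2 * A) := by
    refine hasSize_of_average hfi fun P hP k n hs => ?_
    by_contra hcon
    refine (Finset.mem_filter.1 hP).2 (hs.trans fun x hx => ?_)
    simp only [hΩ, maximalSet, Set.mem_iUnion]
    exact ⟨k, n, not_le.1 hcon, hx⟩
  have h3 := hmain N hN E hEm hEfin he0 f hf2 φ hφ h2 (2 * A) α (by positivity) hα.le _ hsize
    fun x hx => by
      rw [carlesonSum_filter_not_subset _ _ _ _ hx.2]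
      exact hαle x hx.1
  refine h3.trans ?_
  have e1 : 2 * A = 4 * (φ / g) := by rw [hA]; ring
  have e2 : φ / volume.real E ≤ 2 * (φ / g) := by
    rw [div_le_iff₀ he0]
    have : 2 * (φ / g) * (g / 2) = φ := by field_simp
    calc φ = 2 * (φ / g) * (g / 2) := this.symm
      _ ≤ _ := by gcongr
  have hx : 0 < φ / g := by positivity
  calc _ ≤ C * (2 * A) ^ (1 - θ) * (2 * (φ / g)) ^ (θ / 2) := by gcongr
    _ = C * 4 ^ (1 - θ) * 2 ^ (θ / 2) * ((φ / g) ^ (1 - θ) * (φ / g) ^ (θ / 2)) := by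
        rw [e1, Real.mul_rpow (by norm_num) hx.le, Real.mul_rpow (by norm_num) hx.le]; ring
    _ = _ := by
        rw [← Real.rpow_add hx]
        congr 2
        rw [hθ]; field_simp; ring

/-! ### Interpolation -/

theorem mul_rpow_two_zpow {p q K c ε : ℝ} (hK : 0 < K) (hc : 0 < c) (i : ℤ) (t : ℝ) (n : ℕ)
    (ht : -(i : ℝ) * p + (i + ε * n) * q = t * n) :
    2 ^ p * ((2 : ℝ) ^ i) ^ (-p) * (K * (2 : ℝ) ^ i / (c * ((2 : ℝ) ^ (-ε)) ^ n)) ^ q =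
      2 ^ p * (K / c) ^ q * ((2 : ℝ) ^ t) ^ n := by
  have h2 : (0 : ℝ) < 2 := two_pos
  have e1 : K * (2 : ℝ) ^ i / (c * ((2 : ℝ) ^ (-ε)) ^ n) = K / c * (2 : ℝ) ^ (i + ε * n) := by
    rw [← Real.rpow_natCast, ← Real.rpow_mul h2.le, Real.rpow_add h2, Real.rpow_intCast,
      show ε * n = -(-ε * n) by ring, Real.rpow_neg h2.le]
    field_simp
  rw [e1, Real.mul_rpow (by positivity) (by positivity), ← Real.rpow_mul h2.le,
    ← Real.rpow_intCast, ← Real.rpow_mul h2.le, ← Real.rpow_natCast, ← Real.rpow_mul h2.le, ← ht,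
    Real.rpow_add h2]
  rw [show (i : ℝ) * -p = -i * p by ring]
  ring

/-- Weights `w` on `ℤ` of total mass at most one that decay slowly enough for the weak type bounds
of exponents `q₀ < p < q₁` to be summed against them. -/
theorem exists_weights {p q₀ q₁ K : ℝ} (hq₀ : 0 < q₀) (h₀ : q₀ < p) (h₁ : p < q₁) (hK : 0 < K) :
    ∃ w : ℤ → ℝ, (∀ i, 0 < w i) ∧ ∑' i, ENNReal.ofReal (w i) ≤ 1 ∧
      Summable fun i : ℤ => 2 ^ p * ((2 : ℝ) ^ i) ^ (-p) *
        (K * (2 : ℝ) ^ i / w i) ^ (if 0 ≤ i then q₀ else q₁) := by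
  -- `w i` is a multiple of `2^{-ε|i|}`, with `ε` small compared with `p - q₀` and `q₁ - p`
  obtain ⟨ε, hε0, hε₀, hε₁⟩ : ∃ ε : ℝ, 0 < ε ∧ ε * q₀ < p - q₀ ∧ ε * q₁ < q₁ - p := by
    have hq₁ : 0 < q₁ := by linarith
    refine ⟨min ((p - q₀) / q₀) ((q₁ - p) / q₁) / 2, ?_, ?_, ?_⟩
    · exact half_pos (lt_min (div_pos (by linarith) hq₀) (div_pos (by linarith) hq₁))
    · have h := min_le_left ((p - q₀) / q₀) ((q₁ - p) / q₁)
      rw [le_div_iff₀ hq₀] at h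
      linarith
    · have h := min_le_right ((p - q₀) / q₀) ((q₁ - p) / q₁)
      rw [le_div_iff₀ hq₁] at h
      linarith
  have hu1 : (2 : ℝ) ^ (-ε) < 1 := Real.rpow_lt_one_of_one_lt_of_neg (by norm_num) (by linarith)
  have hu0 : (0 : ℝ) < (2 : ℝ) ^ (-ε) := by positivity
  have hsum := summable_pow_natAbs hu0.le hu1
  have hS : 0 < ∑' z : ℤ, ((2 : ℝ) ^ (-ε)) ^ z.natAbs :=
    hsum.tsum_pos (fun _ => by positivity) 0 (by simp)
  set c := (∑' z : ℤ, ((2 : ℝ) ^ (-ε)) ^ z.natAbs)⁻¹ with hc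
  have hc0 : 0 < c := inv_pos.2 hS
  refine ⟨fun i => c * ((2 : ℝ) ^ (-ε)) ^ i.natAbs, fun i => by positivity, ?_, ?_⟩
  · rw [← ENNReal.ofReal_tsum_of_nonneg (fun _ => by positivity) (hsum.mul_left c), tsum_mul_left,
      hc, inv_mul_cancel₀ hS.ne', ENNReal.ofReal_one]
  · refine Summable.of_nat_of_neg_add_one ?_ ?_
    · have e : ∀ n : ℕ, 2 ^ p * ((2 : ℝ) ^ (n : ℤ)) ^ (-p) * (K * (2 : ℝ) ^ (n : ℤ) /
          (c * ((2 : ℝ) ^ (-ε)) ^ (n : ℤ).natAbs)) ^ (if 0 ≤ (n : ℤ) then q₀ else q₁) =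
          2 ^ p * (K / c) ^ q₀ * ((2 : ℝ) ^ (-p + q₀ + ε * q₀)) ^ n := by
        intro n
        rw [if_pos (by positivity), Int.natAbs_natCast]
        exact mul_rpow_two_zpow hK hc0 _ _ _ (by push_cast; ring)
      simp_rw [e]
      exact (summable_geometric_of_lt_one (by positivity)
        (Real.rpow_lt_one_of_one_lt_of_neg (by norm_num) (by linarith))).mul_left _
    · have e : ∀ n : ℕ, 2 ^ p * ((2 : ℝ) ^ (-((n : ℤ) + 1))) ^ (-p) *
          (K * (2 : ℝ) ^ (-((n : ℤ) + 1)) / (c * ((2 : ℝ) ^ (-ε)) ^ (-((n : ℤ) + 1)).natAbs)) ^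
            (if 0 ≤ -((n : ℤ) + 1) then q₀ else q₁) =
          2 ^ p * (K / c) ^ q₁ * ((2 : ℝ) ^ (p - q₁ + ε * q₁)) ^ (n + 1) := by
        intro n
        rw [if_neg (by omega), show (-((n : ℤ) + 1)).natAbs = n + 1 by omega]
        exact mul_rpow_two_zpow hK hc0 _ _ _ (by push_cast; ring)
      simp_rw [e]
      exact ((summable_nat_add_iff 1).2 (summable_geometric_of_lt_one (by positivity)
        (Real.rpow_lt_one_of_one_lt_of_neg (by norm_num) (by linarith)))).mul_left _

/-- Interpolation between restricted weak type bounds: if `g` is dominated by a sum of functions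
`g_j`, each of which obeys the weak type bounds of exponents `q₀` and `q₁` that correspond to a
function of height `2^j` on a set of measure `v_j`, then the `L^p` norm of `g` is controlled for
`q₀ < p < q₁`. -/
theorem exists_lintegral_rpow_le {p q₀ q₁ K : ℝ} (hq₀ : 0 < q₀) (h₀ : q₀ < p) (h₁ : p < q₁)
    (hK : 0 < K) : ∃ D : ℝ≥0, ∀ {X : Type} [MeasurableSpace X] (μ : Measure X) (g : X → ℝ≥0∞)
      (gj : ℤ → X → ℝ≥0∞) (v : ℤ → ℝ≥0∞), Measurable g → (∀ x, g x ≠ ∞) →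
      (∀ x, g x ≤ ∑' j, gj j x) →
      (∀ j, ∀ α : ℝ, 0 < α →
        μ {x | ENNReal.ofReal α < gj j x} ≤ ENNReal.ofReal ((K * (2 : ℝ) ^ j / α) ^ q₀) * v j) →
      (∀ j, ∀ α : ℝ, 0 < α →
        μ {x | ENNReal.ofReal α < gj j x} ≤ ENNReal.ofReal ((K * (2 : ℝ) ^ j / α) ^ q₁) * v j) →
      ∫⁻ x, g x ^ p ∂μ ≤ D * ∑' j : ℤ, ENNReal.ofReal (((2 : ℝ) ^ j) ^ p) * v j := by
  obtain ⟨w, hw0, hw1, hsum⟩ := exists_weights hq₀ h₀ h₁ hK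
  set a : ℤ → ℝ := fun i => 2 ^ p * ((2 : ℝ) ^ i) ^ (-p) *
        (K * (2 : ℝ) ^ i / w i) ^ (if 0 ≤ i then q₀ else q₁) with ha
  have ha0 : ∀ i, 0 ≤ a i := fun i => by have := hw0 i; simp only [ha]; positivity
  refine ⟨Real.toNNReal (∑' i, a i), ?_⟩
  intro X _ μ g gj v hg hgfin hle hv₀ hv₁
  have hp : 0 < p := hq₀.trans h₀
  have hcast : ∀ m : ℤ, (2 : ℝ≥0∞) ^ m = ENNReal.ofReal ((2 : ℝ) ^ m) := by
    intro m
    rw [← Real.rpow_intCast, ← ENNReal.ofReal_rpow_of_pos two_pos, ENNReal.rpow_intCast]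
    simp
  -- the superlevel sets of `g` at dyadic heights control its `L^p` norm
  have hpt : ∀ x, g x ^ p ≤ ∑' m : ℤ, {x | ENNReal.ofReal ((2 : ℝ) ^ m) < g x}.indicator
      (fun _ => ENNReal.ofReal (((2 : ℝ) ^ (m + 1)) ^ p)) x := by
    intro x
    by_cases hx : g x = 0
    · rw [hx, ENNReal.zero_rpow_of_pos hp]; exact bot_le
    · obtain ⟨m, hm1, hm2⟩ := ENNReal.exists_mem_Ioc_zpow hx (hgfin x) ENNReal.one_lt_two
        ENNReal.ofNat_ne_top
      rw [hcast] at hm1 hm2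
      refine le_trans ?_ (ENNReal.le_tsum m)
      rw [Set.indicator_of_mem (by exact hm1), ← ENNReal.ofReal_rpow_of_pos (by positivity)]
      exact ENNReal.rpow_le_rpow hm2 hp.le
  -- the weights distribute a superlevel set of `g` among those of the `g_j`
  have hlevel : ∀ m : ℤ, μ {x | ENNReal.ofReal ((2 : ℝ) ^ m) < g x} ≤
      ∑' j : ℤ, μ {x | ENNReal.ofReal (w (j - m) * (2 : ℝ) ^ m) < gj j x} := by
    intro m
    refine (measure_mono fun x hx => ?_).trans (measure_iUnion_le _)
    by_contra hcon
    simp only [Set.mem_iUnion, Set.mem_ofPred_eq, not_exists, not_lt] at hcon hx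
    have h1 : g x ≤ ENNReal.ofReal ((2 : ℝ) ^ m) := by
      calc g x ≤ ∑' j, gj j x := hle x
        _ ≤ ∑' j : ℤ, ENNReal.ofReal (w (j - m)) * ENNReal.ofReal ((2 : ℝ) ^ m) := by
            refine ENNReal.tsum_le_tsum fun j => ?_
            rw [← ENNReal.ofReal_mul (hw0 _).le]
            exact hcon j
        _ = (∑' j : ℤ, ENNReal.ofReal (w j)) * ENNReal.ofReal ((2 : ℝ) ^ m) := by
            rw [ENNReal.tsum_mul_right]
            congr 1
            exact (Equiv.subRight m).tsum_eq fun j => ENNReal.ofReal (w j)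
        _ ≤ _ := by
            refine (mul_le_mul_left hw1 _).trans_eq (one_mul _)
    exact absurd hx (not_lt.2 h1)
  have hterm : ∀ m j : ℤ, ENNReal.ofReal (((2 : ℝ) ^ (m + 1)) ^ p) *
      μ {x | ENNReal.ofReal (w (j - m) * (2 : ℝ) ^ m) < gj j x} ≤
      ENNReal.ofReal (a (j - m)) * (ENNReal.ofReal (((2 : ℝ) ^ j) ^ p) * v j) := by
    intro m j
    have hw := hw0 (j - m)
    have hpos : 0 < w (j - m) * (2 : ℝ) ^ m := by positivity
    have hv : μ {x | ENNReal.ofReal (w (j - m) * (2 : ℝ) ^ m) < gj j x} ≤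
        ENNReal.ofReal ((K * (2 : ℝ) ^ j / (w (j - m) * (2 : ℝ) ^ m)) ^
          (if 0 ≤ j - m then q₀ else q₁)) * v j := by
      split_ifs
      · exact hv₀ j _ hpos
      · exact hv₁ j _ hpos
    refine (mul_le_mul_right hv _).trans_eq ?_
    rw [← mul_assoc, ← mul_assoc, ← ENNReal.ofReal_mul (by positivity),
      ← ENNReal.ofReal_mul (ha0 _)]
    congr 2
    simp only [ha]
    have e1 : K * (2 : ℝ) ^ j / (w (j - m) * (2 : ℝ) ^ m) = K * (2 : ℝ) ^ (j - m) / w (j - m) := by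
      rw [zpow_sub₀ two_ne_zero]; field_simp
    have e2 : ((2 : ℝ) ^ (m + 1)) ^ p = 2 ^ p * ((2 : ℝ) ^ (j - m)) ^ (-p) * ((2 : ℝ) ^ j) ^ p := by
      rw [Real.rpow_neg (by positivity), ← Real.inv_rpow (by positivity),
        ← Real.mul_rpow (by norm_num) (by positivity),
        ← Real.mul_rpow (by positivity) (by positivity)]
      congr 1
      rw [zpow_sub₀ two_ne_zero, zpow_add_one₀ two_ne_zero]
      field_simp
    rw [e1, e2]
    ring
  calc ∫⁻ x, g x ^ p ∂μ ≤ ∫⁻ x, ∑' m : ℤ, {x | ENNReal.ofReal ((2 : ℝ) ^ m) < g x}.indicator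
        (fun _ => ENNReal.ofReal (((2 : ℝ) ^ (m + 1)) ^ p)) x ∂μ := lintegral_mono hpt
    _ = ∑' m : ℤ, ENNReal.ofReal (((2 : ℝ) ^ (m + 1)) ^ p) *
          μ {x | ENNReal.ofReal ((2 : ℝ) ^ m) < g x} := by
        have hms : ∀ m : ℤ, MeasurableSet {x | ENNReal.ofReal ((2 : ℝ) ^ m) < g x} :=
          fun m => measurableSet_lt measurable_const hg
        rw [lintegral_tsum fun m => (measurable_const.indicator (hms m)).aemeasurable]
        exact tsum_congr fun m => lintegral_indicator_const (hms m) _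
    _ ≤ ∑' m : ℤ, ∑' j : ℤ,
          ENNReal.ofReal (a (j - m)) * (ENNReal.ofReal (((2 : ℝ) ^ j) ^ p) * v j) := by
        refine ENNReal.tsum_le_tsum fun m => ?_
        refine (mul_le_mul_right (hlevel m) _).trans ?_
        rw [← ENNReal.tsum_mul_left]
        exact ENNReal.tsum_le_tsum fun j => hterm m j
    _ = ∑' j : ℤ, (∑' i : ℤ, ENNReal.ofReal (a i)) *
          (ENNReal.ofReal (((2 : ℝ) ^ j) ^ p) * v j) := by
        rw [ENNReal.tsum_comm]
        refine tsum_congr fun j => ?_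
        rw [ENNReal.tsum_mul_right]
        congr 1
        exact (Equiv.subLeft j).tsum_eq fun i => ENNReal.ofReal (a i)
    _ = _ := by
        rw [ENNReal.tsum_mul_left, ← ENNReal.ofReal_tsum_of_nonneg ha0 hsum]
        rfl

/-! ### Strong type bounds for finite collections -/

theorem integrableOn_dyadic_of_memLp {p : ℝ≥0∞} (hp : 1 ≤ p) {f : ℝ → ℂ} (hf : MemLp f p volume)
    (k n : ℤ) : IntegrableOn f (dyadic k n) := by
  have : IsFiniteMeasure (volume.restrict (dyadic k n)) :=
    isFiniteMeasure_restrict.2 (volume_dyadic_ne_top k n)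
  exact (hf.restrict _).integrable hp

/-- The set where `|f|` lies in `[2^j, 2^{j+1})`. -/
def levelSet (f : ℝ → ℂ) (j : ℤ) : Set ℝ := {x | ‖f x‖ ∈ Set.Ico ((2 : ℝ) ^ j) ((2 : ℝ) ^ (j + 1))}

theorem measurableSet_levelSet {f : ℝ → ℂ} (hf : Measurable f) (j : ℤ) :
    MeasurableSet (levelSet f j) := hf.norm measurableSet_Ico

theorem pairwise_disjoint_levelSet (f : ℝ → ℂ) :
    Pairwise (Function.onFun Disjoint (levelSet f)) := by
  intro i j hij
  rw [Function.onFun, Set.disjoint_left]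
  rintro x ⟨h1, h2⟩ ⟨h3, h4⟩
  have h5 := (zpow_lt_zpow_iff_right₀ (one_lt_two (α := ℝ))).1 (h1.trans_lt h4)
  have h6 := (zpow_lt_zpow_iff_right₀ (one_lt_two (α := ℝ))).1 (h3.trans_lt h2)
  omega

theorem mem_iUnion_levelSet {f : ℝ → ℂ} {x : ℝ} (hx : f x ≠ 0) : x ∈ ⋃ j, levelSet f j := by
  obtain ⟨j, hj⟩ := exists_mem_Ico_zpow (norm_pos_iff.2 hx) (one_lt_two (α := ℝ))
  exact Set.mem_iUnion.2 ⟨j, hj⟩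

theorem hasSum_coeff_levelSet {p : ℝ≥0∞} (hp : 1 ≤ p) {f : ℝ → ℂ} (hfm : Measurable f)
    (hf : MemLp f p volume) (P : Tile) :
    HasSum (fun j : ℤ => P.coeff ((levelSet f j).indicator f)) (P.coeff f) := by
  have h := hasSum_integral_iUnion (measurableSet_levelSet hfm) (pairwise_disjoint_levelSet f)
    (P.integrable_mul (integrableOn_dyadic_of_memLp hp hf P.k P.n)).integrableOn
  rw [setIntegral_eq_integral_of_forall_compl_eq_zero fun x hx => by
    have : f x = 0 := by by_contra h0; exact hx (mem_iUnion_levelSet h0)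
    rw [this, zero_mul]] at h
  have e : ∀ j, P.coeff ((levelSet f j).indicator f) =
      ∫ x in levelSet f j, f x * (P.wavePacket x : ℂ) := by
    intro j
    rw [← integral_indicator (measurableSet_levelSet hfm j), Tile.coeff]
    congr 1
    funext x
    by_cases hx : x ∈ levelSet f j <;> simp [hx]
  simp_rw [e]
  exact h

/-- The level sets of `f` sum up to its `L^p` norm. -/
theorem tsum_levelSet_le {p : ℝ} (hp : 0 < p) {f : ℝ → ℂ} (hfm : Measurable f) :
    ∑' j : ℤ, ENNReal.ofReal (((2 : ℝ) ^ j) ^ p) * volume (levelSet f j) ≤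
      ∫⁻ x, ‖f x‖ₑ ^ p := by
  calc _ ≤ ∑' j : ℤ, ∫⁻ x in levelSet f j, ‖f x‖ₑ ^ p := by
        refine ENNReal.tsum_le_tsum fun j => ?_
        rw [← setLIntegral_const]
        refine setLIntegral_mono' (measurableSet_levelSet hfm j) fun x hx => ?_
        rw [← ENNReal.ofReal_rpow_of_pos (by positivity), ← ofReal_norm]
        exact ENNReal.rpow_le_rpow (ENNReal.ofReal_le_ofReal hx.1) hp.le
    _ = ∫⁻ x in ⋃ j, levelSet f j, ‖f x‖ₑ ^ p :=
        (lintegral_iUnion (measurableSet_levelSet hfm) (pairwise_disjoint_levelSet f) _).symm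
    _ ≤ _ := lintegral_mono' Measure.restrict_le_self le_rfl

/-- The restricted weak type bound for functions of height `M` on a set `F`. -/
theorem RestrictedWeakType.scaled {q C C' : ℝ} (h : RestrictedWeakType q C) (hC : 0 < C)
    (hCC' : C ≤ C') (hq : 0 < q) {N : ℝ → ℝ} (hN : Measurable N) {F : Set ℝ} (hF : MeasurableSet F)
    (hFfin : volume F ≠ ∞) {f : ℝ → ℂ} (hf : Measurable f) {M : ℝ} (hM : 0 < M)
    (hfF : ∀ x ∈ F, ‖f x‖ ≤ M) (T : Finset Bitile) {α : ℝ} (hα : 0 < α) :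
    volume {x | ENNReal.ofReal α < ‖carlesonSum (fun P => P.sub₁.coeff (F.indicator f)) N T x‖ₑ} ≤
      ENNReal.ofReal ((C' * M / α) ^ q) * volume F := by
  have hc : ∀ P : Bitile, P.sub₁.coeff (F.indicator f) =
      M * P.sub₁.coeff (fun x => (M : ℂ)⁻¹ * F.indicator f x) := by
    intro P
    rw [Tile.coeff, Tile.coeff, ← integral_const_mul]
    congr 1
    funext x
    have : (M : ℂ) ≠ 0 := by exact_mod_cast hM.ne'
    field_simp
  have hS : ∀ x, carlesonSum (fun P => P.sub₁.coeff (F.indicator f)) N T x =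
      M * carlesonSum (fun P => P.sub₁.coeff (fun x => (M : ℂ)⁻¹ * F.indicator f x)) N T x := by
    intro x
    simp only [carlesonSum, Finset.mul_sum]
    refine Finset.sum_congr rfl fun P _ => ?_
    by_cases hx : x ∈ {x | N x ∈ P.sub₂.freq}
    · rw [Set.indicator_of_mem hx, Set.indicator_of_mem hx, hc, mul_assoc]
    · rw [Set.indicator_of_notMem hx, Set.indicator_of_notMem hx, mul_zero]
  have := h N hN F hF hFfin (fun x => (M : ℂ)⁻¹ * F.indicator f x)
    ((hf.indicator hF).const_mul _) (fun x => by
      by_cases hx : x ∈ F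
      · rw [Set.indicator_of_mem hx, Set.indicator_of_mem hx, norm_mul, norm_inv, Complex.norm_real,
          Real.norm_of_nonneg hM.le, Pi.one_apply, inv_mul_le_iff₀ hM, mul_one]
        exact hfF x hx
      · simp [hx]) T (α / M) (by positivity)
  refine le_trans (measure_mono fun x hx => ?_) (this.trans ?_)
  · simp only [Set.mem_ofPred_eq] at hx ⊢
    rw [hS, ← ofReal_norm, norm_mul, Complex.norm_real, Real.norm_of_nonneg hM.le,
      ENNReal.ofReal_lt_ofReal_iff_of_nonneg hα.le] at hx
    rw [div_lt_iff₀ hM]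
    linarith
  · gcongr ENNReal.ofReal (?_ ^ q) * _
    rw [div_div_eq_mul_div]
    gcongr

/-- The Walsh–Carleson theorem for finite collections of bitiles. -/
theorem exists_eLpNorm_carlesonSum_le {p : ℝ≥0∞} (hp_one : 1 < p) (hp_top : p < ∞) :
    ∃ C : ℝ≥0, ∀ (N : ℝ → ℝ), Measurable N → ∀ f : ℝ → ℂ, MemLp f p volume → ∀ T : Finset Bitile,
      eLpNorm (carlesonSum (fun P => P.sub₁.coeff f) N T) p volume ≤ C * eLpNorm f p volume := by
  have hp0 : p ≠ 0 := (zero_lt_one.trans hp_one).ne'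
  set r := p.toReal with hr
  have hr1 : 1 < r := by
    have := (ENNReal.toReal_lt_toReal ENNReal.one_ne_top hp_top.ne).2 hp_one
    simpa using this
  have hr0 : 0 < r := by linarith
  obtain ⟨q₀, hq₀1, hq₀2, hq₀r⟩ : ∃ q₀ : ℝ, 1 < q₀ ∧ q₀ < 2 ∧ q₀ < r := by
    obtain ⟨q, h1, h2⟩ := exists_between (lt_min one_lt_two hr1)
    exact ⟨q, h1, h2.trans_le (min_le_left _ _), h2.trans_le (min_le_right _ _)⟩
  obtain ⟨q₁, hq₁2, hq₁r⟩ : ∃ q₁ : ℝ, 2 < q₁ ∧ r < q₁ := by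
    obtain ⟨q, hq⟩ := exists_gt (max 2 r)
    exact ⟨q, (le_max_left _ _).trans_lt hq, (le_max_right _ _).trans_lt hq⟩
  obtain ⟨C₀, hC₀, h₀⟩ := exists_restrictedWeakType_of_lt_two hq₀1 hq₀2
  obtain ⟨C₁, hC₁, h₁⟩ := exists_restrictedWeakType_of_two_lt hq₁2
  set K := max C₀ C₁ with hK
  have hK0 : 0 < K := lt_max_of_lt_left hC₀
  obtain ⟨D, hD⟩ := exists_lintegral_rpow_le (K := K * 2) (by linarith) hq₀r hq₁r (by positivity)
  refine ⟨D ^ (1 / r), ?_⟩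
  intro N hN f hf T
  -- pass to a measurable representative
  wlog hfm : Measurable f generalizing f with hwlog
  · have hmk := hf.1.ae_eq_mk
    have h := hwlog (hf.1.mk f) (hf.ae_eq hmk) hf.1.stronglyMeasurable_mk.measurable
    have hc : ∀ P : Bitile, P.sub₁.coeff f = P.sub₁.coeff (hf.1.mk f) := by
      intro P
      refine integral_congr_ae ?_
      filter_upwards [hmk] with x hx
      rw [hx]
    simp_rw [hc]
    exact h.trans_eq (by rw [← eLpNorm_congr_ae hmk])
  have hlint : ∫⁻ x, ‖f x‖ₑ ^ r < ∞ :=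
    (eLpNorm_lt_top_iff_lintegral_rpow_enorm_lt_top hp0 hp_top.ne).1 hf.2
  have hlev := tsum_levelSet_le hr0 hfm
  have hfin : ∀ j, volume (levelSet f j) ≠ ∞ := by
    intro j htop
    have h := (ENNReal.le_tsum j).trans (hlev.trans hlint.le)
    have h' := ((ENNReal.le_tsum j).trans hlev).trans_lt hlint
    rw [htop, ENNReal.mul_top] at h'
    · exact lt_irrefl _ h'
    · have : 0 < ((2 : ℝ) ^ j) ^ r := by positivity
      simpa using this
  have hmain := hD volume (fun x => ‖carlesonSum (fun P => P.sub₁.coeff f) N T x‖ₑ)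
    (fun j x => ‖carlesonSum (fun P => P.sub₁.coeff ((levelSet f j).indicator f)) N T x‖ₑ)
    (fun j => volume (levelSet f j)) (measurable_carlesonSum _ hN T).enorm
    (fun x => enorm_ne_top) (fun x => ?_) (fun j α hα => ?_) (fun j α hα => ?_)
  · rw [eLpNorm_eq_lintegral_rpow_enorm_toReal hp0 hp_top.ne,
      eLpNorm_eq_lintegral_rpow_enorm_toReal hp0 hp_top.ne, ← hr]
    calc _ ≤ ((D : ℝ≥0∞) * ∫⁻ x, ‖f x‖ₑ ^ r) ^ (1 / r) := by
          gcongr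
          exact hmain.trans (mul_le_mul_right hlev _)
      _ = _ := by
          rw [ENNReal.mul_rpow_of_nonneg _ _ (by positivity),
            ENNReal.coe_rpow_of_nonneg _ (by positivity)]
  · have hs : HasSum (fun j : ℤ => carlesonSum
        (fun P => P.sub₁.coeff ((levelSet f j).indicator f)) N T x)
        (carlesonSum (fun P => P.sub₁.coeff f) N T x) := by
      refine hasSum_sum fun P _ => ?_
      by_cases hx : x ∈ {x | N x ∈ P.sub₂.freq}
      · simp only [Set.indicator_of_mem hx]
        exact (hasSum_coeff_levelSet hp_one.le hfm hf P.sub₁).mul_right _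
      · simp only [Set.indicator_of_notMem hx]
        exact hasSum_zero
    rw [← hs.tsum_eq]
    exact enorm_tsum_le_tsum_enorm
  · rw [mul_assoc, mul_comm 2, ← zpow_add_one₀ two_ne_zero]
    exact h₀.scaled hC₀ (le_max_left _ _) (by linarith) hN (measurableSet_levelSet hfm j) (hfin j)
      hfm (by positivity) (fun x hx => hx.2.le) T hα
  · rw [mul_assoc, mul_comm 2, ← zpow_add_one₀ two_ne_zero]
    exact h₁.scaled hC₁ (le_max_right _ _) (by linarith) hN (measurableSet_levelSet hfm j) (hfin j)
      hfm (by positivity) (fun x hx => hx.2.le) T hα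

/-! ### Infinite collections -/

/-- By Hölder's inequality a term of the series is at most `‖f‖_p |I_P|^{-1/p}`. -/
theorem norm_walshCarlesonTerm_le {p : ℝ≥0∞} (hp_one : 1 ≤ p) {f : ℝ → ℂ} (hf : MemLp f p volume)
    (N : ℝ → ℝ) (P : Bitile) (x : ℝ) :
    ‖walshCarlesonTerm N f P x‖ ≤
      (eLpNorm f p volume).toReal * ((2 : ℝ) ^ (1 / p.toReal)) ^ P.k := by
  have hI : ∫ y in dyadic P.k P.n, ‖f y‖ ≤ (eLpNorm f p volume).toReal *
      ((2 : ℝ) ^ (-P.k)) ^ (1 - 1 / p.toReal) := by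
    have hint := integrableOn_dyadic_of_memLp hp_one hf P.k P.n
    have h1 := eLpNorm_le_eLpNorm_mul_rpow_measure_univ (μ := volume.restrict (dyadic P.k P.n))
      hp_one hf.1.restrict
    have h2 : eLpNorm f 1 (volume.restrict (dyadic P.k P.n)) ≤ eLpNorm f p volume *
        ENNReal.ofReal (((2 : ℝ) ^ (-P.k)) ^ (1 - 1 / p.toReal)) := by
      refine h1.trans ?_
      rw [Measure.restrict_apply_univ, volume_dyadic, ENNReal.ofReal_rpow_of_pos (by positivity)]
      simp only [ENNReal.toReal_one, div_one]
      gcongr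
      exact Measure.restrict_le_self
    rw [integral_norm_eq_lintegral_enorm hint.aestronglyMeasurable,
      ← eLpNorm_one_eq_lintegral_enorm]
    have h3 := ENNReal.toReal_mono (ENNReal.mul_ne_top hf.2.ne ENNReal.ofReal_ne_top) h2
    rwa [ENNReal.toReal_mul, ENNReal.toReal_ofReal (by positivity)] at h3
  have hc : ‖P.sub₁.coeff f‖ ≤ (2 : ℝ) ^ ((P.k : ℝ) / 2) * ∫ y in dyadic P.k P.n, ‖f y‖ :=
    P.sub₁.norm_coeff_le (integrableOn_dyadic_of_memLp hp_one hf P.k P.n)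
  have hx : ‖walshCarlesonTerm N f P x‖ ≤ ‖P.sub₁.coeff f‖ * (2 : ℝ) ^ ((P.k : ℝ) / 2) := by
    refine (norm_indicator_le_norm_self _ _).trans ?_
    rw [norm_mul, Complex.norm_real, Real.norm_eq_abs]
    gcongr
    exact P.sub₁.abs_wavePacket_le x
  refine hx.trans ?_
  calc _ ≤ (2 : ℝ) ^ ((P.k : ℝ) / 2) * ((eLpNorm f p volume).toReal *
        ((2 : ℝ) ^ (-P.k)) ^ (1 - 1 / p.toReal)) * (2 : ℝ) ^ ((P.k : ℝ) / 2) := by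
        gcongr
        exact hc.trans (by gcongr)
    _ = (eLpNorm f p volume).toReal *
        (((2 : ℝ) ^ ((P.k : ℝ) / 2)) ^ 2 * ((2 : ℝ) ^ (-P.k)) ^ (1 - 1 / p.toReal)) := by ring
    _ = _ := by
        congr 1
        rw [rpow_half_sq, ← Real.rpow_intCast, ← Real.rpow_intCast, ← Real.rpow_mul (by norm_num),
          ← Real.rpow_add (by norm_num), ← Real.rpow_intCast, ← Real.rpow_mul (by norm_num)]
        congr 1
        push_cast; ring

/-- At each point the series has at most one nonzero term per scale, none at the small scales, and
its terms decay geometrically towards the large scales. -/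
theorem summable_walshCarlesonTerm {p : ℝ≥0∞} (hp_one : 1 < p) (hp_top : p < ∞) (𝓟 : Set Bitile)
    (N : ℝ → ℝ) {f : ℝ → ℂ} (hf : MemLp f p volume) (x : ℝ) :
    Summable fun P : 𝓟 => walshCarlesonTerm N f P x := by
  have hmem : ∀ P : Bitile, walshCarlesonTerm N f P x ≠ 0 → x ∈ P.time ∧ N x ∈ P.sub₂.freq := by
    intro P h
    constructor
    · by_contra hx
      have : P.sub₁.wavePacket x = 0 := P.sub₁.wavePacket_eq_zero hx
      exact h (by simp [walshCarlesonTerm, this])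
    · by_contra hx
      exact h (by simp [walshCarlesonTerm, hx])
  obtain ⟨K, hK⟩ := pow_unbounded_of_one_lt (N x) (one_lt_two (α := ℝ))
  have hscale : ∀ P : Bitile, walshCarlesonTerm N f P x ≠ 0 → P.k ≤ K := by
    intro P h
    have h1 := (hmem P h).2.1
    simp only [Bitile.sub₂] at h1
    push_cast at h1
    have h2 : (2 : ℝ) ^ P.k < (2 : ℝ) ^ (K : ℤ) := by
      rw [zpow_natCast]
      have : (0 : ℝ) < (2 : ℝ) ^ P.k := by positivity
      have : (0 : ℝ) ≤ P.l := by positivity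
      nlinarith
    exact ((zpow_lt_zpow_iff_right₀ one_lt_two).1 h2).le
  set b := (2 : ℝ) ^ (1 / p.toReal) with hb
  have hr : 0 < p.toReal := ENNReal.toReal_pos (zero_lt_one.trans hp_one).ne' hp_top.ne
  have hb1 : 1 < b := Real.one_lt_rpow one_lt_two (by positivity)
  have hb0 : 0 < b := by linarith
  have hsum : Summable fun k : ℤ => (eLpNorm f p volume).toReal * b ^ (K : ℤ) *
      b⁻¹ ^ (k - K).natAbs :=
    (((Equiv.subRight (K : ℤ)).summable_iff (f := fun z : ℤ => b⁻¹ ^ z.natAbs)).2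
      (summable_pow_natAbs (by positivity) (inv_lt_one_of_one_lt₀ hb1))).mul_left _
  set F : 𝓟 → ℂ := fun P => walshCarlesonTerm N f P x
  suffices Summable (F ∘ ((↑) : Function.support F → 𝓟)) by
    obtain ⟨a, ha⟩ := this
    exact ⟨a, hasSum_subtype_support.1 ha⟩
  have hinj : Function.Injective fun P : Function.support F => (P : 𝓟).1.k := by
    intro P Q h
    have h1 := hmem _ P.2
    have h2 := hmem _ Q.2
    exact Subtype.ext (Subtype.ext (Bitile.ext_of_mem h h1.1 h2.1
      (Bitile.sub₂_freq_subset _ h1.2) (Bitile.sub₂_freq_subset _ h2.2)))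
  refine Summable.of_norm_bounded (hsum.comp_injective hinj) fun P => ?_
  have hk := hscale _ P.2
  refine (norm_walshCarlesonTerm_le hp_one.le hf N P.1.1 x).trans_eq ?_
  rw [Function.comp_apply, mul_assoc]
  congr 1
  rw [inv_pow, ← zpow_natCast, ← zpow_neg, ← zpow_add₀ hb0.ne']
  congr 1
  omega

instance : Countable Bitile :=
  Function.Injective.countable (f := fun P : Bitile => (P.k, P.n, P.l)) fun P Q h => by
    simp only [Prod.mk.injEq] at h
    exact Bitile.ext h.1 h.2.1 h.2.2

end

theorem theorem1p7 (p : ℝ≥0∞) (hp_one : 1 < p) (hp_top : p < ∞) :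
    ∃ C : ℝ≥0, ∀ (𝓟 : Set Bitile) (N : ℝ → ℝ), AEMeasurable N volume →
      ∀ f : ℝ → ℂ, MemLp f p volume →
        (∀ x : ℝ, Summable fun P : 𝓟 => walshCarlesonTerm N f P x) ∧
        MemLp (walshCarleson 𝓟 N f) p volume ∧
        eLpNorm (walshCarleson 𝓟 N f) p volume ≤ C * eLpNorm f p volume := by
  obtain ⟨C, hC⟩ := exists_eLpNorm_carlesonSum_le hp_one hp_top
  refine ⟨C, fun 𝓟 N hN f hf => ⟨summable_walshCarlesonTerm hp_one hp_top 𝓟 N hf, ?_⟩⟩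
  suffices h : AEStronglyMeasurable (walshCarleson 𝓟 N f) volume ∧
      eLpNorm (walshCarleson 𝓟 N f) p volume ≤ C * eLpNorm f p volume from
    ⟨⟨h.1, h.2.trans_lt (ENNReal.mul_lt_top ENNReal.coe_lt_top hf.2)⟩, h.2⟩
  wlog hNm : Measurable N generalizing N with hwlog
  · have hae : walshCarleson 𝓟 N f =ᵐ[volume] walshCarleson 𝓟 (hN.mk N) f := by
      filter_upwards [hN.ae_eq_mk] with x hx
      classical
      simp only [walshCarleson, walshCarlesonTerm, Set.indicator_apply, Set.mem_ofPred_eq, hx]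
    obtain ⟨h1, h2⟩ := hwlog (hN.mk N) hN.measurable_mk.aemeasurable hN.measurable_mk
    exact ⟨h1.congr hae.symm, by rwa [eLpNorm_congr_ae hae]⟩
  obtain ⟨s, hs⟩ := Filter.exists_seq_tendsto (Filter.atTop : Filter (Finset 𝓟))
  let S : ℕ → ℝ → ℂ := fun n =>
    carlesonSum (fun P => P.sub₁.coeff f) N ((s n).map (Function.Embedding.subtype _))
  have hSm : ∀ n, AEStronglyMeasurable (S n) volume := fun n =>
    (measurable_carlesonSum _ hNm _).aestronglyMeasurable
  have hlim : ∀ᵐ x : ℝ, Filter.Tendsto (fun n => S n x) Filter.atTop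
      (nhds (walshCarleson 𝓟 N f x)) := by
    refine Filter.Eventually.of_forall fun x => ?_
    have h := (summable_walshCarlesonTerm hp_one hp_top 𝓟 N hf x).hasSum.comp hs
    refine h.congr fun n => ?_
    simp only [S, carlesonSum, Finset.sum_map, Function.comp_apply]
    rfl
  refine ⟨aestronglyMeasurable_of_tendsto_ae Filter.atTop hSm hlim, ?_⟩
  refine (Lp.eLpNorm_lim_le_liminf_eLpNorm hSm _ hlim).trans ?_
  refine Filter.liminf_le_of_le (by isBoundedDefault) fun b hb => ?_
  obtain ⟨n, hn⟩ := hb.exists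
  exact hn.trans (hC N hNm f hf _)
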